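/- **Proposition (residual bound for the mixed method).** Let $N\in\{2,3\}$, let $\Omega\subset\mathbf R^N$ be a bounded convex polygonal ($N=2$) or polyhedral ($N=3$) domain, and let $\mathcal T_h$ be a regular (conforming) triangulation of $\overline\Omega$ into closed triangles ($N=2$) or tetrahedra ($N=3$), with $\overline\Omega=\bigcup_{K\in\mathcal T_h}K$; $h_K$ and $h_\tau$ denote the diameters of an element $K$ and of a face $\tau$ (a side if $N=2$). Let $m\ge 1$ and $$V_h^m=\{v\in C(\overline\Omega):\ v|_K\in P_m(K)\ \ \forall K\in\mathcal T_h\}.$$ Let $\varepsilon>0$, $T>0$, and $f=F'$, where $F$ is a smooth double equal well potential with global minimum value $0$ attained at $\pm1$. Let $(u_h,\varphi_h):[0,T]\to[V_h^m]^2$ be a solution of the semidiscrete Ciarlet–Raviart mixed method for the Cahn–Hilliard equation: for all $t\in(0,T]$, $$\Bigl(\tfrac{\partial u_h}{\partial t},\psi_h\Bigr)+(\nabla\varphi_h,\nabla\psi_h)=0\quad\forall\psi_h\in V_h^m,$$ $$\varepsilon(\nabla u_h,\nabla\chi_h)+\tfrac1\varepsilon(f(u_h),\chi_h)-(\varphi_h,\chi_h)=0\quad\forall\chi_h\in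 V_h^m,$$ where $(\cdot,\cdot)$ is the $L^2(\Omega)$ inner product. Define the residuals $r_h^{(1)}(t),r_h^{(2)}(t)\in (H^1(\Omega))^*$ by $$\langle r_h^{(1)}(t),\psi\rangle=\Bigl(\tfrac{\partial u_h}{\partial t},\psi\Bigr)+(\nabla\varphi_h,\nabla\psi),\qquad \langle \varepsilon r_h^{(2)}(t),\chi\rangle=\varepsilon(\nabla u_h,\nabla\chi)+\tfrac1\varepsilon(f(u_h),\chi)-(\varphi_h,\chi)$$ for all $\psi,\chi\in H^1(\Omega)$, and put $$\|r\|_{\widetilde H^{-1}}=\sup_{0\ne\psi\in H^1(\Omega)}\frac{\langle r,\psi\rangle}{\|\nabla\psi\|_{L^2(\Omega)}}\qquad\text{(with } 0/0=0,\ a/0=\infty \text{ for } a>0).$$ For $K\in\mathcal T_h$ let $$R_K^{(1)}=\frac{\partial u_h|_K}{\partial t}-\Delta(\varphi_h|_K),\qquad R_K^{(2)}=-\Delta(u_h|_K)+\frac1{\varepsilon^2}f(u_h|_K)-\frac1\varepsilon\varphi_h .$$ With $w^{(1)}=\varphi_h$ and $w^{(2)}=u_h$, let $J_\tau^{(j)}=(\nabla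 w^{(j)}|_{K_1}-\nabla w^{(j)}|_{K_2})\cdot n_1$ if $\tau$ is the common face of $K_1,K_2\in\mathcal T_h$ and $n_1$ is the unit normal to $\tau$ pointing from $K_1$ to $K_2$, and $J_\tau^{(j)}=2\nabla w^{(j)}|_K\cdot n$ if $\tau\subset\partial\Omega$ is a face of $K$ and $n$ is the outer unit normal. Put $$\eta_K^{(j)}(t)=h_K\|R_K^{(j)}\|_{L^2(K)}+\sum_{\tau\subset\partial K}\Bigl(\tfrac12h_\tau\|J_\tau^{(j)}\|_{L^2(\tau)}^2\Bigr)^{1/2},\qquad j=1,2.$$ Then for all $t\in(0,T]$ and $j=1,2$ $$\|r_h^{(j)}(t)\|_{\widetilde H^{-1}}^2\le C\sum_{K\in\mathcal T_h}\bigl(\eta_K^{(j)}(t)\bigr)^2,$$ where $C$ depends only on the minimum angle of the mesh: for every $\theta_0>0$ there is one constant $C>0$ that works for all $N,\Omega,m,\varepsilon,F,T,u_h,\varphi_h,t$ as above and all meshes $\mathcal T_h$ with minimum angle at least $\theta_0$. (The minimum angle is the smallest among the angles of the triangles and, if $N=3$, the angles of the triangular faces and the dihedral angles of the tetrahedra.)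 -/

import Mathlib

open MeasureTheory Set
open scoped ENNReal ContDiff RealInnerProductSpace

noncomputable section

namespace CahnHilliardFEM

/-- The Euclidean space `ℝ^N`. -/
abbrev Eu (N : ℕ) : Type := EuclideanSpace ℝ (Fin N)

variable {N : ℕ}

/-! ### The potential -/

/-- `F` is a smooth double equal well potential: it is smooth and takes its global minimum
value `0` at `±1`. The nonlinearity of the Cahn-Hilliard equation is `f = F'`. -/
structure IsDoubleWell (F : ℝ → ℝ) : Prop where
  smooth : ContDiff ℝ ∞ F
  nonneg : ∀ s, 0 ≤ F s
  one : F 1 = 0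
  neg_one : F (-1) = 0

/-! ### Triangulations -/

/-- A regular (that is, conforming) triangulation of `closure Ω` by closed `N`-simplices: a finite
simplicial complex, given through the vertex sets of its cells, all of whose maximal cells have
dimension `N`, and whose cells cover exactly `closure Ω`. -/
structure Triangulation (Ω : Set (Eu N)) where
  complex : Geometry.SimplicialComplex ℝ (Eu N)
  finite_faces : complex.faces.Finite
  pure : ∀ s ∈ complex.faces, ∃ K ∈ complex.faces, s ⊆ K ∧ K.card = N + 1
  space_eq : complex.space = closure Ω

/-- The elements of the mesh, each given by the set of its `N + 1` vertices. -/
def Triangulation.elements {Ω : Set (Eu N)} (T : Triangulation Ω) : Finset (Finset (Eu N)) :=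
  T.finite_faces.toFinset.filter fun K => K.card = N + 1

/-- The closed simplex with a given set of vertices. -/
def cell (K : Finset (Eu N)) : Set (Eu N) := convexHull ℝ (K : Set (Eu N))

open Classical in
/-- The face of the simplex `K` opposite to its vertex `v`. -/
def faceOpp (K : Finset (Eu N)) (v : Eu N) : Finset (Eu N) := K.erase v

/-- The component orthogonal to the hyperplane of the face opposite to `v` of the vector from `v`
to (the barycenter of) that face. -/
def heightVec (K : Finset (Eu N)) (v : Eu N) : Eu N :=
  (vectorSpan ℝ (faceOpp K v : Set (Eu N)))ᗮ.starProjection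
    ((faceOpp K v).centroid ℝ id - v)

/-- The outer unit normal to `K` on its face opposite to the vertex `v`. -/
def outerNormal (K : Finset (Eu N)) (v : Eu N) : Eu N := ‖heightVec K v‖⁻¹ • heightVec K v

/-- The angles of the mesh: the plane angles of its triangles (the elements if `N = 2`, their
faces if `N = 3`), and the dihedral angles between the faces of its elements (which for `N = 2`
are the plane angles again). The minimum angle is the least element of this set. -/
def Triangulation.angles {Ω : Set (Eu N)} (T : Triangulation Ω) : Set ℝ :=
  {α | ∃ K ∈ T.elements, ∃ a ∈ K, ∃ b ∈ K, ∃ c ∈ K, a ≠ b ∧ b ≠ c ∧ a ≠ c ∧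
      α = EuclideanGeometry.angle a b c} ∪
  {α | ∃ K ∈ T.elements, ∃ a ∈ K, ∃ b ∈ K, a ≠ b ∧
      α = Real.pi - InnerProductGeometry.angle (outerNormal K a) (outerNormal K b)}

/-! ### Function spaces -/

/-- `ψ ∈ H¹(Ω)` with weak gradient `g`. -/
structure IsH1 (Ω : Set (Eu N)) (ψ : Eu N → ℝ) (g : Eu N → Eu N) : Prop where
  memLp : MemLp ψ 2 (volume.restrict Ω)
  memLp_grad : MemLp g 2 (volume.restrict Ω)
  integral_by_parts : ∀ ζ : Eu N → ℝ, ContDiff ℝ ∞ ζ → HasCompactSupport ζ → tsupport ζ ⊆ Ω →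
    ∀ i : Fin N, ∫ x in Ω, ψ x * fderiv ℝ ζ x (EuclideanSpace.single i 1) =
      -∫ x in Ω, g x i * ζ x

/-- The `P_m` conforming finite element space `V_h^m`: functions that are continuous on
`closure Ω` and on each element agree with a polynomial of total degree at most `m`.
The values outside `closure Ω` are irrelevant. -/
def feSpace {Ω : Set (Eu N)} (T : Triangulation Ω) (m : ℕ) : Set (Eu N → ℝ) :=
  {v | ContinuousOn v (closure Ω) ∧ ∀ K ∈ T.elements, ∃ p : MvPolynomial (Fin N) ℝ,
    p.totalDegree ≤ m ∧ ∀ x ∈ cell K, v x = MvPolynomial.eval (fun i => x i) p}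

/-- The norm of `(H¹(Ω))*` given by `sup_{ψ} ⟨r, ψ⟩ / ‖∇ψ‖_{L²(Ω)}`, as an extended nonnegative
real; `r` acts on an `H¹` function together with its weak gradient. In the quotient `0 / 0 = 0`,
and `a / 0 = ∞` for `a > 0`, so that the norm is finite only if `r` vanishes on constants. -/
def dualNorm (Ω : Set (Eu N)) (r : (Eu N → ℝ) → (Eu N → Eu N) → ℝ) : ℝ≥0∞ :=
  ⨆ (ψ : Eu N → ℝ) (g : Eu N → Eu N) (_ : IsH1 Ω ψ g),
    ENNReal.ofReal (r ψ g) / ENNReal.ofReal (√(∫ x in Ω, ‖g x‖ ^ 2))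

/-! ### The semidiscrete mixed method and its residuals

The gradient of a function in `V_h^m` is its classical gradient, which exists off the faces of the
mesh, hence almost everywhere, and is its weak gradient. -/

/-- The time derivative at `t`, pointwise in space, of a function on `[0, T]`. -/
def timeDeriv (T : ℝ) (u : ℝ → Eu N → ℝ) (t : ℝ) (x : Eu N) : ℝ :=
  derivWithin (fun s => u s x) (Icc 0 T) t

/-- `⟨r⁽¹⁾, ψ⟩ = (u_t, ψ) + (∇φ, ∇ψ)`, where `ut = u_t` and `g = ∇ψ`. -/
def residual₁ (Ω : Set (Eu N)) (ut φ : Eu N → ℝ) (ψ : Eu N → ℝ) (g : Eu N → Eu N) : ℝ :=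
  (∫ x in Ω, ut x * ψ x) + ∫ x in Ω, ⟪gradient φ x, g x⟫

/-- `⟨r⁽²⁾, χ⟩ = ε⁻¹ (ε (∇u, ∇χ) + ε⁻¹ (f(u), χ) - (φ, χ))`, where `g = ∇χ`. -/
def residual₂ (Ω : Set (Eu N)) (ε : ℝ) (f : ℝ → ℝ) (u φ : Eu N → ℝ)
    (χ : Eu N → ℝ) (g : Eu N → Eu N) : ℝ :=
  ε⁻¹ * (ε * (∫ x in Ω, ⟪gradient u x, g x⟫) + ε⁻¹ * (∫ x in Ω, f (u x) * χ x)
    - ∫ x in Ω, φ x * χ x)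

/-- `(u, φ) : [0, T] → V_h^m × V_h^m` solves the continuous in time, semidiscrete in space
Ciarlet-Raviart mixed finite element equations for the Cahn-Hilliard equation on `(0, T]`. -/
structure IsMixedSolution {Ω : Set (Eu N)} (𝒯 : Triangulation Ω) (m : ℕ) (ε : ℝ) (f : ℝ → ℝ)
    (T : ℝ) (u φ : ℝ → Eu N → ℝ) : Prop where
  mem_u : ∀ t ∈ Icc 0 T, u t ∈ feSpace 𝒯 m
  mem_φ : ∀ t ∈ Icc 0 T, φ t ∈ feSpace 𝒯 m
  differentiable : ∀ t ∈ Ioc 0 T, ∀ x ∈ closure Ω,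
    DifferentiableWithinAt ℝ (fun s => u s x) (Icc 0 T) t
  eq₁ : ∀ t ∈ Ioc 0 T, ∀ ψ ∈ feSpace 𝒯 m,
    (∫ x in Ω, timeDeriv T u t x * ψ x) + (∫ x in Ω, ⟪gradient (φ t) x, gradient ψ x⟫) = 0
  eq₂ : ∀ t ∈ Ioc 0 T, ∀ χ ∈ feSpace 𝒯 m,
    ε * (∫ x in Ω, ⟪gradient (u t) x, gradient χ x⟫) + ε⁻¹ * (∫ x in Ω, f (u t x) * χ x)
      - (∫ x in Ω, φ t x * χ x) = 0

/-! ### The error estimators -/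

/-- The element residual `R_K⁽¹⁾ = u_t|_K - Δ(φ|_K)`. -/
def elemRes₁ (ut φ : Eu N → ℝ) (K : Finset (Eu N)) (x : Eu N) : ℝ :=
  ut x - InnerProductSpace.laplacianWithin φ (cell K) x

/-- The element residual `R_K⁽²⁾ = -Δ(u|_K) + ε⁻² f(u|_K) - ε⁻¹ φ`. -/
def elemRes₂ (ε : ℝ) (f : ℝ → ℝ) (u φ : Eu N → ℝ) (K : Finset (Eu N)) (x : Eu N) : ℝ :=
  -InnerProductSpace.laplacianWithin u (cell K) x + (ε ^ 2)⁻¹ * f (u x) - ε⁻¹ * φ x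

/-- The normal derivative `∇(w|_K) · n` on the face of `K` opposite to `v`, `n` being the outer
unit normal to `K` on that face. -/
def normalDeriv (w : Eu N → ℝ) (K : Finset (Eu N)) (v : Eu N) (x : Eu N) : ℝ :=
  fderivWithin ℝ w (cell K) x (outerNormal K v)

open Classical in
/-- The jump `J_τ` of the normal derivative of `w` across the face `τ`.
On a face `τ ⊆ ∂Ω` it is `2 ∇(w|_K) · n`, where `K` is the only element with face `τ`.
On any other face there are exactly two elements `K₁, K₂` with face `τ`, their outer normals on `τ`
are opposite, and the sum is `(∇(w|_{K₁}) - ∇(w|_{K₂})) · n₁`. -/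
def jump {Ω : Set (Eu N)} (𝒯 : Triangulation Ω) (w : Eu N → ℝ) (τ : Finset (Eu N))
    (x : Eu N) : ℝ :=
  (if cell τ ⊆ frontier Ω then 2 else 1) *
    ∑ K ∈ 𝒯.elements, ∑ v ∈ K with faceOpp K v = τ, normalDeriv w K v x

/-- The `L²` norm over an element, with respect to Lebesgue measure. -/
def elemNorm (K : Finset (Eu N)) (R : Eu N → ℝ) : ℝ := √(∫ x in cell K, R x ^ 2)

/-- The `L²` norm over a face, with respect to the `(N - 1)`-dimensional surface measure. -/
def faceNorm (τ : Finset (Eu N)) (J : Eu N → ℝ) : ℝ := √(∫ x in cell τ, J x ^ 2 ∂μHE[N - 1])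

/-- The estimator `h_K ‖R‖_{L²(K)} + ∑_{τ ⊂ ∂K} (h_τ ‖J_τ‖²_{L²(τ)} / 2)^{1/2}`, for an element
residual `R` and the jumps of the normal derivative of `w`. -/
def estimator {Ω : Set (Eu N)} (𝒯 : Triangulation Ω) (R w : Eu N → ℝ) (K : Finset (Eu N)) : ℝ :=
  Metric.diam (cell K) * elemNorm K R +
    ∑ v ∈ K, √(1 / 2 * Metric.diam (cell (faceOpp K v)) *
      faceNorm (faceOpp K v) (jump 𝒯 w (faceOpp K v)) ^ 2)

/-- `η_K⁽¹⁾`. -/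
def η₁ {Ω : Set (Eu N)} (𝒯 : Triangulation Ω) (ut φ : Eu N → ℝ) (K : Finset (Eu N)) : ℝ :=
  estimator 𝒯 (elemRes₁ ut φ K) φ K

/-- `η_K⁽²⁾`. -/
def η₂ {Ω : Set (Eu N)} (𝒯 : Triangulation Ω) (ε : ℝ) (f : ℝ → ℝ) (u φ : Eu N → ℝ)
    (K : Finset (Eu N)) : ℝ :=
  estimator 𝒯 (elemRes₂ ε f u φ K) u K

end CahnHilliardFEM

end

open MeasureTheory Set
open scoped ENNReal ContDiff RealInnerProductSpace

noncomputable section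

namespace CahnHilliardFEM

variable {N : ℕ}

/-! ### Nondegenerate simplices and barycentric coordinates -/

/-! Both residuals have the form `⟨r, ψ⟩ = (b, ψ) + (∇w, ∇ψ)` with `w` in the finite element space
and `b` continuous on every element, and both vanish on that space (Galerkin orthogonality). In the
second one the powers of `ε` are absorbed into `b`. So one estimate, `dualNorm_sq_le_of_galerkin`,
serves both, with a constant that does not see `ε`, `F` or `m`.

For a `C¹` function `ψ` let `I` be its quasi-interpolant: the continuous piecewise affine function
whose value at a vertex `z` is a constant that approximates `ψ` near `z`. Orthogonality gives `⟨r,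
ψ⟩ = ⟨r, ψ - I⟩`, and integration by parts on each element turns this into element residuals and
jumps of normal derivatives tested with `ψ - I`. By Cauchy-Schwarz it remains to bound `‖ψ - I‖` by
`h_K ‖∇ψ‖` on an element `K` and by `h_τ^{1/2} ‖∇ψ‖` on its faces, with `∇ψ` measured on the
elements that share a vertex with `K`; these neighbourhoods have bounded overlap
(`sq_residual_le_of_contDiff`). Density of `C¹` functions (`exists_contDiff_approx`) extends the
bound to `H¹`.

The constants come from the minimum angle alone. It bounds the heights of an element below by a
multiple `κ` of its diameter (`exists_shapeRegular`). Hence the elements at a vertex are bounded in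
number (`card_star_mul_le`) and, being linked by chains in which neighbours share an edge,
comparable in size (`pow_card_mul_diam_le`). The patch of elements around a vertex need not be
convex, so the Poincaré inequality is applied on the intersection of the convex set `Ω` with a small
ball, and then carried to each element through a shrunken copy of that element
(`exists_sqDev_le_energy_patch`).

Integration by parts and the trace inequality both rest on the identity `height_mul_integral_face`,
obtained by integrating over a simplex along the rays from a vertex. -/

/-- `K` is the vertex set of a nondegenerate `N`-simplex in `ℝ^N`. -/
structure IsSimplex (K : Finset (Eu N)) : Prop where
  card : K.card = N + 1
  indep : AffineIndependent ℝ ((↑) : K → Eu N)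

/-- The barycentric coordinate of `x` with respect to the vertex `v` of `K`. -/
def bary (K : Finset (Eu N)) (v x : Eu N) : ℝ :=
  1 - ⟪heightVec K v, x - v⟫ / ‖heightVec K v‖ ^ 2

lemma bary_self (K : Finset (Eu N)) (v : Eu N) : bary K v v = 1 := by simp [bary]

/-- `bary K v` is affine with gradient `-heightVec K v / ‖heightVec K v‖ ^ 2`, so its Lipschitz
constant is the reciprocal of the height over the face opposite to `v`. -/
lemma bary_eq_add (K : Finset (Eu N)) (v x y : Eu N) :
    bary K v x = bary K v y - ⟪heightVec K v, x - y⟫ / ‖heightVec K v‖ ^ 2 := by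
  have : x - v = (x - y) + (y - v) := by abel
  simp only [bary]
  rw [this, inner_add_right]
  ring

lemma bary_lineMap (K : Finset (Eu N)) (v x y : Eu N) (t : ℝ) :
    bary K v (x + t • (y - x)) = (1 - t) * bary K v x + t * bary K v y := by
  rw [bary_eq_add K v (x + t • (y - x)) x, bary_eq_add K v y x]
  simp only [add_sub_cancel_left, inner_smul_right]
  ring

lemma continuous_bary (K : Finset (Eu N)) (v : Eu N) : Continuous (bary K v) := by
  unfold bary; fun_prop

lemma isCompact_cell (K : Finset (Eu N)) : IsCompact (cell K) :=
  K.finite_toSet.isCompact_convexHull (𝕜 := ℝ)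

lemma convex_cell (K : Finset (Eu N)) : Convex ℝ (cell K) := convex_convexHull ℝ _

lemma measurableSet_cell (K : Finset (Eu N)) : MeasurableSet (cell K) :=
  (isCompact_cell K).isClosed.measurableSet

lemma subset_cell {K : Finset (Eu N)} {v : Eu N} (hv : v ∈ K) : v ∈ cell K :=
  subset_convexHull ℝ _ hv

lemma cell_mono {K L : Finset (Eu N)} (h : K ⊆ L) : cell K ⊆ cell L :=
  convexHull_mono (Finset.coe_subset.2 h)

lemma mem_faceOpp {K : Finset (Eu N)} {v w : Eu N} : w ∈ faceOpp K v ↔ w ≠ v ∧ w ∈ K := by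
  simp [faceOpp]

lemma faceOpp_subset (K : Finset (Eu N)) (v : Eu N) : faceOpp K v ⊆ K :=
  fun _ h => (mem_faceOpp.1 h).2

namespace IsSimplex

variable {K : Finset (Eu N)}

lemma card_faceOpp (hK : IsSimplex K) {v : Eu N} (hv : v ∈ K) : (faceOpp K v).card = N := by
  have := hK.card
  rw [faceOpp, Finset.card_erase_of_mem hv]; omega

lemma faceOpp_nonempty (hK : IsSimplex K) (hN : 1 ≤ N) {v : Eu N} (hv : v ∈ K) :
    (faceOpp K v).Nonempty := by
  rw [← Finset.card_pos, hK.card_faceOpp hv]; omega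

lemma affineSpan_eq_top (hK : IsSimplex K) : affineSpan ℝ (K : Set (Eu N)) = ⊤ := by
  have := hK.indep.affineSpan_eq_top_iff_card_eq_finrank_add_one.2
    (by simp [hK.card])
  simpa using this

lemma exists_weights (hK : IsSimplex K) (x : Eu N) :
    ∃ c : Eu N → ℝ, ∑ v ∈ K, c v = 1 ∧ ∑ v ∈ K, c v • v = x := by
  let b : AffineBasis K ℝ (Eu N) := ⟨(↑), hK.indep, by simpa using hK.affineSpan_eq_top⟩
  classical
  refine ⟨fun v => if h : v ∈ K then b.coord ⟨v, h⟩ x else 0, ?_, ?_⟩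
  · rw [← b.sum_coord_apply_eq_one x, ← Finset.sum_coe_sort]
    exact Finset.sum_congr rfl fun v _ => by simp
  · rw [← Finset.sum_coe_sort]
    conv_rhs => rw [← b.linear_combination_coord_eq_self x]
    exact Finset.sum_congr rfl fun v _ => by simp only [Finset.coe_mem, dite_true]; rfl

lemma heightVec_mem (K : Finset (Eu N)) (v : Eu N) :
    heightVec K v ∈ (vectorSpan ℝ (faceOpp K v : Set (Eu N)))ᗮ :=
  Submodule.starProjection_apply_mem _ _

lemma centroid_mem (hK : IsSimplex K) (hN : 1 ≤ N) {v : Eu N} (hv : v ∈ K) :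
    (faceOpp K v).centroid ℝ id ∈ affineSpan ℝ (faceOpp K v : Set (Eu N)) := by
  exact convexHull_subset_affineSpan _ (Finset.centroid_mem_convexHull _ (hK.faceOpp_nonempty hN hv))

/-- Points of the face differ by vectors orthogonal to the height, so `w` may be replaced by the
centroid, for which the pairing is that of a vector with its own projection. -/
lemma inner_heightVec (hK : IsSimplex K) (hN : 1 ≤ N) {v w : Eu N} (hv : v ∈ K)
    (hw : w ∈ faceOpp K v) : ⟪heightVec K v, w - v⟫ = ‖heightVec K v‖ ^ 2 := by
  set c := (faceOpp K v).centroid ℝ id with hc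
  have h1 : w - c ∈ vectorSpan ℝ (faceOpp K v : Set (Eu N)) := by
    rw [← direction_affineSpan]
    exact AffineSubspace.vsub_mem_direction (subset_affineSpan ℝ _ hw) (hK.centroid_mem hN hv)
  have h2 : ⟪heightVec K v, w - c⟫ = 0 :=
    Submodule.inner_left_of_mem_orthogonal h1 (heightVec_mem K v)
  have h3 : w - v = (w - c) + (c - v) := by abel
  rw [h3, inner_add_right, h2, zero_add, heightVec, ← hc, Submodule.inner_starProjection_left_eq_right,
    real_inner_comm, ← real_inner_self_eq_norm_sq, Submodule.inner_starProjection_left_eq_right,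
    Submodule.inner_starProjection_left_eq_right,
    Submodule.starProjection_eq_self_iff.2 (Submodule.starProjection_apply_mem _ _)]

lemma heightVec_ne_zero (hK : IsSimplex K) (hN : 1 ≤ N) {v : Eu N} (hv : v ∈ K) :
    heightVec K v ≠ 0 := by
  intro h
  rw [heightVec, Submodule.starProjection_apply_eq_zero_iff, Submodule.orthogonal_orthogonal] at h
  have h1 := hK.centroid_mem hN hv
  have h2 : v ∈ affineSpan ℝ (faceOpp K v : Set (Eu N)) := by
    rw [← direction_affineSpan] at h
    have := AffineSubspace.vadd_mem_of_mem_direction (neg_mem h) h1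
    simpa using this
  have := hK.indep.notMem_affineSpan_sdiff ⟨v, hv⟩ Set.univ
  apply this
  convert! h2 using 2
  ext w
  simp [mem_faceOpp, and_comm]

lemma norm_heightVec_pos (hK : IsSimplex K) (hN : 1 ≤ N) {v : Eu N} (hv : v ∈ K) :
    0 < ‖heightVec K v‖ := norm_pos_iff.2 (hK.heightVec_ne_zero hN hv)

lemma bary_of_ne (hK : IsSimplex K) (hN : 1 ≤ N) {v w : Eu N} (hv : v ∈ K) (hw : w ∈ K)
    (h : w ≠ v) : bary K v w = 0 := by
  have := (hK.norm_heightVec_pos hN hv).ne'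
  rw [bary, hK.inner_heightVec hN hv (mem_faceOpp.2 ⟨h, hw⟩)]
  field_simp
  ring

/-- An affine function with value `1` at `v` and `0` at the other vertices reads off the weight of
`v`. This identifies `bary` with the usual barycentric coordinates; membership in cells and faces is
decided through it. -/
lemma bary_combination (hK : IsSimplex K) (hN : 1 ≤ N) {c : Eu N → ℝ} (hc : ∑ v ∈ K, c v = 1)
    {v : Eu N} (hv : v ∈ K) : bary K v (∑ w ∈ K, c w • w) = c v := by
  classical
  have h1 : ∑ w ∈ K, c w • w - v = ∑ w ∈ K, c w • (w - v) := by
    simp_rw [smul_sub, Finset.sum_sub_distrib, ← Finset.sum_smul, hc, one_smul]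
  have h2 : bary K v (∑ w ∈ K, c w • w) = ∑ w ∈ K, c w * bary K v w := by
    simp_rw [bary, h1, inner_sum, inner_smul_right, mul_sub, Finset.sum_sub_distrib, mul_one, hc,
      Finset.sum_div, mul_div_assoc]
  rw [h2, Finset.sum_eq_single v]
  · rw [bary_self, mul_one]
  · intro w hw h
    rw [hK.bary_of_ne hN hv hw h, mul_zero]
  · exact fun h => absurd hv h

lemma sum_bary (hK : IsSimplex K) (hN : 1 ≤ N) (x : Eu N) : ∑ v ∈ K, bary K v x = 1 := by
  obtain ⟨c, hc, rfl⟩ := hK.exists_weights x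
  rw [Finset.sum_congr rfl fun v hv => hK.bary_combination hN hc hv, hc]

lemma sum_bary_smul (hK : IsSimplex K) (hN : 1 ≤ N) (x : Eu N) :
    ∑ v ∈ K, bary K v x • v = x := by
  obtain ⟨c, hc, rfl⟩ := hK.exists_weights x
  exact Finset.sum_congr rfl fun v hv => by rw [hK.bary_combination hN hc hv]

lemma mem_cell_iff (hK : IsSimplex K) (hN : 1 ≤ N) {x : Eu N} :
    x ∈ cell K ↔ ∀ v ∈ K, 0 ≤ bary K v x := by
  rw [cell, Finset.mem_convexHull']
  constructor
  · rintro ⟨c, hc0, hc, rfl⟩ v hv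
    rw [hK.bary_combination hN hc hv]
    exact hc0 v hv
  · exact fun h => ⟨fun v => bary K v x, h, hK.sum_bary hN x, hK.sum_bary_smul hN x⟩

lemma bary_eq_zero_of_notMem (hK : IsSimplex K) (hN : 1 ≤ N) {L : Finset (Eu N)} (hL : L ⊆ K)
    {x v : Eu N} (hx : x ∈ cell L) (hv : v ∈ K) (hvL : v ∉ L) : bary K v x = 0 := by
  classical
  rw [cell, Finset.mem_convexHull'] at hx
  obtain ⟨c, hc0, hc, rfl⟩ := hx
  have h1 : ∑ w ∈ K, (if w ∈ L then c w else 0) = 1 := by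
    rw [← hc, Finset.sum_ite_mem, Finset.inter_eq_right.2 hL]
  have h2 : ∑ w ∈ L, c w • w = ∑ w ∈ K, (if w ∈ L then c w else 0) • w := by
    simp_rw [ite_smul, zero_smul]
    rw [Finset.sum_ite_mem, Finset.inter_eq_right.2 hL]
  rw [h2, hK.bary_combination hN h1 hv, if_neg hvL]

lemma bary_combination_subset (hK : IsSimplex K) (hN : 1 ≤ N) {L : Finset (Eu N)} (hL : L ⊆ K)
    {x : Eu N} (hx : x ∈ cell L) : ∑ v ∈ L, bary K v x = 1 ∧ ∑ v ∈ L, bary K v x • v = x := by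
  constructor
  · rw [← hK.sum_bary hN x]
    exact Finset.sum_subset hL fun v hv h => hK.bary_eq_zero_of_notMem hN hL hx hv h
  · conv_rhs => rw [← hK.sum_bary_smul hN x]
    exact Finset.sum_subset hL fun v hv h => by
      rw [hK.bary_eq_zero_of_notMem hN hL hx hv h, zero_smul]

lemma mem_faceOpp_iff (hK : IsSimplex K) (hN : 1 ≤ N) {x v : Eu N} (hv : v ∈ K) :
    x ∈ cell (faceOpp K v) ↔ x ∈ cell K ∧ bary K v x = 0 := by
  classical
  constructor
  · exact fun h => ⟨cell_mono (faceOpp_subset K v) h,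
      hK.bary_eq_zero_of_notMem hN (faceOpp_subset K v) h hv (by simp [mem_faceOpp])⟩
  · rintro ⟨h, h0⟩
    rw [hK.mem_cell_iff hN] at h
    rw [cell, Finset.mem_convexHull']
    refine ⟨fun w => bary K w x, fun w hw => h w (faceOpp_subset K v hw), ?_, ?_⟩
    · rw [← hK.sum_bary hN x, ← Finset.add_sum_erase K _ hv, h0, zero_add]; rfl
    · conv_rhs => rw [← hK.sum_bary_smul hN x, ← Finset.add_sum_erase K _ hv, h0, zero_smul,
        zero_add]
      rfl

lemma bary_le_one (hK : IsSimplex K) (hN : 1 ≤ N) {x v : Eu N} (hv : v ∈ K) (hx : x ∈ cell K) :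
    bary K v x ≤ 1 := by
  rw [← hK.sum_bary hN x]
  exact Finset.single_le_sum ((hK.mem_cell_iff hN).1 hx) hv

lemma abs_bary_sub_le (hK : IsSimplex K) (hN : 1 ≤ N) {v : Eu N} (hv : v ∈ K) (x y : Eu N) :
    |bary K v x - bary K v y| ≤ ‖x - y‖ / ‖heightVec K v‖ := by
  have hp := hK.norm_heightVec_pos hN hv
  rw [bary_eq_add K v x y]
  have : bary K v y - ⟪heightVec K v, x - y⟫ / ‖heightVec K v‖ ^ 2 - bary K v y =
    - (⟪heightVec K v, x - y⟫ / ‖heightVec K v‖ ^ 2) := by ring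
  rw [this, abs_neg, abs_div, abs_of_pos (pow_pos hp 2), div_le_div_iff₀ (by positivity) hp]
  have := abs_real_inner_le_norm (heightVec K v) (x - y)
  nlinarith [norm_nonneg (x - y)]

/-- A ball around the barycenter that is contained in the simplex. -/
lemma closedBall_subset_cell (hK : IsSimplex K) (hN : 1 ≤ N) {r : ℝ}
    (hr : ∀ v ∈ K, r ≤ ‖heightVec K v‖) :
    Metric.closedBall (∑ v ∈ K, ((N : ℝ) + 1)⁻¹ • v) (r / (N + 1)) ⊆ cell K := by
  intro x hx
  rw [hK.mem_cell_iff hN]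
  intro v hv
  -- All coordinates of the barycenter equal `1 / (N + 1)`, and a displacement of length `r / (N +
  -- 1)` changes each of them by at most that amount.
  have h1 : ∑ v ∈ K, ((N : ℝ) + 1)⁻¹ = 1 := by
    rw [Finset.sum_const, hK.card]; simp; field_simp
  have h2 := hK.bary_combination hN (c := fun _ => ((N : ℝ) + 1)⁻¹) h1 hv
  have h3 := hK.abs_bary_sub_le hN hv x (∑ v ∈ K, ((N : ℝ) + 1)⁻¹ • v)
  rw [h2] at h3
  rw [mem_closedBall_iff_norm] at hx
  have hp := hK.norm_heightVec_pos hN hv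
  have h4 : ‖x - ∑ v ∈ K, ((N : ℝ) + 1)⁻¹ • v‖ / ‖heightVec K v‖ ≤ ((N : ℝ) + 1)⁻¹ := by
    rw [div_le_iff₀ hp]
    refine hx.trans ?_
    rw [div_eq_inv_mul]
    gcongr
    exact hr v hv
  have := (abs_le.1 (h3.trans h4)).1
  linarith

lemma exists_pos_le_heights (hK : IsSimplex K) (hN : 1 ≤ N) :
    ∃ r > 0, ∀ v ∈ K, r ≤ ‖heightVec K v‖ := by
  have hne : K.Nonempty := by rw [← Finset.card_pos, hK.card]; omega
  obtain ⟨w, hw, h⟩ := K.exists_min_image (fun v => ‖heightVec K v‖) hne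
  exact ⟨_, hK.norm_heightVec_pos hN hw, h⟩

lemma interior_cell_nonempty (hK : IsSimplex K) (hN : 1 ≤ N) : (interior (cell K)).Nonempty := by
  obtain ⟨r, hr, h⟩ := hK.exists_pos_le_heights hN
  have hp : 0 < r / ((N : ℝ) + 1) := by positivity
  exact ⟨_, interior_mono (hK.closedBall_subset_cell hN h)
    (mem_interior_iff_mem_nhds.2 (Metric.closedBall_mem_nhds _ hp))⟩

lemma interior_ae_eq_cell (_hK : IsSimplex K) :
    interior (cell K) =ᵐ[volume] cell K := by
  refine (interior_subset.eventuallyLE).antisymm ?_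
  rw [ae_le_set]
  refine measure_mono_null ?_ ((convex_cell K).addHaar_frontier volume)
  rw [(isCompact_cell K).isClosed.frontier_eq]

lemma uniqueDiffOn_cell (hK : IsSimplex K) (hN : 1 ≤ N) : UniqueDiffOn ℝ (cell K) :=
  uniqueDiffOn_convex (convex_cell K) (hK.interior_cell_nonempty hN)

lemma heightVec_le_dist (hK : IsSimplex K) (hN : 1 ≤ N) {v w : Eu N} (hv : v ∈ K) (hw : w ∈ K)
    (h : w ≠ v) : ‖heightVec K v‖ ≤ dist w v := by
  have hp := hK.norm_heightVec_pos hN hv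
  have h1 := hK.inner_heightVec hN hv (mem_faceOpp.2 ⟨h, hw⟩)
  have h2 := real_inner_le_norm (heightVec K v) (w - v)
  rw [h1] at h2
  rw [dist_eq_norm]
  nlinarith

end IsSimplex

lemma dist_le_diam_cell {K : Finset (Eu N)} {x y : Eu N} (hx : x ∈ cell K) (hy : y ∈ cell K) :
    dist x y ≤ Metric.diam (cell K) :=
  Metric.dist_le_diam_of_mem (isCompact_cell K).isBounded hx hy

lemma diam_cell_le {K : Finset (Eu N)} {C : ℝ} (hC : 0 ≤ C)
    (h : ∀ x ∈ K, ∀ y ∈ K, dist x y ≤ C) : Metric.diam (cell K) ≤ C := by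
  rw [cell, convexHull_diam]
  exact Metric.diam_le_of_forall_dist_le hC h


/-! ### Integration over simplices in conical coordinates, and the divergence theorem -/

namespace IsSimplex

variable {K : Finset (Eu N)}

lemma cone_mem_cell {v y : Eu N} (hv : v ∈ K)
    (hy : y ∈ cell (faceOpp K v)) {s : ℝ} (hs : s ∈ Ioc (0 : ℝ) 1) : v + s • (y - v) ∈ cell K :=
  (convex_cell K).add_smul_sub_mem (subset_cell hv) (cell_mono (faceOpp_subset K v) hy)
    ⟨hs.1.le, hs.2⟩

/-- The slice of a simplex parallel to the face opposite to `v`, at relative distance `s` from `v`,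
is that face scaled by `s` about `v`. -/
lemma inter_level_eq (hK : IsSimplex K) (hN : 1 ≤ N) {v : Eu N} (hv : v ∈ K) {t : Set (Eu N)}
    (ht : t ⊆ cell K) {s : ℝ} (hs : s ∈ Ioc (0 : ℝ) 1) :
    t ∩ {y | bary K v y = 1 - s} = AffineMap.homothety v s ''
      (cell (faceOpp K v) ∩ (fun y => v + s • (y - v)) ⁻¹' t) := by
  have hhom : ∀ y, AffineMap.homothety v s y = v + s • (y - v) := fun y => by
    simp [AffineMap.homothety_apply, add_comm]
  ext y
  constructor
  · rintro ⟨hyt, hy⟩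
    have hy' : v + s • ((v + s⁻¹ • (y - v)) - v) = y := by
      rw [add_sub_cancel_left, smul_smul, mul_inv_cancel₀ hs.1.ne', one_smul, add_sub_cancel]
    refine ⟨v + s⁻¹ • (y - v), ⟨?_, by simpa only [mem_preimage, hy'] using hyt⟩, by rw [hhom, hy']⟩
    set z := v + s⁻¹ • (y - v)
    have key : ∀ w, bary K w y = (1 - s) * bary K w v + s * bary K w z := fun w => by
      rw [← bary_lineMap, hy']
    have h0 : bary K v z = 0 := by
      have := key v
      rw [bary_self, hy.out] at this
      have hs0 := hs.1.ne'
      have h : s * bary K v z = 0 := by linarith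
      exact (mul_eq_zero.1 h).resolve_left hs0
    rw [hK.mem_faceOpp_iff hN hv, hK.mem_cell_iff hN]
    refine ⟨fun w hw => ?_, h0⟩
    by_cases hwv : w = v
    · rw [hwv, h0]
    · have h1 := key w
      rw [hK.bary_of_ne hN hw hv (Ne.symm hwv), mul_zero, zero_add] at h1
      have h2 := (hK.mem_cell_iff hN).1 (ht hyt) w hw
      rw [h1] at h2
      exact nonneg_of_mul_nonneg_right h2 hs.1
  · rintro ⟨z, ⟨hz, hzt⟩, rfl⟩
    rw [hhom]
    refine ⟨hzt, ?_⟩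
    rw [mem_ofPred_eq, bary_lineMap, bary_self, ((hK.mem_faceOpp_iff hN hv).1 hz).2]
    ring

/-- Fubini along the height vector: the hyperplane through `v + s • heightVec K v` is the level set
`bary K v = 1 - s`, and scaling the slice back to the face costs `s ^ (N - 1)`. -/
lemma volume_eq_lintegral_cone (hK : IsSimplex K) (hN : 1 ≤ N) {v : Eu N} (hv : v ∈ K)
    {t : Set (Eu N)} (htm : MeasurableSet t) (ht : t ⊆ cell K) :
    volume t = ‖heightVec K v‖ₑ * ∫⁻ s in Ioc (0 : ℝ) 1, ENNReal.ofReal (s ^ (N - 1)) *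
      μHE[N - 1] (cell (faceOpp K v) ∩ (fun y => v + s • (y - v)) ⁻¹' t) := by
  have h1 := EuclideanGeometry.euclideanHausdorffMeasure_eq_lintegral v
    (hK.heightVec_ne_zero hN hv) htm
  rw [InnerProductSpace.euclideanHausdorffMeasure_eq_volume, finrank_euclideanSpace_fin] at h1
  rw [h1, ← lintegral_indicator measurableSet_Ioc]
  congr 1
  refine lintegral_congr_ae ?_
  have hp := hK.norm_heightVec_pos hN hv
  filter_upwards [Measure.ae_ne volume 0] with s hs0
  have hplane : ((AffineSubspace.mk' (s • heightVec K v +ᵥ v) (ℝ ∙ heightVec K v)ᗮ :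
      AffineSubspace ℝ (Eu N)) : Set (Eu N)) = {y | bary K v y = 1 - s} := by
    ext y
    rw [SetLike.mem_coe, AffineSubspace.mem_mk', Submodule.mem_orthogonal_singleton_iff_inner_right,
      mem_ofPred_eq, bary]
    have h2 : y -ᵥ (s • heightVec K v +ᵥ v) = (y - v) - s • heightVec K v := by
      simp only [vsub_eq_sub, vadd_eq_add]; abel
    rw [h2, inner_sub_right, inner_smul_right, real_inner_self_eq_norm_sq, sub_eq_zero,
      sub_right_inj, div_eq_iff (by positivity)]
  rw [hplane]
  by_cases hs : s ∈ Ioc (0 : ℝ) 1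
  · rw [indicator_of_mem hs, hK.inter_level_eq hN hv ht hs,
      euclideanHausdorffMeasure_homothety_image _ _ hs0, ENNReal.smul_def, smul_eq_mul]
    congr 1
    rw [ENNReal.ofReal_pow hs.1.le, ENNReal.coe_pow, ← Real.enorm_of_nonneg hs.1.le]
    rfl
  · rw [indicator_of_notMem hs]
    refine (congrArg _ ?_).trans measure_empty
    rw [eq_empty_iff_forall_notMem]
    rintro y ⟨hyt, hy⟩
    apply hs
    have h2 := (hK.mem_cell_iff hN).1 (ht hyt) v hv
    have h3 := hK.bary_le_one hN hv (ht hyt)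
    rw [hy.out] at h2 h3
    exact ⟨lt_of_le_of_ne (by linarith) (Ne.symm hs0), by linarith⟩

lemma lintegral_pow_ne_zero (n : ℕ) : ∫⁻ s in Ioc (0 : ℝ) 1, ENNReal.ofReal (s ^ n) ≠ 0 := by
  rw [← ofReal_integral_eq_lintegral_ofReal]
  · rw [← intervalIntegral.integral_of_le zero_le_one, integral_pow]
    simp only [one_pow, ne_eq, ENNReal.ofReal_eq_zero, not_le]
    have : (0 : ℝ) ^ (n + 1) = 0 := by simp
    rw [this]; positivity
  · exact ((continuous_pow n).integrableOn_Icc).mono_set Ioc_subset_Icc_self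
  · exact (ae_restrict_iff' measurableSet_Ioc).2 (ae_of_all _ fun s hs => pow_nonneg hs.1.le n)

/-- With the whole cell as the set, the conical formula writes its finite volume as a positive
multiple of the measure of the face. -/
lemma measure_face_lt_top (hK : IsSimplex K) (hN : 1 ≤ N) {v : Eu N} (hv : v ∈ K) :
    μHE[N - 1] (cell (faceOpp K v)) < ⊤ := by
  have h1 := hK.volume_eq_lintegral_cone hN hv (measurableSet_cell K) subset_rfl
  have h2 : ∫⁻ s in Ioc (0 : ℝ) 1, ENNReal.ofReal (s ^ (N - 1)) *
      μHE[N - 1] (cell (faceOpp K v) ∩ (fun y => v + s • (y - v)) ⁻¹' cell K) =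
      ∫⁻ s in Ioc (0 : ℝ) 1, ENNReal.ofReal (s ^ (N - 1)) * μHE[N - 1] (cell (faceOpp K v)) := by
    refine setLIntegral_congr_fun measurableSet_Ioc fun s hs => ?_
    have h3 : cell (faceOpp K v) ⊆ (fun y => v + s • (y - v)) ⁻¹' cell K :=
      fun y hy => cone_mem_cell hv hy hs
    rw [inter_eq_left.2 h3]
  rw [h2, lintegral_mul_const _ (by fun_prop)] at h1
  have h3 : volume (cell K) < ⊤ := (isCompact_cell K).measure_lt_top
  rw [h1] at h3
  by_contra h
  rw [not_lt, top_le_iff] at h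
  have := (hK.norm_heightVec_pos hN hv).ne'
  rw [h, ENNReal.mul_top (lintegral_pow_ne_zero _), ENNReal.mul_top (by simpa using this)] at h3
  exact lt_irrefl _ h3

/-- The conical formula as an identity of measures, so that it applies to Bochner integrals and not
only to volumes. -/
lemma restrict_cell_eq_map_cone (hK : IsSimplex K) (hN : 1 ≤ N) {v : Eu N} (hv : v ∈ K) :
    volume.restrict (cell K) = ‖heightVec K v‖ₑ •
      (((volume.restrict (Ioc (0 : ℝ) 1)).withDensity fun s => ENNReal.ofReal (s ^ (N - 1))).prod
        (μHE[N - 1].restrict (cell (faceOpp K v)))).map fun p => v + p.1 • (p.2 - v) := by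
  have hfin : IsFiniteMeasure (μHE[N - 1].restrict (cell (faceOpp K v))) :=
    ⟨by simpa using hK.measure_face_lt_top hN hv⟩
  have hmeas : Measurable fun p : ℝ × Eu N => v + p.1 • (p.2 - v) := by fun_prop
  ext t ht
  rw [Measure.restrict_apply ht, hK.volume_eq_lintegral_cone hN hv (ht.inter (measurableSet_cell K))
    inter_subset_right, Measure.smul_apply, Measure.map_apply hmeas ht,
    Measure.prod_apply (hmeas ht), smul_eq_mul,
    lintegral_withDensity_eq_lintegral_mul _ (by fun_prop)
      (measurable_measure_prodMk_left (hmeas ht))]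
  congr 1
  refine setLIntegral_congr_fun measurableSet_Ioc fun s hs => ?_
  simp only [Pi.mul_apply]
  congr 1
  have hms : Measurable fun y : Eu N => v + s • (y - v) := by fun_prop
  change _ = (μHE[N - 1].restrict (cell (faceOpp K v))) ((fun y => v + s • (y - v)) ⁻¹' t)
  rw [Measure.restrict_apply (hms ht)]
  congr 1
  ext y
  simp only [mem_inter_iff, mem_preimage]
  exact ⟨fun h => ⟨h.2.1, h.1⟩, fun h => ⟨h.2, h.1, cone_mem_cell hv h.2 hs⟩⟩

lemma integral_cell_eq_cone (hK : IsSimplex K) (hN : 1 ≤ N) {v : Eu N} (hv : v ∈ K)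
    {g : Eu N → ℝ} (hg : Continuous g) :
    ∫ x in cell K, g x = ‖heightVec K v‖ * ∫ y in cell (faceOpp K v),
      (∫ s in (0 : ℝ)..1, s ^ (N - 1) * g (v + s • (y - v))) ∂μHE[N - 1] := by
  have hfin : IsFiniteMeasure (μHE[N - 1].restrict (cell (faceOpp K v))) :=
    ⟨by simpa using hK.measure_face_lt_top hN hv⟩
  have hmeas : Measurable fun p : ℝ × Eu N => v + p.1 • (p.2 - v) := by fun_prop
  have hp := (hK.norm_heightVec_pos hN hv).ne'
  have hint : IntegrableOn g (cell K) := hg.continuousOn.integrableOn_compact (isCompact_cell K)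
  rw [IntegrableOn, hK.restrict_cell_eq_map_cone hN hv, integrable_smul_measure
    (by simpa using hp) (by simp), integrable_map_measure hg.aestronglyMeasurable
    hmeas.aemeasurable, Function.comp_def] at hint
  rw [hK.restrict_cell_eq_map_cone hN hv, integral_smul_measure, integral_map hmeas.aemeasurable
    hg.aestronglyMeasurable, integral_prod_symm _ hint, toReal_enorm, smul_eq_mul]
  congr 2
  ext y
  rw [integral_withDensity_eq_integral_toReal_smul (by fun_prop) (by simp),
    intervalIntegral.integral_of_le zero_le_one]
  refine setIntegral_congr_fun measurableSet_Ioc fun s hs => ?_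
  simp [ENNReal.toReal_ofReal (pow_nonneg hs.1.le (N - 1))]

/-- The divergence theorem for the field `f x • (x - v)`, which is tangential to the faces
through `v`. -/
lemma height_mul_integral_face (hK : IsSimplex K) (hN : 1 ≤ N) {v : Eu N} (hv : v ∈ K)
    {f : Eu N → ℝ} (hf : ContDiff ℝ 1 f) :
    ‖heightVec K v‖ * ∫ y in cell (faceOpp K v), f y ∂μHE[N - 1] =
      ∫ x in cell K, (N * f x + fderiv ℝ f x (x - v)) := by
  have hc' : Continuous (fderiv ℝ f) := hf.continuous_fderiv (by norm_num)
  have hc : Continuous fun x => N * f x + fderiv ℝ f x (x - v) :=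
    (continuous_const.mul hf.continuous).add (hc'.clm_apply (by fun_prop))
  rw [hK.integral_cell_eq_cone hN hv hc]
  congr 2
  ext y
  -- The integrand along the ray is an exact derivative, so the integral over `[0, 1]` leaves the
  -- value `f y` on the face; the apex contributes nothing because `N ≥ 1`.
  have hd : ∀ s : ℝ, HasDerivAt (fun s : ℝ => s ^ N * f (v + s • (y - v)))
      (s ^ (N - 1) * (N * f (v + s • (y - v)) +
        fderiv ℝ f (v + s • (y - v)) (v + s • (y - v) - v))) s := by
    intro s
    have h1 : HasDerivAt (fun s : ℝ => v + s • (y - v)) (y - v) s := by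
      simpa using ((hasDerivAt_id s).smul_const (y - v)).const_add v
    have h2 := ((hf.differentiable (by norm_num)) (v + s • (y - v))).hasFDerivAt.comp_hasDerivAt s h1
    have h3 := (hasDerivAt_pow N s).mul h2
    refine h3.congr_deriv ?_
    obtain ⟨n, rfl⟩ : ∃ n, N = n + 1 := ⟨N - 1, by omega⟩
    simp only [Nat.add_sub_cancel, add_sub_cancel_left, map_smul, smul_eq_mul, Function.comp]
    ring
  have hcont : Continuous fun s : ℝ => s ^ (N - 1) * (N * f (v + s • (y - v)) +
        fderiv ℝ f (v + s • (y - v)) (v + s • (y - v) - v)) :=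
    (continuous_pow _).mul (hc.comp (by fun_prop : Continuous fun s : ℝ => v + s • (y - v)))
  rw [intervalIntegral.integral_eq_sub_of_hasDerivAt (fun s _ => hd s)
    (hcont.intervalIntegrable 0 1)]
  have : N ≠ 0 := by omega
  simp [this]

/-- These are the derivatives in direction `e` of `∑ bary = 1` and `∑ bary • v = x`, with the sign
reversed. They write the constant field `e` as a combination of the radial fields `x - v`, each of
which has flux through one face only. -/
lemma sum_inner_heightVec (hK : IsSimplex K) (hN : 1 ≤ N) (e x : Eu N) :
    ∑ v ∈ K, (⟪heightVec K v, e⟫ / ‖heightVec K v‖ ^ 2) = 0 ∧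
      ∑ v ∈ K, (⟪heightVec K v, e⟫ / ‖heightVec K v‖ ^ 2) • (x - v) = e := by
  have hb : ∀ v, ⟪heightVec K v, e⟫ / ‖heightVec K v‖ ^ 2 = bary K v 0 - bary K v e := fun v => by
    rw [bary_eq_add K v e 0, sub_zero]; ring
  have h0 : ∑ v ∈ K, (⟪heightVec K v, e⟫ / ‖heightVec K v‖ ^ 2) = 0 := by
    simp_rw [hb, Finset.sum_sub_distrib, hK.sum_bary hN, sub_self]
  refine ⟨h0, ?_⟩
  simp_rw [smul_sub, Finset.sum_sub_distrib, ← Finset.sum_smul, h0, zero_smul, hb, sub_smul,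
    Finset.sum_sub_distrib, hK.sum_bary_smul hN]
  simp

/-- The divergence theorem on a simplex for the field `f x • e`. -/
lemma integral_fderiv_apply (hK : IsSimplex K) (hN : 1 ≤ N) {f : Eu N → ℝ} (hf : ContDiff ℝ 1 f)
    (e : Eu N) : ∫ x in cell K, fderiv ℝ f x e =
      ∑ v ∈ K, ⟪outerNormal K v, e⟫ * ∫ y in cell (faceOpp K v), f y ∂μHE[N - 1] := by
  have hc' : Continuous (fderiv ℝ f) := hf.continuous_fderiv (by norm_num)
  have hc : ∀ v : Eu N, Continuous fun x => N * f x + fderiv ℝ f x (x - v) := fun v =>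
    (continuous_const.mul hf.continuous).add (hc'.clm_apply (by fun_prop))
  have h1 : ∀ v ∈ K, ⟪outerNormal K v, e⟫ * ∫ y in cell (faceOpp K v), f y ∂μHE[N - 1] =
      ∫ x in cell K, (⟪heightVec K v, e⟫ / ‖heightVec K v‖ ^ 2) *
        (N * f x + fderiv ℝ f x (x - v)) := by
    intro v hv
    rw [integral_const_mul, ← hK.height_mul_integral_face hN hv hf, outerNormal,
      real_inner_smul_left]
    have := (hK.norm_heightVec_pos hN hv).ne'
    field_simp
  rw [Finset.sum_congr rfl h1, ← integral_finsetSum]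
  · refine setIntegral_congr_fun (measurableSet_cell K) fun x _ => ?_
    obtain ⟨hs0, hs⟩ := hK.sum_inner_heightVec hN e x
    -- The terms `N * f x` cancel because the coefficients of the radial fields sum to zero.
    simp_rw [mul_add, Finset.sum_add_distrib, ← Finset.sum_mul, hs0, zero_mul, zero_add]
    conv_lhs => rw [← hs]
    simp
  · exact fun v _ => ((continuous_const.mul (hc v)).continuousOn.integrableOn_compact
      (isCompact_cell K))

lemma integrableOn_face (hK : IsSimplex K) (hN : 1 ≤ N) {v : Eu N} (hv : v ∈ K)
    {f : Eu N → ℝ} (hf : ContinuousOn f (cell (faceOpp K v))) :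
    IntegrableOn f (cell (faceOpp K v)) μHE[N - 1] := by
  have := hK.measure_face_lt_top hN hv
  have hfin : IsFiniteMeasure (μHE[N - 1].restrict (cell (faceOpp K v))) := ⟨by simpa using this⟩
  obtain ⟨C, hC⟩ := (isCompact_cell (faceOpp K v)).exists_bound_of_continuousOn hf
  exact Integrable.of_bound (hf.aestronglyMeasurable (measurableSet_cell _)) C
    ((ae_restrict_iff' (measurableSet_cell _)).2 (ae_of_all _ hC))

end IsSimplex


/-! ### Poincaré inequalities on convex sets -/

lemma lintegral_comp_add_smul {f : Eu N → ℝ≥0∞} (hf : Measurable f) (c : Eu N) {t : ℝ}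
    (ht : 0 < t) : ∫⁻ y, f (c + t • y) = ENNReal.ofReal ((t ^ N)⁻¹) * ∫⁻ y, f y := by
  have h1 : ∫⁻ y, f (c + t • y) = ∫⁻ z, f (c + z) ∂(Measure.map (t • ·) volume) := by
    rw [lintegral_map (by fun_prop) (by fun_prop)]
  rw [h1, Measure.map_addHaar_smul volume ht.ne', lintegral_smul_measure, smul_eq_mul,
    lintegral_add_left_eq_self, finrank_euclideanSpace_fin, abs_of_pos (by positivity)]

lemma setLIntegral_comp_add_smul_le {f : Eu N → ℝ≥0∞} (hf : Measurable f) (c : Eu N) {t : ℝ}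
    (ht : 0 < t) {D D' : Set (Eu N)} (hD : MeasurableSet D) (hD' : MeasurableSet D')
    (hmaps : ∀ y ∈ D, c + t • y ∈ D') :
    ∫⁻ y in D, f (c + t • y) ≤ ENNReal.ofReal ((t ^ N)⁻¹) * ∫⁻ y in D', f y := by
  rw [← lintegral_indicator hD', ← lintegral_comp_add_smul (hf.indicator hD') c ht,
    ← lintegral_indicator hD]
  refine lintegral_mono fun y => ?_
  by_cases hy : y ∈ D
  · rw [indicator_of_mem hy, indicator_of_mem (hmaps y hy)]
  · rw [indicator_of_notMem hy]; exact zero_le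

/-- For `t ≥ 1 / 2` substitute in `y`, with Jacobian factor `t ^ (-N) ≤ 2 ^ N`; otherwise exchange
`x` and `y`, which replaces `t` by `1 - t`. Convexity keeps the intermediate point in `D`. -/
lemma setLIntegral_segment_le {f : Eu N → ℝ≥0∞} (hf : Measurable f) {D : Set (Eu N)}
    (hD : MeasurableSet D) (hconv : Convex ℝ D) {t : ℝ} (ht : t ∈ Icc (0 : ℝ) 1) :
    ∫⁻ x in D, ∫⁻ y in D, f (x + t • (y - x)) ≤
      ENNReal.ofReal (2 ^ N) * volume D * ∫⁻ x in D, f x := by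
  have hpow : ∀ s : ℝ, 1 / 2 ≤ s → ENNReal.ofReal ((s ^ N)⁻¹) ≤ ENNReal.ofReal (2 ^ N) := by
    intro s hs
    apply ENNReal.ofReal_le_ofReal
    rw [← inv_pow]
    have : s⁻¹ ≤ 2 := by
      rw [inv_le_comm₀ (by linarith) (by norm_num)]; linarith
    exact pow_le_pow_left₀ (inv_nonneg.2 (by linarith)) this N
  have key : ∀ s ∈ Icc (0 : ℝ) 1, 1 / 2 ≤ s → ∀ x ∈ D,
      ∫⁻ y in D, f ((1 - s) • x + s • y) ≤ ENNReal.ofReal (2 ^ N) * ∫⁻ y in D, f y := by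
    intro s hs hs2 x hx
    refine (setLIntegral_comp_add_smul_le hf _ (by linarith) hD hD fun y hy => ?_).trans
      (mul_le_mul_left (hpow s hs2) _)
    exact hconv hx hy (by linarith [hs.2]) hs.1 (by ring)
  have hrep : ∀ x y : Eu N, x + t • (y - x) = (1 - t) • x + t • y := fun x y => by
    rw [smul_sub, sub_smul, one_smul]; abel
  have hfinal : ∫⁻ x in D, (ENNReal.ofReal (2 ^ N) * ∫⁻ y in D, f y) =
      ENNReal.ofReal (2 ^ N) * volume D * ∫⁻ x in D, f x := by
    rw [setLIntegral_const]; ring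
  rw [← hfinal]
  rcases le_total (1 / 2) t with h | h
  · refine setLIntegral_mono' hD fun x hx => ?_
    simp_rw [hrep]
    exact key t ht h x hx
  · rw [lintegral_lintegral_swap]
    · refine setLIntegral_mono' hD fun y hy => ?_
      have h1 := key (1 - t) ⟨by linarith [ht.2], by linarith [ht.1]⟩ (by linarith) y hy
      refine le_trans (le_of_eq ?_) h1
      refine lintegral_congr fun x => ?_
      rw [hrep, sub_sub_cancel, add_comm]
    · exact Measurable.aemeasurable (hf.comp (by fun_prop))

/-- The difference of the two sides is the variance of `a`. -/
lemma sq_integral_le_integral_sq {a : ℝ → ℝ} (ha : Continuous a) :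
    (∫ t in (0 : ℝ)..1, a t) ^ 2 ≤ ∫ t in (0 : ℝ)..1, a t ^ 2 := by
  set m := ∫ t in (0 : ℝ)..1, a t with hm
  have h0 : 0 ≤ ∫ t in (0 : ℝ)..1, (a t - m) ^ 2 :=
    intervalIntegral.integral_nonneg zero_le_one fun _ _ => sq_nonneg _
  have h1 : ∫ t in (0 : ℝ)..1, (a t - m) ^ 2 = (∫ t in (0 : ℝ)..1, a t ^ 2) - 2 * m * m + m ^ 2 := by
    have : ∀ t, (a t - m) ^ 2 = a t ^ 2 - 2 * m * a t + m ^ 2 := fun t => by ring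
    simp_rw [this]
    rw [intervalIntegral.integral_add, intervalIntegral.integral_sub,
      intervalIntegral.integral_const_mul, ← hm]
    · simp
    all_goals exact Continuous.intervalIntegrable (by fun_prop) _ _
  nlinarith

lemma ofReal_sq_sub_le {ψ : Eu N → ℝ} (hψ : ContDiff ℝ 1 ψ) {x y : Eu N} {d : ℝ}
    (hd : dist x y ≤ d) : ENNReal.ofReal ((ψ x - ψ y) ^ 2) ≤ ENNReal.ofReal (d ^ 2) *
      ∫⁻ t in Icc (0 : ℝ) 1, ENNReal.ofReal (‖fderiv ℝ ψ (x + t • (y - x))‖ ^ 2) := by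
  have hc' : Continuous (fderiv ℝ ψ) := hψ.continuous_fderiv (by norm_num)
  have hcγ : Continuous fun t : ℝ => x + t • (y - x) := by fun_prop
  have hc : Continuous fun t : ℝ => ‖fderiv ℝ ψ (x + t • (y - x))‖ := (hc'.comp hcγ).norm
  have hd0 : 0 ≤ d := dist_nonneg.trans hd
  have h1 : ψ y - ψ x = ∫ t in (0 : ℝ)..1, fderiv ℝ ψ (x + t • (y - x)) (y - x) := by
    rw [intervalIntegral.integral_eq_sub_of_hasDerivAt (f := fun t : ℝ => ψ (x + t • (y - x)))]
    · simp
    · intro t _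
      have h1 : HasDerivAt (fun s : ℝ => x + s • (y - x)) (y - x) t := by
        simpa using ((hasDerivAt_id t).smul_const (y - x)).const_add x
      exact ((hψ.differentiable (by norm_num)) _).hasFDerivAt.comp_hasDerivAt t h1
    · exact Continuous.intervalIntegrable ((hc'.comp hcγ).clm_apply continuous_const) _ _
  have h2 : |ψ y - ψ x| ≤ d * ∫ t in (0 : ℝ)..1, ‖fderiv ℝ ψ (x + t • (y - x))‖ := by
    rw [h1, ← Real.norm_eq_abs, ← intervalIntegral.integral_const_mul]
    refine intervalIntegral.norm_integral_le_of_norm_le zero_le_one ?_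
      ((continuous_const.mul hc).intervalIntegrable _ _)
    refine ae_of_all _ fun t _ => ?_
    refine (ContinuousLinearMap.le_opNorm _ _).trans ?_
    rw [mul_comm]
    gcongr
    rwa [← dist_eq_norm, dist_comm]
  have h3 : (ψ x - ψ y) ^ 2 ≤ d ^ 2 * ∫ t in (0 : ℝ)..1, ‖fderiv ℝ ψ (x + t • (y - x))‖ ^ 2 := by
    rw [← sq_abs, abs_sub_comm]
    calc |ψ y - ψ x| ^ 2 ≤ (d * ∫ t in (0 : ℝ)..1, ‖fderiv ℝ ψ (x + t • (y - x))‖) ^ 2 :=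
          pow_le_pow_left₀ (abs_nonneg _) h2 2
      _ ≤ _ := by
          rw [mul_pow]
          exact mul_le_mul_of_nonneg_left (sq_integral_le_integral_sq hc) (sq_nonneg d)
  refine (ENNReal.ofReal_le_ofReal h3).trans ?_
  rw [ENNReal.ofReal_mul (sq_nonneg d), intervalIntegral.integral_of_le zero_le_one,
    ← integral_Icc_eq_integral_Ioc, ofReal_integral_eq_lintegral_ofReal]
  · exact (hc.pow 2).continuousOn.integrableOn_Icc
  · exact ae_of_all _ fun t => sq_nonneg _

/-- The integral of the squared norm of the gradient, in `[0, ∞]`. -/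
def energy (ψ : Eu N → ℝ) (A : Set (Eu N)) : ℝ≥0∞ :=
  ∫⁻ x in A, ENNReal.ofReal (‖fderiv ℝ ψ x‖ ^ 2)

/-- Write `ψ x - ψ y` as an integral of the derivative along the segment, move the integral over the
segment parameter outside, and bound the double integral for each fixed parameter. -/
lemma lintegral_sq_sub_le {ψ : Eu N → ℝ} (hψ : ContDiff ℝ 1 ψ) {D : Set (Eu N)}
    (hD : MeasurableSet D) (hconv : Convex ℝ D) {d : ℝ} (hd : ∀ x ∈ D, ∀ y ∈ D, dist x y ≤ d) :
    ∫⁻ x in D, ∫⁻ y in D, ENNReal.ofReal ((ψ x - ψ y) ^ 2) ≤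
      ENNReal.ofReal (2 ^ N * d ^ 2) * volume D * energy ψ D := by
  have hc' : Continuous (fderiv ℝ ψ) := hψ.continuous_fderiv (by norm_num)
  set g : Eu N → ℝ≥0∞ := fun x => ENNReal.ofReal (‖fderiv ℝ ψ x‖ ^ 2) with hg
  have hgm : Measurable g := by
    exact (ENNReal.continuous_ofReal.comp (hc'.norm.pow 2)).measurable
  have hm3 : Measurable fun p : (Eu N × Eu N) × ℝ => g (p.1.1 + p.2 • (p.1.2 - p.1.1)) :=
    hgm.comp (by fun_prop)
  calc ∫⁻ x in D, ∫⁻ y in D, ENNReal.ofReal ((ψ x - ψ y) ^ 2)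
      ≤ ∫⁻ x in D, ∫⁻ y in D, ENNReal.ofReal (d ^ 2) *
          ∫⁻ t in Icc (0 : ℝ) 1, g (x + t • (y - x)) :=
        setLIntegral_mono' hD fun x hx => setLIntegral_mono' hD fun y hy =>
          ofReal_sq_sub_le hψ (hd x hx y hy)
    _ = ENNReal.ofReal (d ^ 2) * ∫⁻ t in Icc (0 : ℝ) 1, ∫⁻ x in D, ∫⁻ y in D,
          g (x + t • (y - x)) := by
        simp_rw [lintegral_const_mul' _ _ ENNReal.ofReal_ne_top]
        congr 1
        refine (lintegral_congr fun x => lintegral_lintegral_swap (f := fun y t =>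
          g (x + t • (y - x))) (Measurable.aemeasurable
          (hgm.comp (by fun_prop : Measurable fun p : Eu N × ℝ => x + p.2 • (p.1 - x))))).trans
          (lintegral_lintegral_swap (Measurable.aemeasurable ?_))
        have h4 : Measurable fun q : (Eu N × ℝ) × Eu N => g (q.1.1 + q.1.2 • (q.2 - q.1.1)) :=
          hgm.comp (by fun_prop)
        exact h4.lintegral_prod_right'
    _ ≤ ENNReal.ofReal (d ^ 2) * ∫⁻ t in Icc (0 : ℝ) 1,
          ENNReal.ofReal (2 ^ N) * volume D * energy ψ D :=
        mul_le_mul_right (setLIntegral_mono' measurableSet_Icc fun t ht =>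
          setLIntegral_segment_le hgm hD hconv ht) _
    _ = _ := by
        rw [setLIntegral_const, Real.volume_Icc, ENNReal.ofReal_mul (by positivity)]
        simp only [sub_zero, ENNReal.ofReal_one, mul_one]
        ring

/-- The squared `L²` distance of `ψ` to the constant `c`, in `[0, ∞]`. -/
def sqDev (ψ : Eu N → ℝ) (c : ℝ) (A : Set (Eu N)) : ℝ≥0∞ :=
  ∫⁻ x in A, ENNReal.ofReal ((ψ x - c) ^ 2)

/-- The constant is a value `ψ y` for which the deviation is at most its average over `y ∈ D`; that
average is the double integral already bounded. -/
lemma exists_sqDev_le {ψ : Eu N → ℝ} (hψ : ContDiff ℝ 1 ψ) {D : Set (Eu N)}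
    (hD : MeasurableSet D) (hconv : Convex ℝ D) {d : ℝ} (hd : ∀ x ∈ D, ∀ y ∈ D, dist x y ≤ d)
    (h0 : volume D ≠ 0) (htop : volume D ≠ ⊤) :
    ∃ c, sqDev ψ c D ≤ ENNReal.ofReal (2 ^ N * d ^ 2) * energy ψ D := by
  have hψm := hψ.continuous.measurable
  have hm : Measurable fun p : Eu N × Eu N => ENNReal.ofReal ((ψ p.1 - ψ p.2) ^ 2) := by fun_prop
  obtain ⟨y, hy, h⟩ := exists_le_setLAverage h0 htop
    (f := fun y => sqDev ψ (ψ y) D) (Measurable.aemeasurable hm.lintegral_prod_left')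
  refine ⟨ψ y, h.trans ?_⟩
  rw [setLAverage_eq]
  refine ENNReal.div_le_of_le_mul ?_
  unfold sqDev
  calc _ = ∫⁻ x in D, ∫⁻ y in D, ENNReal.ofReal ((ψ x - ψ y) ^ 2) :=
        lintegral_congr fun x => lintegral_congr fun y => by rw [sub_sq_comm]
    _ ≤ _ := (lintegral_sq_sub_le hψ hD hconv hd).trans (le_of_eq (by ring))

/-- Transfer of a bound for `ψ - c` on a subset of a convex set `D` to all of `D`. -/
lemma sqDev_le_of_subset {ψ : Eu N → ℝ} (hψ : ContDiff ℝ 1 ψ) {D D' : Set (Eu N)}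
    (hD : MeasurableSet D) (hconv : Convex ℝ D) {d : ℝ} (hd : ∀ x ∈ D, ∀ y ∈ D, dist x y ≤ d)
    (hsub : D' ⊆ D) (h0 : volume D ≠ 0) (htop : volume D ≠ ⊤)
    {L : ℝ} (hL : volume D ≤ ENNReal.ofReal L * volume D') (c : ℝ) :
    sqDev ψ c D ≤ ENNReal.ofReal (2 * L) *
      (ENNReal.ofReal (2 ^ N * d ^ 2) * energy ψ D + sqDev ψ c D') := by
  have hψm := hψ.continuous.measurable
  -- Integrate `(ψ x - c)² ≤ 2 (ψ x - ψ y)² + 2 (ψ y - c)²` over `x ∈ D` and `y ∈ D'`.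
  have h1 : volume D' * sqDev ψ c D ≤
      2 * (ENNReal.ofReal (2 ^ N * d ^ 2) * volume D * energy ψ D) +
        2 * (volume D * sqDev ψ c D') := by
    calc volume D' * sqDev ψ c D = ∫⁻ x in D, ∫⁻ _ in D', ENNReal.ofReal ((ψ x - c) ^ 2) := by
          simp_rw [setLIntegral_const]
          rw [lintegral_mul_const _ (by fun_prop), mul_comm, sqDev]
      _ ≤ ∫⁻ x in D, ∫⁻ y in D', (2 * ENNReal.ofReal ((ψ x - ψ y) ^ 2) +
            2 * ENNReal.ofReal ((ψ y - c) ^ 2)) := by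
          refine lintegral_mono fun x => lintegral_mono fun y => ?_
          dsimp only
          have h2 : (2 : ℝ≥0∞) = ENNReal.ofReal 2 := by simp
          rw [h2, ← ENNReal.ofReal_mul (by norm_num), ← ENNReal.ofReal_mul (by norm_num),
            ← ENNReal.ofReal_add (by positivity) (by positivity)]
          exact ENNReal.ofReal_le_ofReal (by nlinarith [sq_nonneg (ψ x - ψ y - (ψ y - c))])
      _ = 2 * (∫⁻ x in D, ∫⁻ y in D', ENNReal.ofReal ((ψ x - ψ y) ^ 2)) +
            2 * (volume D * sqDev ψ c D') := by
          have hm : ∀ x, Measurable fun y => 2 * ENNReal.ofReal ((ψ x - ψ y) ^ 2) := by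
            intro x; fun_prop
          simp_rw [lintegral_add_left (hm _), lintegral_const_mul' _ _ ENNReal.ofNat_ne_top]
          rw [lintegral_add_right _ measurable_const, setLIntegral_const,
            lintegral_const_mul' _ _ ENNReal.ofNat_ne_top]
          unfold sqDev
          ring
      _ ≤ _ := by
          gcongr
          exact (lintegral_mono fun x => lintegral_mono_set hsub).trans
            (lintegral_sq_sub_le hψ hD hconv hd)
  have h2 : volume D * sqDev ψ c D ≤ volume D * (ENNReal.ofReal (2 * L) *
      (ENNReal.ofReal (2 ^ N * d ^ 2) * energy ψ D + sqDev ψ c D')) := by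
    calc volume D * sqDev ψ c D ≤ ENNReal.ofReal L * (volume D' * sqDev ψ c D) := by
          rw [← mul_assoc]; gcongr
      _ ≤ ENNReal.ofReal L * (2 * (ENNReal.ofReal (2 ^ N * d ^ 2) * volume D * energy ψ D) +
        2 * (volume D * sqDev ψ c D')) := by gcongr
      _ = _ := by
        rw [ENNReal.ofReal_mul (by norm_num : (0 : ℝ) ≤ 2), ENNReal.ofReal_ofNat]; ring
  exact (ENNReal.mul_le_mul_iff_right h0 htop).1 h2


/-! ### Shape regularity from the minimum angle -/

namespace Triangulation

variable {Ω : Set (Eu N)} (𝒯 : Triangulation Ω)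

lemma mem_elements {K : Finset (Eu N)} :
    K ∈ 𝒯.elements ↔ K ∈ 𝒯.complex.faces ∧ K.card = N + 1 := by
  simp [elements]

lemma isSimplex {K : Finset (Eu N)} (hK : K ∈ 𝒯.elements) : IsSimplex K :=
  ⟨(𝒯.mem_elements.1 hK).2, 𝒯.complex.indep (𝒯.mem_elements.1 hK).1⟩

end Triangulation

lemma sin_le_sin_of_mem {θ α : ℝ} (h0 : 0 < θ) (h1 : θ ≤ α) (h2 : α ≤ Real.pi - θ) :
    Real.sin θ ≤ Real.sin α := by
  rcases le_total α (Real.pi / 2) with h | h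
  · exact Real.sin_le_sin_of_le_of_le_pi_div_two (by linarith) h h1
  · rw [← Real.sin_pi_sub α]
    exact Real.sin_le_sin_of_le_of_le_pi_div_two (by linarith) (by linarith) (by linarith)

/-- All plane angles of the simplex `K` are at least `θ`. -/
def PlaneAnglesGe (K : Finset (Eu N)) (θ : ℝ) : Prop :=
  ∀ a ∈ K, ∀ b ∈ K, ∀ c ∈ K, a ≠ b → b ≠ c → a ≠ c → θ ≤ EuclideanGeometry.angle a b c

section PlaneAngles

variable {K : Finset (Eu N)} {θ : ℝ}

/-- The angles of a triangle sum to `π`, so a lower bound for all of them also keeps each one below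
`π - θ`. -/
lemma PlaneAnglesGe.sin_le (h : PlaneAnglesGe K θ) (hθ : 0 < θ) {a b c : Eu N} (ha : a ∈ K)
    (hb : b ∈ K) (hc : c ∈ K) (hab : a ≠ b) (hbc : b ≠ c) (hac : a ≠ c) :
    Real.sin θ ≤ Real.sin (EuclideanGeometry.angle a b c) := by
  have h1 := h a ha b hb c hc hab hbc hac
  have h2 := h b hb c hc a ha hbc hac.symm hab.symm
  have h3 := EuclideanGeometry.angle_nonneg c a b
  have h4 := EuclideanGeometry.angle_add_angle_add_angle_eq_pi c hab.symm
  exact sin_le_sin_of_mem hθ h1 (by linarith)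

lemma PlaneAnglesGe.sin_mul_dist_le (h : PlaneAnglesGe K θ) (hθ : 0 < θ) {x y z : Eu N}
    (hx : x ∈ K) (hy : y ∈ K) (hz : z ∈ K) (hxy : x ≠ y) :
    Real.sin θ * dist x z ≤ dist x y := by
  have h1 := Real.sin_le_one θ
  by_cases hzx : z = x
  · rw [hzx, dist_self, mul_zero]; exact dist_nonneg
  by_cases hzy : z = y
  · rw [hzy]; exact mul_le_of_le_one_left dist_nonneg h1
  have h2 := EuclideanGeometry.law_sin z y x
  have h3 := h.sin_le hθ hx hz hy (Ne.symm hzx) hzy hxy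
  calc Real.sin θ * dist x z ≤ Real.sin (EuclideanGeometry.angle z y x) * dist x y := by
        rw [dist_comm x y, h2]; gcongr
    _ ≤ dist x y := mul_le_of_le_one_left dist_nonneg (Real.sin_le_one _)

/-- By the law of sines, edges with a common vertex are comparable with factor `sin θ`. Any two
edges of a simplex are joined by at most two such comparisons. -/
lemma PlaneAnglesGe.sin_sq_mul_diam_le (h : PlaneAnglesGe K θ) (hθ : 0 < θ)
    (hs : 0 < Real.sin θ) {x y : Eu N} (hx : x ∈ K) (hy : y ∈ K) (hxy : x ≠ y) :
    Real.sin θ ^ 2 * Metric.diam (cell K) ≤ dist x y := by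
  have h1 := Real.sin_le_one θ
  have h2 : Metric.diam (cell K) ≤ dist x y / Real.sin θ ^ 2 := by
    refine diam_cell_le (by positivity) fun p hp q hq => ?_
    rw [le_div_iff₀ (by positivity)]
    by_cases hpx : p = x
    · have h3 := h.sin_mul_dist_le hθ hx hy hq hxy
      rw [hpx]
      nlinarith [mul_nonneg (mul_nonneg hs.le (sub_nonneg.2 h1)) (dist_nonneg (x := x) (y := q))]
    · have h3 := h.sin_mul_dist_le hθ hx hy hp hxy
      have h4 := h.sin_mul_dist_le hθ hp hx hq hpx
      rw [dist_comm p x] at h4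
      nlinarith [dist_nonneg (x := p) (y := q)]
  rw [le_div_iff₀ (by positivity)] at h2
  linarith

end PlaneAngles

/-- Here `g` is the gradient, in the plane of the triangle with vertices `i`, `i + a`, `i + b`, of
the barycentric coordinate of `i`. The identity says that the height at `i` is twice the area
divided by the opposite side. -/
lemma norm_sq_mul_gram_eq {E : Type*} [NormedAddCommGroup E] [InnerProductSpace ℝ E] {g a b : E}
    {α β : ℝ} (hg : g = α • a + β • b) (ha : ⟪g, a⟫ = -1) (hb : ⟪g, b⟫ = -1) :
    ‖g‖ ^ 2 * (‖a‖ ^ 2 * ‖b‖ ^ 2 - ⟪a, b⟫ ^ 2) = ‖a - b‖ ^ 2 := by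
  have h1 : ‖g‖ ^ 2 = -(α + β) := by
    rw [← real_inner_self_eq_norm_sq]
    nth_rewrite 2 [hg]
    rw [inner_add_right, inner_smul_right, inner_smul_right, ha, hb]; ring
  rw [hg, inner_add_left, real_inner_smul_left, real_inner_smul_left, real_inner_self_eq_norm_sq]
    at ha
  rw [hg, inner_add_left, real_inner_smul_left, real_inner_smul_left, real_inner_self_eq_norm_sq]
    at hb
  rw [real_inner_comm a b] at ha
  rw [h1, norm_sub_sq_real]
  linear_combination (-(‖b‖ ^ 2 - ⟪a, b⟫)) * ha - (‖a‖ ^ 2 - ⟪a, b⟫) * hb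

/-- A bound for the gradient, in the plane of a triangle, of a barycentric coordinate. -/
lemma PlaneAnglesGe.norm_mul_le {K : Finset (Eu N)} {θ : ℝ} (h : PlaneAnglesGe K θ) (hθ : 0 < θ)
    (hs : 0 < Real.sin θ) {i j k g : Eu N} (hi : i ∈ K) (hj : j ∈ K) (hk : k ∈ K) (hij : i ≠ j)
    (hik : i ≠ k) (hjk : j ≠ k) {α β : ℝ} (hg : g = α • (j - i) + β • (k - i))
    (h1 : ⟪g, j - i⟫ = -1) (h2 : ⟪g, k - i⟫ = -1) :
    Real.sin θ ^ 5 * Metric.diam (cell K) * ‖g‖ ≤ 1 := by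
  have hgram := norm_sq_mul_gram_eq hg h1 h2
  set s := Real.sin θ with hsdef
  set d := Metric.diam (cell K)
  have hd : 0 ≤ d := Metric.diam_nonneg
  have hij' := h.sin_sq_mul_diam_le hθ hs hj hi hij.symm
  have hik' := h.sin_sq_mul_diam_le hθ hs hk hi hik.symm
  have hjk' : dist j k ≤ d := dist_le_diam_cell (subset_cell hj) (subset_cell hk)
  have hang := h.sin_le hθ hj hi hk hij.symm hik hjk
  have hG : ‖j - i‖ ^ 2 * ‖k - i‖ ^ 2 - ⟪j - i, k - i⟫ ^ 2 =
      (Real.sin (EuclideanGeometry.angle j i k) * (‖j - i‖ * ‖k - i‖)) ^ 2 := by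
    have := InnerProductGeometry.cos_angle_mul_norm_mul_norm (j - i) (k - i)
    rw [EuclideanGeometry.angle, vsub_eq_sub, vsub_eq_sub, ← this]
    linear_combination (-(‖j - i‖ * ‖k - i‖) ^ 2) * Real.sin_sq_add_cos_sq (InnerProductGeometry.angle (j - i) (k - i))
  rw [dist_eq_norm] at hij' hik' hjk'
  rw [hG, show j - i - (k - i) = j - k by abel, ← mul_pow] at hgram
  have hsin := hs.le.trans hang
  -- Twice the area is the sine of the angle at `i`, at least `s`, times two edges of length at
  -- least `s ^ 2 * d`; the opposite edge is at most `d`. This is where the fifth power arises.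
  have h3 : ‖g‖ * (s * (s ^ 2 * d * (s ^ 2 * d))) ≤ d := by
    calc ‖g‖ * (s * (s ^ 2 * d * (s ^ 2 * d))) ≤
        ‖g‖ * (Real.sin (EuclideanGeometry.angle j i k) * (‖j - i‖ * ‖k - i‖)) := by gcongr
      _ = ‖j - k‖ := by
        refine (pow_left_inj₀ ?_ (norm_nonneg _) two_ne_zero).1 hgram
        positivity
      _ ≤ d := hjk'
  rcases hd.eq_or_lt with h0 | h0
  · rw [← h0]; simp
  · have : d * (s ^ 5 * d * ‖g‖) ≤ d * 1 := by
      calc d * (s ^ 5 * d * ‖g‖) = ‖g‖ * (s * (s ^ 2 * d * (s ^ 2 * d))) := by ring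
        _ ≤ d * 1 := by linarith
    exact le_of_mul_le_mul_left this h0

namespace IsSimplex

variable {K : Finset (Eu N)}

/-- The coefficient of `w - i` is the derivative of `bary K w` in direction `e`. The vertex `i`
always drops out, and so does any `w` whose height vector is orthogonal to `e`; this places `e` in
the span of the remaining edges at `i`. -/
lemma eq_sum_of_orthogonal (hK : IsSimplex K) (hN : 1 ≤ N) (e i : Eu N) :
    e = ∑ w ∈ K, -(⟪heightVec K w, e⟫ / ‖heightVec K w‖ ^ 2) • (w - i) := by
  conv_lhs => rw [← (hK.sum_inner_heightVec hN e i).2]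
  refine Finset.sum_congr rfl fun w _ => ?_
  rw [neg_smul, ← smul_neg, neg_sub]

/-- At the foot of the perpendicular from `v` the coordinates of the `N` vertices of the opposite
face sum to `1`, so one of them is at least `1 / N`. For that vertex the height is at most `N` times
the height of `v`, and the two outer normals make an obtuse angle. -/
lemma exists_inner_heightVec_le (hK : IsSimplex K) (hN : 1 ≤ N) {v : Eu N} (hv : v ∈ K) :
    ∃ i ∈ faceOpp K v, ‖heightVec K i‖ ^ 2 ≤ -(N * ⟪heightVec K i, heightVec K v⟫) := by
  have hp := hK.norm_heightVec_pos hN hv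
  have hN0 : (0 : ℝ) < N := by exact_mod_cast hN
  set p := v + heightVec K v with hpdef
  have hvp : bary K v p = 0 := by
    rw [bary, hpdef, add_sub_cancel_left, real_inner_self_eq_norm_sq, div_self (by positivity),
      sub_self]
  have hsum : ∑ i ∈ faceOpp K v, bary K i p = 1 := by
    rw [← hK.sum_bary hN p, ← Finset.add_sum_erase K _ hv, hvp, zero_add]; rfl
  by_contra! hcon
  have h1 : ∑ i ∈ faceOpp K v, bary K i p < ∑ i ∈ faceOpp K v, (N : ℝ)⁻¹ := by
    refine Finset.sum_lt_sum_of_nonempty (hK.faceOpp_nonempty hN hv) fun i hi => ?_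
    have hi' := mem_faceOpp.1 hi
    have hpi := hK.norm_heightVec_pos hN hi'.2
    have h2 := hcon i hi
    rw [bary_eq_add K i p v, hK.bary_of_ne hN hi'.2 hv hi'.1.symm, hpdef, add_sub_cancel_left,
      zero_sub, ← neg_div, div_lt_iff₀ (by positivity), inv_mul_eq_div, lt_div_iff₀ hN0]
    linarith
  rw [hsum, Finset.sum_const, hK.card_faceOpp hv, nsmul_eq_mul, mul_inv_cancel₀ hN0.ne'] at h1
  exact lt_irrefl _ h1

end IsSimplex

lemma height_ge_of_triangle {K : Finset (Eu 2)} (hK : IsSimplex K) {θ : ℝ}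
    (h : PlaneAnglesGe K θ) (hθ : 0 < θ) (hs : 0 < Real.sin θ) {i : Eu 2} (hi : i ∈ K) :
    Real.sin θ ^ 5 * Metric.diam (cell K) ≤ ‖heightVec K i‖ := by
  classical
  have hN : 1 ≤ 2 := by norm_num
  obtain ⟨j, k, hjk, hF⟩ := Finset.card_eq_two.1 (hK.card_faceOpp hi)
  have hj : j ∈ faceOpp K i := by simp [hF]
  have hk : k ∈ faceOpp K i := by simp [hF]
  have hp := hK.norm_heightVec_pos hN hi
  set g := -(‖heightVec K i‖ ^ 2)⁻¹ • heightVec K i with hg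
  have hinner : ∀ w ∈ faceOpp K i, ⟪g, w - i⟫ = -1 := by
    intro w hw
    rw [hg, real_inner_smul_left, hK.inner_heightVec hN hi hw]
    field_simp
  have hrep := hK.eq_sum_of_orthogonal hN g i
  rw [← Finset.add_sum_erase K _ hi, sub_self, smul_zero, zero_add,
    show K.erase i = {j, k} from by convert! hF, Finset.sum_pair hjk] at hrep
  have := h.norm_mul_le hθ hs hi (mem_faceOpp.1 hj).2 (mem_faceOpp.1 hk).2 (mem_faceOpp.1 hj).1.symm
    (mem_faceOpp.1 hk).1.symm hjk hrep (hinner j hj) (hinner k hk)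
  have hgn : ‖g‖ = ‖heightVec K i‖⁻¹ := by
    rw [hg, norm_smul, norm_neg, norm_inv, norm_pow, norm_norm]; field_simp
  rwa [hgn, ← div_eq_mul_inv, div_le_one hp] at this

/-- For the vertex `i` of `exists_inner_heightVec_le`, the height at `i` is at most three times that
at `v`. The height at `i` is in turn at least the sine of the dihedral angle times the height of the
triangular face opposite to `v` at its vertex `i`, which the plane angles control. -/
lemma height_ge_of_tetrahedron {K : Finset (Eu 3)} (hK : IsSimplex K) {θ : ℝ}
    (h : PlaneAnglesGe K θ) (hdih : ∀ a ∈ K, ∀ b ∈ K, a ≠ b →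
      θ ≤ Real.pi - InnerProductGeometry.angle (outerNormal K a) (outerNormal K b))
    (hθ : 0 < θ) (hs : 0 < Real.sin θ) {v : Eu 3} (hv : v ∈ K) :
    Real.sin θ ^ 6 / 3 * Metric.diam (cell K) ≤ ‖heightVec K v‖ := by
  classical
  have hN : 1 ≤ 3 := by norm_num
  obtain ⟨i, hiF, hile⟩ := hK.exists_inner_heightVec_le hN hv
  obtain ⟨hiv, hi⟩ := mem_faceOpp.1 hiF
  have hcard : ((faceOpp K v).erase i).card = 2 := by
    rw [Finset.card_erase_of_mem hiF, hK.card_faceOpp hv]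
  obtain ⟨j, k, hjk, hF⟩ := Finset.card_eq_two.1 hcard
  have hj : j ∈ (faceOpp K v).erase i := by simp [hF]
  have hk : k ∈ (faceOpp K v).erase i := by simp [hF]
  have hpv := hK.norm_heightVec_pos hN hv
  have hpi := hK.norm_heightVec_pos hN hi
  set hvv := heightVec K v with hvv_def
  set hii := heightVec K i with hii_def
  have hneg : ⟪hii, hvv⟫ < 0 := by
    have : 0 < ‖hii‖ ^ 2 := by positivity
    push_cast at hile
    linarith
  have h1 : ‖hii‖ ≤ 3 * ‖hvv‖ := by
    have h2 := neg_le_of_abs_le (abs_real_inner_le_norm hii hvv)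
    push_cast at hile
    nlinarith
  have hangle : Real.sin θ ≤ Real.sin (InnerProductGeometry.angle hii hvv) := by
    have h2 := hdih i hi v hv hiv
    rw [outerNormal, outerNormal, InnerProductGeometry.angle_smul_left_of_pos _ _ (inv_pos.2 hpi),
      InnerProductGeometry.angle_smul_right_of_pos _ _ (inv_pos.2 hpv)] at h2
    -- The choice of `i` makes this dihedral angle at most a right angle, so its lower bound alone
    -- keeps the sine away from zero.
    have h3 : Real.pi / 2 ≤ InnerProductGeometry.angle hii hvv := by
      by_contra! hlt
      have h4 := Real.cos_nonneg_of_neg_pi_div_two_le_of_le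
        (by linarith [InnerProductGeometry.angle_nonneg hii hvv, Real.pi_pos]) hlt.le
      have h5 := InnerProductGeometry.cos_angle_mul_norm_mul_norm hii hvv
      have h6 : 0 ≤ ‖hii‖ * ‖hvv‖ := by positivity
      linarith [mul_nonneg h4 h6]
    exact sin_le_sin_of_mem hθ (by linarith) (by linarith)
  -- The gradient of `bary K i` projected to the plane of the face opposite to `v`: the gradient of
  -- the same coordinate within that triangle. Its norm is the sine of the angle between the normals
  -- divided by `‖hii‖`.
  set g := -(‖hii‖ ^ 2)⁻¹ • (hii - (⟪hii, hvv⟫ / ‖hvv‖ ^ 2) • hvv) with hg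
  have hgv : ⟪hvv, g⟫ = 0 := by
    rw [hg, inner_smul_right, inner_sub_right, inner_smul_right, real_inner_self_eq_norm_sq,
      div_mul_cancel₀ _ (by positivity), real_inner_comm, sub_self, mul_zero]
  have hinner : ∀ w ∈ (faceOpp K v).erase i, ⟪g, w - i⟫ = -1 := by
    intro w hw
    obtain ⟨hwi, hwv, hwK⟩ := Finset.mem_erase.1 hw |>.imp_right mem_faceOpp.1
    have h2 : ⟪hvv, w - i⟫ = 0 := by
      have e1 := hK.inner_heightVec hN hv (mem_faceOpp.2 ⟨hwv, hwK⟩)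
      have e2 := hK.inner_heightVec hN hv (mem_faceOpp.2 ⟨hiv, hi⟩)
      rw [show w - i = (w - v) - (i - v) by abel, inner_sub_right, e1, e2, sub_self]
    rw [hg, real_inner_smul_left, inner_sub_left, real_inner_smul_left, h2,
      hK.inner_heightVec hN hi (mem_faceOpp.2 ⟨hwi, hwK⟩), ← hii_def, mul_zero, sub_zero, neg_mul,
      inv_mul_cancel₀ (by positivity)]
  have hrep := hK.eq_sum_of_orthogonal hN g i
  rw [← Finset.add_sum_erase K _ hv, hgv, zero_div, neg_zero, zero_smul, zero_add,
    show K.erase v = faceOpp K v from by unfold faceOpp; convert! rfl,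
    ← Finset.add_sum_erase _ _ hiF, sub_self, smul_zero, zero_add, hF, Finset.sum_pair hjk] at hrep
  obtain ⟨hji, hjv, hjK⟩ := Finset.mem_erase.1 hj |>.imp_right mem_faceOpp.1
  obtain ⟨hki, hkv, hkK⟩ := Finset.mem_erase.1 hk |>.imp_right mem_faceOpp.1
  have key := h.norm_mul_le hθ hs hi hjK hkK hji.symm hki.symm hjk hrep (hinner j hj) (hinner k hk)
  have hgn : Real.sin θ / ‖hii‖ ≤ ‖g‖ := by
    have hsq : ‖hii - (⟪hii, hvv⟫ / ‖hvv‖ ^ 2) • hvv‖ =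
        Real.sin (InnerProductGeometry.angle hii hvv) * ‖hii‖ := by
      refine (pow_left_inj₀ (norm_nonneg _) (mul_nonneg (hs.le.trans hangle) hpi.le)
        two_ne_zero).1 ?_
      have hc := InnerProductGeometry.cos_angle_mul_norm_mul_norm hii hvv
      rw [norm_sub_sq_real, inner_smul_right, norm_smul, mul_pow, mul_pow, Real.sin_sq, ← hc,
        Real.norm_eq_abs, sq_abs]
      field_simp
      ring
    rw [hg, norm_smul, norm_neg, norm_inv, norm_pow, norm_norm, hsq, div_eq_mul_inv]
    calc Real.sin θ * ‖hii‖⁻¹ ≤ Real.sin (InnerProductGeometry.angle hii hvv) * ‖hii‖⁻¹ := by gcongr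
      _ = _ := by field_simp
  have hd : 0 ≤ Metric.diam (cell K) := Metric.diam_nonneg
  have h4 : Real.sin θ ^ 5 * Metric.diam (cell K) * (Real.sin θ / ‖hii‖) ≤ 1 :=
    (mul_le_mul_of_nonneg_left hgn (by positivity)).trans key
  rw [← mul_div_assoc, div_le_one hpi] at h4
  calc Real.sin θ ^ 6 / 3 * Metric.diam (cell K) =
      (Real.sin θ ^ 5 * Metric.diam (cell K) * Real.sin θ) / 3 := by ring
    _ ≤ ‖hvv‖ := by linarith

/-- The mesh is shape regular with constant `κ`: the heights of each element are at least `κ` times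
its diameter. -/
def Triangulation.ShapeRegular {Ω : Set (Eu N)} (𝒯 : Triangulation Ω) (κ : ℝ) : Prop :=
  ∀ K ∈ 𝒯.elements, ∀ v ∈ K, κ * Metric.diam (cell K) ≤ ‖heightVec K v‖

lemma exists_shapeRegular {θ₀ : ℝ} (hθ₀ : 0 < θ₀) : ∃ κ : ℝ, 0 < κ ∧ κ ≤ 1 ∧
    ∀ (N : ℕ) (_ : N = 2 ∨ N = 3) (Ω : Set (Eu N)) (𝒯 : Triangulation Ω)
      (_ : ∀ α ∈ 𝒯.angles, θ₀ ≤ α), 𝒯.ShapeRegular κ := by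
  -- The given bound may exceed `π`; truncation makes the sine positive.
  set θ := min θ₀ 1
  have hθ : 0 < θ := lt_min hθ₀ one_pos
  have hs : 0 < Real.sin θ := Real.sin_pos_of_pos_of_lt_pi hθ
    ((min_le_right _ _).trans_lt (by linarith [Real.pi_gt_three]))
  have hs1 := Real.sin_le_one θ
  have hs6 : Real.sin θ ^ 6 ≤ 1 := pow_le_one₀ hs.le hs1
  refine ⟨Real.sin θ ^ 6 / 3, by positivity, by linarith, ?_⟩
  intro N hN Ω 𝒯 hang K hK v hv
  have hplane : PlaneAnglesGe K θ := fun a ha b hb c hc hab hbc hac =>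
    (min_le_left _ _).trans (hang _ (Or.inl ⟨K, hK, a, ha, b, hb, c, hc, hab, hbc, hac, rfl⟩))
  rcases hN with rfl | rfl
  · refine le_trans ?_ (height_ge_of_triangle (𝒯.isSimplex hK) hplane hθ hs hv)
    refine mul_le_mul_of_nonneg_right ?_ Metric.diam_nonneg
    have : Real.sin θ ^ 6 ≤ Real.sin θ ^ 5 := pow_le_pow_of_le_one hs.le hs1 (by norm_num)
    have : 0 < Real.sin θ ^ 6 := by positivity
    linarith
  · exact height_ge_of_tetrahedron (𝒯.isSimplex hK) hplane (fun a ha b hb hab =>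
      (min_le_left _ _).trans (hang _ (Or.inr ⟨K, hK, a, ha, b, hb, hab, rfl⟩))) hθ hs hv


/-! ### The mesh near a vertex -/

namespace IsSimplex

variable {K : Finset (Eu N)}

lemma volume_face_eq_zero (hK : IsSimplex K) {v : Eu N} (hv : v ∈ K) :
    volume (cell (faceOpp K v)) = 0 := by
  refine measure_mono_null (convexHull_subset_affineSpan _)
    (Measure.addHaar_affineSubspace volume (affineSpan ℝ (faceOpp K v : Set (Eu N))) fun h => ?_)
  have h1 := hK.indep.notMem_affineSpan_sdiff ⟨v, hv⟩ Set.univ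
  apply h1
  have h2 : v ∈ affineSpan ℝ (faceOpp K v : Set (Eu N)) := by rw [h]; trivial
  convert! h2 using 2
  ext w
  simp [mem_faceOpp, and_comm]

lemma diam_pos (hK : IsSimplex K) (hN : 1 ≤ N) : 0 < Metric.diam (cell K) := by
  have hne : 1 < K.card := by rw [hK.card]; omega
  obtain ⟨v, hv, w, hw, h⟩ := Finset.one_lt_card.1 hne
  exact (hK.norm_heightVec_pos hN hv).trans_le ((hK.heightVec_le_dist hN hv hw h.symm).trans
    (dist_le_diam_cell (subset_cell hw) (subset_cell hv)))

lemma heightVec_le_diam (hK : IsSimplex K) (hN : 1 ≤ N) {v : Eu N} (hv : v ∈ K) :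
    ‖heightVec K v‖ ≤ Metric.diam (cell K) := by
  obtain ⟨w, hw⟩ := hK.faceOpp_nonempty hN hv
  obtain ⟨h, hwK⟩ := mem_faceOpp.1 hw
  exact (hK.heightVec_le_dist hN hv hwK h).trans
    (dist_le_diam_cell (subset_cell hwK) (subset_cell hv))

lemma exists_mem_interior_ne (hK : IsSimplex K) (hN : 1 ≤ N) {z : Eu N} (hz : z ∈ K) :
    ∃ y ∈ interior (cell K), y ≠ z := by
  obtain ⟨r, hr, h⟩ := hK.exists_pos_le_heights hN
  have hp : 0 < r / ((N : ℝ) + 1) := by positivity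
  refine ⟨_, interior_mono (hK.closedBall_subset_cell hN h)
    (mem_interior_iff_mem_nhds.2 (Metric.closedBall_mem_nhds _ hp)), fun heq => ?_⟩
  have h1 : ∑ v ∈ K, ((N : ℝ) + 1)⁻¹ = 1 := by
    rw [Finset.sum_const, hK.card]; simp; field_simp
  have h2 := hK.bary_combination hN (c := fun _ => ((N : ℝ) + 1)⁻¹) h1 hz
  have : (1 : ℝ) ≤ N := by exact_mod_cast hN
  rw [heq, bary_self, eq_comm, inv_eq_one] at h2
  linarith

end IsSimplex

namespace Triangulation

variable {Ω : Set (Eu N)} (𝒯 : Triangulation Ω)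

open Classical in
/-- The elements with vertex `z`. -/
def star (z : Eu N) : Finset (Finset (Eu N)) := 𝒯.elements.filter fun K => z ∈ K

lemma mem_star {z : Eu N} {K : Finset (Eu N)} : K ∈ 𝒯.star z ↔ K ∈ 𝒯.elements ∧ z ∈ K := by
  simp [star]

/-- The union of the elements with vertex `z`. -/
def patch (z : Eu N) : Set (Eu N) := ⋃ K ∈ 𝒯.star z, cell K

lemma closure_eq_iUnion : closure Ω = ⋃ K ∈ 𝒯.elements, cell K := by
  rw [← 𝒯.space_eq]
  ext x
  simp only [Geometry.SimplicialComplex.mem_space_iff, mem_iUnion, exists_prop]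
  constructor
  · rintro ⟨s, hs, hx⟩
    obtain ⟨K, hK, hsK, hcard⟩ := 𝒯.pure s hs
    exact ⟨K, 𝒯.mem_elements.2 ⟨hK, hcard⟩, cell_mono hsK hx⟩
  · rintro ⟨K, hK, hx⟩
    exact ⟨K, (𝒯.mem_elements.1 hK).1, hx⟩

lemma cell_subset_closure {K : Finset (Eu N)} (hK : K ∈ 𝒯.elements) : cell K ⊆ closure Ω := by
  rw [𝒯.closure_eq_iUnion]
  exact subset_biUnion_of_mem (u := fun K => cell K) hK

lemma mem_of_mem_cell {K L : Finset (Eu N)} (hK : K ∈ 𝒯.elements) (hL : L ∈ 𝒯.elements)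
    {z : Eu N} (hz : z ∈ L) (h : z ∈ cell K) : z ∈ K := by
  refine (Geometry.SimplicialComplex.vertex_mem_convexHull_iff ?_ (𝒯.mem_elements.1 hK).1).1 h
  exact 𝒯.complex.down_closed (𝒯.mem_elements.1 hL).1 (Finset.singleton_subset_iff.2 hz)
    (Finset.singleton_nonempty _)

open Classical in
lemma inter_cell_subset {K L : Finset (Eu N)} (hK : K ∈ 𝒯.elements) (hL : L ∈ 𝒯.elements) :
    cell K ∩ cell L ⊆ cell (K ∩ L) := by
  rw [cell, cell, cell, Finset.coe_inter]
  exact 𝒯.complex.inter_subset_convexHull (𝒯.mem_elements.1 hK).1 (𝒯.mem_elements.1 hL).1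

/-- Having equally many vertices, distinct elements cannot be nested. So `K` has a vertex outside
`L`, and by conformity the intersection lies in the face of `K` opposite to it, a null set. -/
lemma aedisjoint_cell {K L : Finset (Eu N)} (hK : K ∈ 𝒯.elements) (hL : L ∈ 𝒯.elements)
    (h : K ≠ L) : AEDisjoint volume (cell K) (cell L) := by
  classical
  have h1 : ¬ K ⊆ L := fun hsub => h (Finset.eq_of_subset_of_card_le hsub
    (by rw [(𝒯.isSimplex hK).card, (𝒯.isSimplex hL).card]))
  obtain ⟨v, hvK, hvL⟩ := Finset.not_subset.1 h1
  refine measure_mono_null ((𝒯.inter_cell_subset hK hL).trans (cell_mono ?_))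
    ((𝒯.isSimplex hK).volume_face_eq_zero hvK)
  intro w hw
  rw [Finset.mem_inter] at hw
  exact mem_faceOpp.2 ⟨fun e => hvL (e ▸ hw.2), hw.1⟩

lemma interior_cell_subset (hΩ : IsOpen Ω) (hconv : Convex ℝ Ω) {K : Finset (Eu N)}
    (hK : K ∈ 𝒯.elements) (hN : 1 ≤ N) : interior (cell K) ⊆ Ω := by
  have h := interior_mono (𝒯.cell_subset_closure hK)
  have hne : (interior Ω).Nonempty := by
    rw [hΩ.interior_eq, ← closure_nonempty_iff]
    exact ((𝒯.isSimplex hK).interior_cell_nonempty hN).mono (interior_subset.trans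
      (𝒯.cell_subset_closure hK))
  rwa [hconv.interior_closure_eq_interior_of_nonempty_interior hne, hΩ.interior_eq] at h

/-- Near a vertex `z` the domain is covered by the elements with vertex `z`. -/
lemma mem_patch (hconv : Convex ℝ Ω) (hN : 1 ≤ N) {z x : Eu N} (hz : (𝒯.star z).Nonempty)
    (hx : x ∈ closure Ω) (hxz : ∀ K ∈ 𝒯.star z, ‖x - z‖ ≤ ‖heightVec K z‖) : x ∈ 𝒯.patch z := by
  classical
  obtain ⟨K₀, hK₀⟩ := hz
  rw [mem_star] at hK₀
  have hzcl : z ∈ closure Ω := 𝒯.cell_subset_closure hK₀.1 (subset_cell hK₀.2)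
  -- The elements without vertex `z` form a closed set that misses `z` by conformity, so the segment
  -- from `z` to `x` starts outside it, inside some element with vertex `z`.
  set A : Set (Eu N) := ⋃ K ∈ 𝒯.elements.filter (fun K => z ∉ K), cell K
  have hA : IsClosed A := (Finset.finite_toSet _).isClosed_biUnion
    fun K _ => (isCompact_cell K).isClosed
  have hzA : z ∉ A := by
    simp only [A, mem_iUnion, not_exists, Finset.mem_filter]
    rintro K ⟨hK, hzK⟩ h
    exact hzK (𝒯.mem_of_mem_cell hK hK₀.1 hK₀.2 h)
  have hev : ∀ᶠ t : ℝ in nhdsWithin 0 (Ioi 0), z + t • (x - z) ∉ A ∧ t ∈ Ioc (0 : ℝ) 1 := by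
    refine Filter.Eventually.and ?_ (Ioc_mem_nhdsGT zero_lt_one)
    have hc : ContinuousAt (fun t : ℝ => z + t • (x - z)) 0 := by fun_prop
    have : ∀ᶠ y in nhds (z + (0 : ℝ) • (x - z)), y ∉ A := by
      rw [zero_smul, add_zero]
      exact hA.isOpen_compl.mem_nhds hzA
    exact (hc.eventually this).filter_mono nhdsWithin_le_nhds
  obtain ⟨t, htA, ht⟩ := hev.exists
  have hy : z + t • (x - z) ∈ closure Ω := hconv.closure.add_smul_sub_mem hzcl hx ⟨ht.1.le, ht.2⟩
  rw [𝒯.closure_eq_iUnion] at hy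
  simp only [mem_iUnion, exists_prop] at hy
  obtain ⟨K, hK, hyK⟩ := hy
  have hzK : z ∈ K := by
    by_contra h
    exact htA (mem_biUnion (by simp [hK, h]) hyK)
  have hKs : K ∈ 𝒯.star z := 𝒯.mem_star.2 ⟨hK, hzK⟩
  refine mem_biUnion hKs ?_
  have hS := 𝒯.isSimplex hK
  rw [hS.mem_cell_iff hN] at hyK ⊢
  intro w hw
  by_cases hwz : w = z
  · have h1 := hS.abs_bary_sub_le hN hzK x z
    have h2 : ‖x - z‖ / ‖heightVec K z‖ ≤ 1 := by
      rw [div_le_one (hS.norm_heightVec_pos hN hzK)]; exact hxz K hKs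
    rw [bary_self] at h1
    rw [hwz]
    linarith [(abs_le.1 (h1.trans h2)).1]
  -- The coordinate of `w ≠ z` vanishes at `z` and is therefore proportional to `t` on the ray; its
  -- sign at `x` is its sign near `z`.
  · have h1 := hyK w hw
    rw [bary_lineMap, hS.bary_of_ne hN hw hzK (Ne.symm hwz), mul_zero, zero_add] at h1
    exact nonneg_of_mul_nonneg_right h1 ht.1

/-- The number of elements with a common vertex is bounded. -/
lemma card_star_mul_le (hN : 1 ≤ N) {κ : ℝ} (hκ : 0 < κ) (hreg : 𝒯.ShapeRegular κ) (z : Eu N) :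
    ((𝒯.star z).card : ℝ) * (κ / (N + 1)) ^ N ≤ 1 := by
  rcases (𝒯.star z).eq_empty_or_nonempty with hne | hne
  · simp [hne]
  have : Nonempty (Fin N) := ⟨⟨0, hN⟩⟩
  obtain ⟨K₀, hK₀, hmin⟩ := Finset.exists_min_image _ (fun K => Metric.diam (cell K)) hne
  set r := Metric.diam (cell K₀)
  have hr : 0 < r := (𝒯.isSimplex (𝒯.mem_star.1 hK₀).1).diam_pos hN
  -- Shrink every element towards `z` to the smallest diameter `r`. The shrunken inscribed balls, of
  -- radius `κ / (N + 1) * r` and with these centers, are essentially disjoint and lie in the ball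
  -- of radius `r` about `z`; compare volumes.
  set c : Finset (Eu N) → Eu N := fun K =>
    z + (r / Metric.diam (cell K)) • ((∑ v ∈ K, ((N : ℝ) + 1)⁻¹ • v) - z)
  have hsub : ∀ K ∈ 𝒯.star z, Metric.closedBall (c K) (κ / (N + 1) * r) ⊆
      cell K ∩ Metric.closedBall z r := by
    intro K hK x hx
    obtain ⟨hKe, hzK⟩ := 𝒯.mem_star.1 hK
    have hd := (𝒯.isSimplex hKe).diam_pos hN
    set d := Metric.diam (cell K)
    set s := r / d with hs
    have hs0 : 0 < s := by positivity
    have hs1 : s ≤ 1 := (div_le_one hd).2 (hmin K hK)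
    set y := z + s⁻¹ • (x - z) with hy
    have hxy : x = z + s • (y - z) := by
      rw [hy, add_sub_cancel_left, smul_smul, mul_inv_cancel₀ hs0.ne', one_smul, add_sub_cancel]
    have hyK : y ∈ cell K := by
      refine (𝒯.isSimplex hKe).closedBall_subset_cell hN (fun v hv => hreg K hKe v hv) ?_
      rw [mem_closedBall_iff_norm] at hx ⊢
      have e : x - c K = s • (y - ∑ v ∈ K, ((N : ℝ) + 1)⁻¹ • v) := by
        rw [hxy]; simp only [c]; rw [add_sub_add_left_eq_sub, ← smul_sub]; congr 1; abel
      rw [e, norm_smul, Real.norm_of_nonneg hs0.le] at hx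
      have e2 : κ / (N + 1) * r = s * (κ * d / (N + 1)) := by rw [hs]; field_simp
      rw [e2] at hx
      exact le_of_mul_le_mul_left hx hs0
    refine ⟨?_, ?_⟩
    · rw [hxy]
      exact (convex_cell K).add_smul_sub_mem (subset_cell hzK) hyK ⟨hs0.le, hs1⟩
    · rw [mem_closedBall_iff_norm, hxy, add_sub_cancel_left, norm_smul,
        Real.norm_of_nonneg hs0.le, ← dist_eq_norm]
      calc s * dist y z ≤ s * d := by
            gcongr; exact dist_le_diam_cell hyK (subset_cell hzK)
        _ = r := by rw [hs]; field_simp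
  have hvol : ∑ K ∈ 𝒯.star z, volume (Metric.closedBall (c K) (κ / (N + 1) * r)) ≤
      volume (Metric.closedBall z r) := by
    rw [← measure_biUnion_finset₀]
    · exact measure_mono (iUnion₂_subset fun K hK => (hsub K hK).trans inter_subset_right)
    · intro K hK L hL hne
      exact (𝒯.aedisjoint_cell (𝒯.mem_star.1 hK).1 (𝒯.mem_star.1 hL).1 hne).mono
        ((hsub K hK).trans inter_subset_left) ((hsub L hL).trans inter_subset_left)
    · exact fun K _ => Metric.isClosed_closedBall.measurableSet.nullMeasurableSet
  have hb : volume (Metric.closedBall (0 : Eu N) 1) ≠ 0 := (Metric.measure_closedBall_pos _ _ one_pos).ne'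
  have hb' : volume (Metric.closedBall (0 : Eu N) 1) ≠ ⊤ := measure_closedBall_lt_top.ne
  have hpos : 0 ≤ κ / (N + 1) * r := by positivity
  simp_rw [fun x => Measure.addHaar_closedBall' volume (x : Eu N) hpos] at hvol
  rw [Measure.addHaar_closedBall' volume z hr.le, Finset.sum_const, finrank_euclideanSpace_fin,
    nsmul_eq_mul, ← mul_assoc, ENNReal.mul_le_mul_iff_left hb hb', ← ENNReal.ofReal_natCast,
    ← ENNReal.ofReal_mul (by positivity), ENNReal.ofReal_le_ofReal_iff (by positivity), mul_pow,
    ← mul_assoc] at hvol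
  exact (mul_le_iff_le_one_left (by positivity)).1 hvol

/-- Any two elements with vertex `z` are joined by a chain of elements with vertex `z` in which
consecutive ones have another common vertex. -/
def starGraph (z : Eu N) : SimpleGraph (𝒯.star z) where
  Adj K L := K ≠ L ∧ ∃ w ∈ K.1, w ∈ L.1 ∧ w ≠ z
  symm := ⟨fun _ _ h => ⟨h.1.symm, by obtain ⟨w, h1, h2, h3⟩ := h.2; exact ⟨w, h2, h1, h3⟩⟩⟩
  loopless := ⟨fun _ h => h.1 rfl⟩

/-- If some element were not reachable, the reachable and the unreachable elements would give two
closed sets that cover `S` and both meet it, hence have a common point in `S`. This point lies in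
the common face of two elements and is not `z`, so they share another vertex and are adjacent. -/
lemma reachable_of_isPreconnected {z : Eu N} {S : Set (Eu N)} (hS : IsPreconnected S)
    (hSz : z ∉ S) (hsub : S ⊆ 𝒯.patch z) (hmeet : ∀ K ∈ 𝒯.star z, (S ∩ cell K).Nonempty)
    (K L : 𝒯.star z) : (𝒯.starGraph z).Reachable K L := by
  classical
  by_contra hKL
  set X : Set (Eu N) := ⋃ M ∈ Finset.univ.filter fun M => (𝒯.starGraph z).Reachable K M, cell M.1
  set Y : Set (Eu N) := ⋃ M ∈ Finset.univ.filter fun M => ¬ (𝒯.starGraph z).Reachable K M, cell M.1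
  have hX : IsClosed X := (Finset.finite_toSet _).isClosed_biUnion
    fun M _ => (isCompact_cell M.1).isClosed
  have hY : IsClosed Y := (Finset.finite_toSet _).isClosed_biUnion
    fun M _ => (isCompact_cell M.1).isClosed
  have hcov : S ⊆ X ∪ Y := by
    intro x hx
    have := hsub hx
    simp only [patch, mem_iUnion, exists_prop] at this
    obtain ⟨M, hM, hxM⟩ := this
    by_cases h : (𝒯.starGraph z).Reachable K ⟨M, hM⟩
    · exact Or.inl (mem_biUnion (x := (⟨M, hM⟩ : 𝒯.star z)) (by simpa using h) hxM)
    · exact Or.inr (mem_biUnion (x := (⟨M, hM⟩ : 𝒯.star z)) (by simpa using h) hxM)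
  have h1 : (S ∩ X).Nonempty := (hmeet K.1 K.2).mono (inter_subset_inter_right _
    (subset_biUnion_of_mem (u := fun M : 𝒯.star z => cell M.1)
      (by simp)))
  have h2 : (S ∩ Y).Nonempty := (hmeet L.1 L.2).mono (inter_subset_inter_right _
    (subset_biUnion_of_mem (u := fun M : 𝒯.star z => cell M.1)
      (by simpa using hKL)))
  obtain ⟨x, hxS, hxX, hxY⟩ := isPreconnected_closed_iff.1 hS X Y hX hY hcov h1 h2
  simp only [X, Y, mem_iUnion, exists_prop, Finset.mem_filter, Finset.mem_univ, true_and] at hxX hxY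
  obtain ⟨M₁, hM₁, hx₁⟩ := hxX
  obtain ⟨M₂, hM₂, hx₂⟩ := hxY
  have hM₁e := 𝒯.mem_star.1 M₁.2
  have hM₂e := 𝒯.mem_star.1 M₂.2
  have hx : x ∈ cell (M₁.1 ∩ M₂.1) := 𝒯.inter_cell_subset hM₁e.1 hM₂e.1 ⟨hx₁, hx₂⟩
  have hw : ∃ w ∈ M₁.1, w ∈ M₂.1 ∧ w ≠ z := by
    by_contra! hcon
    have : M₁.1 ∩ M₂.1 ⊆ {z} := fun w hw => by
      rw [Finset.mem_inter] at hw
      exact Finset.mem_singleton.2 (hcon w hw.1 hw.2)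
    have hxz := cell_mono this hx
    rw [cell, Finset.coe_singleton, convexHull_singleton] at hxz
    exact hSz (hxz ▸ hxS)
  refine hM₂ (hM₁.trans (SimpleGraph.Adj.reachable ⟨?_, hw⟩))
  rintro rfl
  exact hM₂ hM₁

/-- The connected set is a small sphere around `z` if `z ∈ Ω`, connected since `N ≥ 2`. If `z` is on
the boundary, it is the convex intersection of `Ω` with a small ball, which omits `z`. -/
lemma starGraph_preconnected (hΩ : IsOpen Ω) (hconv : Convex ℝ Ω) (hN : 2 ≤ N) (z : Eu N) :
    (𝒯.starGraph z).Preconnected := by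
  intro K₀ L₀
  have hN1 : 1 ≤ N := by omega
  have hne : (𝒯.star z).Nonempty := ⟨K₀.1, K₀.2⟩
  obtain ⟨K₁, hK₁, hmin⟩ := Finset.exists_min_image _ (fun K => ‖heightVec K z‖) hne
  set ρ := ‖heightVec K₁ z‖
  have hρ : 0 < ρ := (𝒯.isSimplex (𝒯.mem_star.1 hK₁).1).norm_heightVec_pos hN1 (𝒯.mem_star.1 hK₁).2
  by_cases hz : z ∈ Ω
  · choose! y hy hyz using fun K (hK : K ∈ 𝒯.star z) =>
      (𝒯.isSimplex (𝒯.mem_star.1 hK).1).exists_mem_interior_ne hN1 (𝒯.mem_star.1 hK).2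
    obtain ⟨K₂, hK₂, hmin₂⟩ := Finset.exists_min_image _ (fun K => ‖y K - z‖) hne
    have hy₂ : 0 < ‖y K₂ - z‖ := norm_pos_iff.2 (sub_ne_zero.2 (hyz K₂ hK₂))
    obtain ⟨δ, hδ, hball⟩ := Metric.isOpen_iff.1 hΩ z hz
    set r := min (min ρ (‖y K₂ - z‖)) (δ / 2)
    have hr : 0 < r := lt_min (lt_min hρ hy₂) (by linarith)
    refine 𝒯.reachable_of_isPreconnected (S := Metric.sphere z r)
      (isPathConnected_sphere ?_ z hr.le).isConnected.isPreconnected ?_ ?_ ?_ K₀ L₀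
    · rw [← Module.finrank_eq_rank, finrank_euclideanSpace_fin]
      exact_mod_cast hN
    · simp [hr.ne]
    · intro x hx
      rw [mem_sphere_iff_norm] at hx
      refine 𝒯.mem_patch hconv hN1 hne (subset_closure (hball ?_)) fun K hK => ?_
      · rw [mem_ball_iff_norm, hx]
        exact (min_le_right _ _).trans_lt (by linarith)
      · rw [hx]
        exact ((min_le_left _ _).trans (min_le_left _ _)).trans (hmin K hK)
    · intro K hK
      have hp : 0 < ‖y K - z‖ := norm_pos_iff.2 (sub_ne_zero.2 (hyz K hK))
      have hrle : r ≤ ‖y K - z‖ := ((min_le_left _ _).trans (min_le_right _ _)).trans (hmin₂ K hK)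
      refine ⟨z + (r / ‖y K - z‖) • (y K - z), ?_, ?_⟩
      · rw [mem_sphere_iff_norm, add_sub_cancel_left, norm_smul, norm_div, norm_norm,
          Real.norm_of_nonneg hr.le, div_mul_cancel₀ _ hp.ne']
      · exact (convex_cell K).add_smul_sub_mem (subset_cell (𝒯.mem_star.1 hK).2)
          (interior_subset (hy K hK)) ⟨by positivity, (div_le_one hp).2 hrle⟩
  · refine 𝒯.reachable_of_isPreconnected (S := Ω ∩ Metric.ball z ρ)
      (hconv.inter (convex_ball z ρ)).isPreconnected (fun h => hz h.1) ?_ ?_ K₀ L₀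
    · intro x hx
      refine 𝒯.mem_patch hconv hN1 hne (subset_closure hx.1) fun K hK => ?_
      exact (mem_ball_iff_norm.1 hx.2).le.trans (hmin K hK)
    · intro K hK
      obtain ⟨hKe, hzK⟩ := 𝒯.mem_star.1 hK
      obtain ⟨y, hy, hyz⟩ := (𝒯.isSimplex hKe).exists_mem_interior_ne hN1 hzK
      have hp : 0 < ‖y - z‖ := norm_pos_iff.2 (sub_ne_zero.2 hyz)
      set t := min 1 (ρ / (2 * ‖y - z‖))
      have ht : 0 < t := lt_min one_pos (by positivity)
      have hmem : z + t • (y - z) ∈ interior (cell K) :=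
        (convex_cell K).add_smul_sub_mem_interior (subset_cell hzK) hy ⟨ht, min_le_left _ _⟩
      refine ⟨z + t • (y - z), ⟨𝒯.interior_cell_subset hΩ hconv hKe hN1 hmem, ?_⟩,
        interior_subset hmem⟩
      rw [mem_ball_iff_norm, add_sub_cancel_left, norm_smul, Real.norm_of_nonneg ht.le]
      calc t * ‖y - z‖ ≤ ρ / (2 * ‖y - z‖) * ‖y - z‖ := by gcongr; exact min_le_right _ _
        _ = ρ / 2 := by field_simp
        _ < ρ := by linarith

/-- Adjacent elements share an edge at `z`, which is at least a height of the first element and at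
most the diameter of the second. Each step of the chain costs one factor `κ`. -/
lemma pow_length_mul_diam_le (hN : 1 ≤ N) {κ : ℝ} (hκ : 0 < κ) (hreg : 𝒯.ShapeRegular κ) {z : Eu N}
    {K L : 𝒯.star z} (p : (𝒯.starGraph z).Walk K L) :
    κ ^ p.length * Metric.diam (cell K.1) ≤ Metric.diam (cell L.1) := by
  induction p with
  | nil => simp
  | @cons K M L h p ih =>
    obtain ⟨hKe, hzK⟩ := 𝒯.mem_star.1 K.2
    obtain ⟨hMe, hzM⟩ := 𝒯.mem_star.1 M.2
    obtain ⟨-, w, hwK, hwM, hwz⟩ := h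
    have h1 : κ * Metric.diam (cell K.1) ≤ Metric.diam (cell M.1) :=
      (hreg K.1 hKe z hzK).trans (((𝒯.isSimplex hKe).heightVec_le_dist hN hzK hwK hwz).trans
        (dist_le_diam_cell (subset_cell hwM) (subset_cell hzM)))
    calc κ ^ (p.length + 1) * Metric.diam (cell K.1) =
        κ ^ p.length * (κ * Metric.diam (cell K.1)) := by ring
      _ ≤ κ ^ p.length * Metric.diam (cell M.1) := by gcongr
      _ ≤ _ := ih

lemma pow_card_mul_diam_le (hΩ : IsOpen Ω) (hconv : Convex ℝ Ω) (hN : 2 ≤ N) {κ : ℝ} (hκ : 0 < κ)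
    (hκ1 : κ ≤ 1) (hreg : 𝒯.ShapeRegular κ) {z : Eu N} {K L : Finset (Eu N)} (hK : K ∈ 𝒯.star z)
    (hL : L ∈ 𝒯.star z) :
    κ ^ (𝒯.star z).card * Metric.diam (cell K) ≤ Metric.diam (cell L) := by
  classical
  obtain ⟨p⟩ := 𝒯.starGraph_preconnected hΩ hconv hN z ⟨K, hK⟩ ⟨L, hL⟩
  have h1 := 𝒯.pow_length_mul_diam_le (by omega) hκ hreg p.toPath.1
  have h2 : p.toPath.1.length ≤ (𝒯.star z).card := by
    simpa using p.toPath.2.length_lt.le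
  refine le_trans ?_ h1
  exact mul_le_mul_of_nonneg_right (pow_le_pow_of_le_one hκ.le hκ1 h2) Metric.diam_nonneg

end Triangulation


/-! ### Local approximation by constants -/

namespace Triangulation

variable {Ω : Set (Eu N)} (𝒯 : Triangulation Ω)

lemma cell_subset_patch {z : Eu N} {K : Finset (Eu N)} (hK : K ∈ 𝒯.star z) : cell K ⊆ 𝒯.patch z :=
  subset_biUnion_of_mem (u := fun K => cell K) hK

/-- With `ρ` the smallest height at `z`, the set `B`, the part of `Ω` within distance `ρ` of `z`, is
convex and lies in the patch; it supplies the constant `c`. Shrinking `K` towards `z` puts a copy of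
its interior into `B` whose volume is at least the fraction `σ ^ N` of that of `K`, and
`sqDev_le_of_subset` passes from this copy to `K`. The factor `10` is `2 * (1 + 4)`, the `4` coming
from the diameter `2 * ρ` of the ball. -/
lemma exists_sqDev_le_energy_patch (hΩ : IsOpen Ω) (hconv : Convex ℝ Ω) (hN : 1 ≤ N) {σ : ℝ}
    (hσ : 0 < σ) {z : Eu N} (hne : (𝒯.star z).Nonempty)
    (hcmp : ∀ K ∈ 𝒯.star z, ∀ L ∈ 𝒯.star z, σ * Metric.diam (cell K) ≤ ‖heightVec L z‖)
    {ψ : Eu N → ℝ} (hψ : ContDiff ℝ 1 ψ) :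
    ∃ c, ∀ K ∈ 𝒯.star z, sqDev ψ c (cell K) ≤
      ENNReal.ofReal (10 * (2 / σ) ^ N * Metric.diam (cell K) ^ 2) * energy ψ (𝒯.patch z) := by
  obtain ⟨K₁, hK₁, hmin⟩ := Finset.exists_min_image _ (fun K => ‖heightVec K z‖) hne
  set ρ := ‖heightVec K₁ z‖
  have hρ : 0 < ρ := (𝒯.isSimplex (𝒯.mem_star.1 hK₁).1).norm_heightVec_pos hN (𝒯.mem_star.1 hK₁).2
  set B := Ω ∩ Metric.closedBall z ρ with hBdef
  have hBconv : Convex ℝ B := hconv.inter (convex_closedBall z ρ)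
  have hBm : MeasurableSet B := hΩ.measurableSet.inter Metric.isClosed_closedBall.measurableSet
  have hBpatch : B ⊆ 𝒯.patch z := fun x hx => 𝒯.mem_patch hconv hN hne (subset_closure hx.1)
    fun K hK => (mem_closedBall_iff_norm.1 hx.2).trans (hmin K hK)
  have hzcl : z ∈ closure Ω := 𝒯.cell_subset_closure (𝒯.mem_star.1 hK₁).1
    (subset_cell (𝒯.mem_star.1 hK₁).2)
  have hB0 : volume B ≠ 0 := by
    have h1 : (Metric.ball z ρ ∩ Ω).Nonempty :=
      mem_closure_iff.1 hzcl _ Metric.isOpen_ball (Metric.mem_ball_self hρ)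
    have h2 : 0 < volume (Metric.ball z ρ ∩ Ω) := (Metric.isOpen_ball.inter hΩ).measure_pos _ h1
    exact (h2.trans_le (measure_mono (show Metric.ball z ρ ∩ Ω ⊆ B from
      fun x hx => ⟨hx.2, Metric.ball_subset_closedBall hx.1⟩))).ne'
  have hBtop : volume B ≠ ⊤ :=
    ((measure_mono inter_subset_right).trans_lt measure_closedBall_lt_top).ne
  have hBd : ∀ x ∈ B, ∀ y ∈ B, dist x y ≤ 2 * ρ := fun x hx y hy => by
    have h1 := dist_triangle_right x y z
    linarith [Metric.mem_closedBall.1 hx.2, Metric.mem_closedBall.1 hy.2]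
  obtain ⟨c, hc⟩ := exists_sqDev_le hψ hBm hBconv hBd hB0 hBtop
  refine ⟨c, fun K hK => ?_⟩
  obtain ⟨hKe, hzK⟩ := 𝒯.mem_star.1 hK
  have hS := 𝒯.isSimplex hKe
  have hd := hS.diam_pos hN
  set d := Metric.diam (cell K) with hddef
  have hρd : ρ ≤ d := (hmin K hK).trans (hS.heightVec_le_diam hN hzK)
  have hσρ : σ * d ≤ ρ := hcmp K hK K₁ hK₁
  set s := ρ / d with hs
  have hs0 : 0 < s := by positivity
  have hs1 : s ≤ 1 := (div_le_one hd).2 hρd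
  set D' := interior (cell K) ∩ Metric.closedBall z ρ
  have hhom : AffineMap.homothety z s '' interior (cell K) ⊆ D' := by
    rintro _ ⟨y, hy, rfl⟩
    have e : AffineMap.homothety z s y = z + s • (y - z) := by
      simp [AffineMap.homothety_apply, add_comm]
    rw [e]
    refine ⟨(convex_cell K).add_smul_sub_mem_interior (subset_cell hzK) hy ⟨hs0, hs1⟩, ?_⟩
    rw [mem_closedBall_iff_norm, add_sub_cancel_left, norm_smul, Real.norm_of_nonneg hs0.le,
      ← dist_eq_norm]
    calc s * dist y z ≤ s * d := by
          gcongr; exact dist_le_diam_cell (interior_subset hy) (subset_cell hzK)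
      _ = ρ := by rw [hs]; field_simp
  have hL : volume (cell K) ≤ ENNReal.ofReal ((1 / σ) ^ N) * volume D' := by
    have h1 : ENNReal.ofReal (s ^ N) * volume (cell K) ≤ volume D' := by
      refine le_trans (le_of_eq ?_) (measure_mono hhom)
      rw [Measure.addHaar_image_homothety, finrank_euclideanSpace_fin, abs_of_pos (by positivity),
        measure_congr hS.interior_ae_eq_cell]
    calc volume (cell K) ≤ ENNReal.ofReal ((1 / σ) ^ N) * (ENNReal.ofReal (s ^ N) * volume (cell K)) := by
          rw [← mul_assoc, ← ENNReal.ofReal_mul (by positivity), ← mul_pow]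
          refine le_mul_of_one_le_left zero_le ?_
          rw [ENNReal.one_le_ofReal]
          refine one_le_pow₀ ?_
          rw [hs, div_mul_div_comm, one_mul, one_le_div (by positivity)]
          exact hσρ
      _ ≤ _ := by gcongr
  have hK0 : volume (cell K) ≠ 0 := by
    rw [← measure_congr hS.interior_ae_eq_cell]
    exact (isOpen_interior.measure_pos _ (hS.interior_cell_nonempty hN)).ne'
  have hmain := sqDev_le_of_subset hψ (measurableSet_cell K) (convex_cell K)
    (fun x hx y hy => dist_le_diam_cell hx hy) (inter_subset_left.trans interior_subset) hK0
    (isCompact_cell K).measure_lt_top.ne hL c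
  refine hmain.trans ?_
  have h1 : sqDev ψ c D' ≤ ENNReal.ofReal (2 ^ N * (2 * d) ^ 2) * energy ψ (𝒯.patch z) := by
    calc sqDev ψ c D' ≤ sqDev ψ c B := lintegral_mono_set fun x hx =>
          ⟨𝒯.interior_cell_subset hΩ hconv hKe hN hx.1, hx.2⟩
      _ ≤ ENNReal.ofReal (2 ^ N * (2 * ρ) ^ 2) * energy ψ B := hc
      _ ≤ _ := by
        refine mul_le_mul' (ENNReal.ofReal_le_ofReal ?_) (lintegral_mono_set hBpatch)
        gcongr
  have h2 : energy ψ (cell K) ≤ energy ψ (𝒯.patch z) := lintegral_mono_set (𝒯.cell_subset_patch hK)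
  calc ENNReal.ofReal (2 * (1 / σ) ^ N) *
        (ENNReal.ofReal (2 ^ N * d ^ 2) * energy ψ (cell K) + sqDev ψ c D')
      ≤ ENNReal.ofReal (2 * (1 / σ) ^ N) * (ENNReal.ofReal (2 ^ N * d ^ 2) * energy ψ (𝒯.patch z) +
        ENNReal.ofReal (2 ^ N * (2 * d) ^ 2) * energy ψ (𝒯.patch z)) := by gcongr
    _ = _ := by
      rw [← add_mul, ← ENNReal.ofReal_add (by positivity) (by positivity), ← mul_assoc,
        ← ENNReal.ofReal_mul (by positivity)]
      congr 2
      rw [div_pow, div_pow]; ring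

end Triangulation

/-- On shape regular meshes in two or three dimensions the number of elements at a vertex is
bounded, and `H¹` functions are approximated near a vertex by constants. -/
lemma exists_patch_constants {κ : ℝ} (hκ : 0 < κ) (hκ1 : κ ≤ 1) : ∃ (M : ℕ) (C : ℝ), 0 < C ∧
    ∀ (N : ℕ) (_ : N = 2 ∨ N = 3) (Ω : Set (Eu N)) (_ : IsOpen Ω) (_ : Convex ℝ Ω)
      (𝒯 : Triangulation Ω) (_ : 𝒯.ShapeRegular κ) (z : Eu N), (𝒯.star z).card ≤ M ∧
        ∀ ψ : Eu N → ℝ, ContDiff ℝ 1 ψ → ∃ c, ∀ K ∈ 𝒯.star z, sqDev ψ c (cell K) ≤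
          ENNReal.ofReal (C * Metric.diam (cell K) ^ 2) * energy ψ (𝒯.patch z) := by
  -- `((N + 1) / κ) ^ N` is at most `(4 / κ) ^ 3` in both dimensions. In `σ`, the factor `κ ^ M`
  -- compares diameters along a chain and one more `κ` passes from a diameter to a height.
  set M := ⌈(4 / κ) ^ 3⌉₊ with hM
  set σ := κ ^ (M + 1) with hσdef
  have hσ : 0 < σ := by positivity
  have hσ1 : σ ≤ 1 := pow_le_one₀ hκ.le hκ1
  refine ⟨M, 10 * (2 / σ) ^ 3, by positivity, ?_⟩
  intro N hN Ω hΩ hconv 𝒯 hreg z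
  have hN2 : 2 ≤ N := by omega
  have hN3 : N ≤ 3 := by omega
  have hcard : (𝒯.star z).card ≤ M := by
    have h1 := 𝒯.card_star_mul_le (by omega) hκ hreg z
    have h2 : (κ / 4) ^ 3 ≤ (κ / (N + 1)) ^ N := by
      have h3 : κ / 4 ≤ κ / (N + 1) := by
        have : (N : ℝ) ≤ 3 := by exact_mod_cast hN3
        gcongr; linarith
      have h4 : κ / 4 ≤ 1 := by linarith
      calc (κ / 4) ^ 3 ≤ (κ / 4) ^ N := pow_le_pow_of_le_one (by positivity) h4 hN3
        _ ≤ _ := by gcongr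
    have h5 : ((𝒯.star z).card : ℝ) ≤ (4 / κ) ^ 3 := by
      have h6 : ((𝒯.star z).card : ℝ) * (κ / 4) ^ 3 ≤ 1 :=
        (mul_le_mul_of_nonneg_left h2 (Nat.cast_nonneg _)).trans h1
      rw [← le_div_iff₀ (by positivity)] at h6
      refine h6.trans (le_of_eq ?_)
      rw [div_pow, div_pow, one_div_div]
    exact_mod_cast h5.trans (Nat.le_ceil _)
  refine ⟨hcard, fun ψ hψ => ?_⟩
  rcases (𝒯.star z).eq_empty_or_nonempty with hne | hne
  · exact ⟨0, by simp [hne]⟩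
  have hcmp : ∀ K ∈ 𝒯.star z, ∀ L ∈ 𝒯.star z, σ * Metric.diam (cell K) ≤ ‖heightVec L z‖ := by
    intro K hK L hL
    have h1 := 𝒯.pow_card_mul_diam_le hΩ hconv hN2 hκ hκ1 hreg hK hL
    have h2 := hreg L (𝒯.mem_star.1 hL).1 z (𝒯.mem_star.1 hL).2
    have h3 : κ ^ M ≤ κ ^ (𝒯.star z).card := pow_le_pow_of_le_one hκ.le hκ1 hcard
    calc σ * Metric.diam (cell K) = κ * (κ ^ M * Metric.diam (cell K)) := by rw [hσdef]; ring
      _ ≤ κ * (κ ^ (𝒯.star z).card * Metric.diam (cell K)) := by gcongr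
      _ ≤ κ * Metric.diam (cell L) := by gcongr
      _ ≤ _ := h2
  obtain ⟨c, hc⟩ := 𝒯.exists_sqDev_le_energy_patch hΩ hconv (by omega) hσ hne hcmp hψ
  refine ⟨c, fun K hK => (hc K hK).trans ?_⟩
  gcongr
  rw [le_div_iff₀ hσ]; linarith


/-! ### Density of smooth functions -/

lemma eLpNorm_two_sq {E : Type*} [NormedAddCommGroup E] {α : Type*} [MeasurableSpace α] (f : α → E) (μ : Measure α) :
    eLpNorm f 2 μ ^ 2 = ∫⁻ x, ‖f x‖ₑ ^ 2 ∂μ := by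
  have := eLpNorm_nnreal_pow_eq_lintegral (f := f) (μ := μ) (p := 2) two_ne_zero
  norm_num at this
  exact_mod_cast this

section Regularization

open Filter Topology

variable {E : Type*} [NormedAddCommGroup E] [NormedSpace ℝ E]

/-- The convolution of `f` with a normed bump function. -/
def mollify (φ : ContDiffBump (0 : Eu N)) (f : Eu N → E) : Eu N → E :=
  convolution (φ.normed volume) f (ContinuousLinearMap.lsmul ℝ ℝ) volume

/-- Jensen's inequality for the probability measure with density the normed bump function. -/
lemma enorm_mollify_sq_le (φ : ContDiffBump (0 : Eu N)) {f : Eu N → E} (hf : StronglyMeasurable f)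
    (z : Eu N) : ‖mollify φ f z‖ₑ ^ 2 ≤
      ∫⁻ t, ENNReal.ofReal (φ.normed volume t) * ‖f (z - t)‖ₑ ^ 2 := by
  set w : Eu N → ℝ≥0∞ := fun t => ENNReal.ofReal (φ.normed volume t)
  have hw : Measurable w := ENNReal.measurable_ofReal.comp φ.continuous_normed.measurable
  have hw1 : ∫⁻ t, w t = 1 := by
    rw [← ofReal_integral_eq_lintegral_ofReal φ.integrable_normed
      (ae_of_all _ fun t => φ.nonneg_normed t), φ.integral_normed, ENNReal.ofReal_one]
  set μ := (volume : Measure (Eu N)).withDensity w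
  have hμ : IsProbabilityMeasure μ := ⟨by rw [withDensity_apply _ MeasurableSet.univ]; simpa using hw1⟩
  have hfm : StronglyMeasurable fun t => f (z - t) := hf.comp_measurable (by fun_prop)
  have h1 : ‖mollify φ f z‖ₑ ≤ eLpNorm (fun t => f (z - t)) 1 μ := by
    rw [eLpNorm_one_eq_lintegral_enorm, lintegral_withDensity_eq_lintegral_mul _ hw hfm.enorm]
    refine (enorm_integral_le_lintegral_enorm _).trans (le_of_eq ?_)
    refine lintegral_congr fun t => ?_
    rw [ContinuousLinearMap.lsmul_apply, enorm_smul, Real.enorm_of_nonneg (φ.nonneg_normed t)]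
    rfl
  have h2 : eLpNorm (fun t => f (z - t)) 1 μ ≤ eLpNorm (fun t => f (z - t)) 2 μ :=
    eLpNorm_le_eLpNorm_of_exponent_le (by norm_num) hfm.aestronglyMeasurable
  calc ‖mollify φ f z‖ₑ ^ 2 ≤ eLpNorm (fun t => f (z - t)) 2 μ ^ 2 := by gcongr; exact h1.trans h2
    _ = _ := by
      rw [eLpNorm_two_sq, lintegral_withDensity_eq_lintegral_mul _ hw (hfm.enorm.pow_const 2)]
      rfl

lemma lintegral_enorm_mollify_sq_le (φ : ContDiffBump (0 : Eu N)) {f : Eu N → E}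
    (hf : AEStronglyMeasurable f volume) :
    ∫⁻ z, ‖mollify φ f z‖ₑ ^ 2 ≤ ∫⁻ z, ‖f z‖ₑ ^ 2 := by
  have h1 : mollify φ f = mollify φ (hf.mk f) := convolution_congr _ (ae_eq_refl _) hf.ae_eq_mk
  have h2 : ∫⁻ z, ‖f z‖ₑ ^ 2 = ∫⁻ z, ‖hf.mk f z‖ₑ ^ 2 :=
    lintegral_congr_ae (hf.ae_eq_mk.mono fun x hx => by dsimp only; rw [hx])
  rw [h1, h2]
  have hm := hf.stronglyMeasurable_mk
  have hw : Measurable fun t => ENNReal.ofReal (φ.normed volume t) :=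
    ENNReal.measurable_ofReal.comp φ.continuous_normed.measurable
  calc ∫⁻ z, ‖mollify φ (hf.mk f) z‖ₑ ^ 2
      ≤ ∫⁻ z, ∫⁻ t, ENNReal.ofReal (φ.normed volume t) * ‖hf.mk f (z - t)‖ₑ ^ 2 :=
        lintegral_mono fun z => enorm_mollify_sq_le φ hm z
    _ = ∫⁻ t, ∫⁻ z, ENNReal.ofReal (φ.normed volume t) * ‖hf.mk f (z - t)‖ₑ ^ 2 := by
        refine lintegral_lintegral_swap (Measurable.aemeasurable ?_)
        exact (hw.comp measurable_snd).mul
          ((hm.enorm.comp (measurable_fst.sub measurable_snd)).pow_const 2)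
    _ = ∫⁻ t, ENNReal.ofReal (φ.normed volume t) * ∫⁻ z, ‖hf.mk f z‖ₑ ^ 2 := by
        refine lintegral_congr fun t => ?_
        rw [lintegral_const_mul' _ _ ENNReal.ofReal_ne_top,
          lintegral_sub_right_eq_self (fun z => ‖hf.mk f z‖ₑ ^ 2)]
    _ = _ := by
        rw [lintegral_mul_const _ hw, ← ofReal_integral_eq_lintegral_ofReal φ.integrable_normed
          (ae_of_all _ fun t => φ.nonneg_normed t), φ.integral_normed, ENNReal.ofReal_one, one_mul]

/-- Mollification after a dilation about `x₀` by the factor `1 / s`. -/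
def regularize (φ : ContDiffBump (0 : Eu N)) (x₀ : Eu N) (s : ℝ) (f : Eu N → E) (x : Eu N) : E :=
  mollify φ f (x₀ + s • (x - x₀))

lemma continuous_mollify (φ : ContDiffBump (0 : Eu N)) {f : Eu N → E}
    (hf : LocallyIntegrable f volume) : Continuous (mollify φ f) :=
  (φ.hasCompactSupport_normed.contDiff_convolution_left (n := 0) _ φ.contDiff_normed hf).continuous

lemma continuous_regularize (φ : ContDiffBump (0 : Eu N)) (x₀ : Eu N) (s : ℝ) {f : Eu N → E}
    (hf : LocallyIntegrable f volume) : Continuous (regularize φ x₀ s f) :=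
  (continuous_mollify φ hf).comp (by fun_prop)

/-- The dilation multiplies the squared norm by at most `s ^ (-N) ≤ 2 ^ N`. The constant is crude:
only its uniformity in `φ` and `s` matters. -/
lemma eLpNorm_regularize_le (φ : ContDiffBump (0 : Eu N)) (x₀ : Eu N) {s : ℝ} (hs : 1 / 2 ≤ s)
    {f : Eu N → E} (hf : MemLp f 2 volume) :
    eLpNorm (regularize φ x₀ s f) 2 volume ≤ 2 ^ N * eLpNorm f 2 volume := by
  have hc := continuous_mollify φ (hf.locallyIntegrable (by norm_num))
  have h1 : eLpNorm (regularize φ x₀ s f) 2 volume ^ 2 ≤ (2 ^ N * eLpNorm f 2 volume) ^ 2 := by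
    rw [mul_pow, eLpNorm_two_sq, eLpNorm_two_sq]
    have e : ∫⁻ x, ‖regularize φ x₀ s f x‖ₑ ^ 2 =
        ∫⁻ x, (fun z => ‖mollify φ f z‖ₑ ^ 2) ((x₀ - s • x₀) + s • x) := by
      refine lintegral_congr fun x => ?_
      have : x₀ + s • (x - x₀) = (x₀ - s • x₀) + s • x := by rw [smul_sub]; abel
      rw [regularize, this]
    rw [e, lintegral_comp_add_smul (hc.enorm.measurable.pow_const 2) _ (by linarith)]
    refine mul_le_mul' ?_ (lintegral_enorm_mollify_sq_le φ hf.1)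
    have h2 : (s ^ N)⁻¹ ≤ 2 ^ N := by
      rw [← inv_pow]
      refine pow_le_pow_left₀ (inv_nonneg.2 (by linarith)) ?_ N
      rw [inv_le_comm₀ (by linarith) (by norm_num)]; linarith
    calc ENNReal.ofReal ((s ^ N)⁻¹) ≤ ENNReal.ofReal (2 ^ N) := ENNReal.ofReal_le_ofReal h2
      _ = 2 ^ N := by rw [ENNReal.ofReal_pow (by norm_num), ENNReal.ofReal_ofNat]
      _ ≤ _ := le_self_pow (one_le_pow₀ (by norm_num)) two_ne_zero
  exact (ENNReal.pow_le_pow_left_iff two_ne_zero).1 h1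

lemma regularize_add (φ : ContDiffBump (0 : Eu N)) (x₀ : Eu N) (s : ℝ) {f g : Eu N → E}
    (hf : LocallyIntegrable f volume) (hg : LocallyIntegrable g volume) :
    regularize φ x₀ s (f + g) = regularize φ x₀ s f + regularize φ x₀ s g := by
  ext x
  have hφ : HasCompactSupport (φ.normed volume) := φ.hasCompactSupport_normed
  have hc : Continuous (φ.normed volume) := φ.continuous_normed
  have h := (hφ.convolutionExists_left (ContinuousLinearMap.lsmul ℝ ℝ) hc hf).distrib_add
    (hφ.convolutionExists_left (ContinuousLinearMap.lsmul ℝ ℝ) hc hg)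
  exact congrFun h (x₀ + s • (x - x₀))

/-- By the uniform `L²` bound it suffices to treat a continuous compactly supported `g` close to
`f`. For such `g` uniform continuity gives uniform convergence, and `Ω` has finite measure. -/
lemma tendsto_eLpNorm_regularize_sub [CompleteSpace E] {Ω : Set (Eu N)} (hb : Bornology.IsBounded Ω)
    (hm : MeasurableSet Ω) {φ : ℕ → ContDiffBump (0 : Eu N)} {x₀ : Eu N} (hx₀ : x₀ ∈ Ω) {s : ℕ → ℝ}
    (hs : ∀ k, 1 / 2 ≤ s k) (hs1 : ∀ k, s k ≤ 1) (hslim : Tendsto s atTop (𝓝 1))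
    (hφ : Tendsto (fun k => (φ k).rOut) atTop (𝓝 0)) {f : Eu N → E} (hf : MemLp f 2 volume) :
    Tendsto (fun k => eLpNorm (regularize (φ k) x₀ (s k) f - f) 2 (volume.restrict Ω)) atTop
      (𝓝 0) := by
  rw [ENNReal.tendsto_nhds_zero]
  intro ε hε
  have hΩ : volume.restrict Ω univ ^ (2 : ℝ≥0∞).toReal⁻¹ ≠ ⊤ := by
    rw [Measure.restrict_apply_univ]
    exact ENNReal.rpow_ne_top_of_nonneg (by simp) hb.measure_lt_top.ne
  obtain ⟨ε₁, hε₁, hε₁'⟩ : ∃ ε₁ : ℝ≥0∞, ε₁ ≠ 0 ∧ (2 ^ N + 1) * ε₁ ≤ ε / 2 := by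
    refine ⟨ε / 2 / (2 ^ N + 1), ?_, ENNReal.mul_div_le⟩
    refine (ENNReal.div_pos ?_ (by simp)).ne'
    exact (ENNReal.half_pos hε.ne').ne'
  obtain ⟨ε₂, hε₂, hε₂'⟩ : ∃ ε₂ : ℝ, 0 < ε₂ ∧
      volume.restrict Ω univ ^ (2 : ℝ≥0∞).toReal⁻¹ * ENNReal.ofReal ε₂ ≤ ε / 2 := by
    have h1 : Tendsto (fun e : ℝ => volume.restrict Ω univ ^ (2 : ℝ≥0∞).toReal⁻¹ *
        ENNReal.ofReal e) (𝓝[>] 0) (𝓝 0) := by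
      have h2 : Tendsto (fun e : ℝ => ENNReal.ofReal e) (𝓝[>] 0) (𝓝 0) := by
        have := (ENNReal.continuous_ofReal.tendsto 0).mono_left (nhdsWithin_le_nhds (s := Ioi 0))
        simpa using this
      simpa using ENNReal.Tendsto.const_mul h2 (Or.inr hΩ)
    have h3 := ((ENNReal.tendsto_nhds_zero.1 h1) (ε / 2) (ENNReal.half_pos hε.ne')).and
      self_mem_nhdsWithin
    obtain ⟨e, he, he0⟩ := h3.exists
    exact ⟨e, he0, he⟩
  obtain ⟨g, hgc, hfg, hg, hgLp⟩ := hf.exists_hasCompactSupport_eLpNorm_sub_le (by simp) hε₁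
  obtain ⟨η, hη, hηg⟩ := Metric.uniformContinuous_iff.1
    (hgc.uniformContinuous_of_continuous hg) ε₂ hε₂
  obtain ⟨R, hR⟩ := Metric.isBounded_iff.1 hb
  have hlim : Tendsto (fun k => (φ k).rOut + (1 - s k) * R) atTop (𝓝 0) := by
    have := hφ.add ((hslim.const_sub 1).mul_const R)
    simpa using this
  filter_upwards [hlim.eventually (gt_mem_nhds hη)] with k hk
  have hR0 : 0 ≤ R := dist_nonneg.trans (hR hx₀ hx₀)
  have hfgLp : MemLp (f - g) 2 volume := hf.sub hgLp
  have hli := hfgLp.locallyIntegrable (by norm_num)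
  have hlg := hgLp.locallyIntegrable (by norm_num)
  have hdecomp : regularize (φ k) x₀ (s k) f - f = (regularize (φ k) x₀ (s k) (f - g) - (f - g)) +
      (regularize (φ k) x₀ (s k) g - g) := by
    have := regularize_add (φ k) x₀ (s k) hli hlg
    rw [sub_add_cancel] at this
    rw [this]; abel
  have hm1 : AEStronglyMeasurable (regularize (φ k) x₀ (s k) (f - g)) volume :=
    (continuous_regularize _ _ _ hli).aestronglyMeasurable
  have hm2 : AEStronglyMeasurable (regularize (φ k) x₀ (s k) g - g) volume :=
    ((continuous_regularize _ _ _ hlg).sub hg).aestronglyMeasurable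
  have hA : eLpNorm (regularize (φ k) x₀ (s k) (f - g) - (f - g)) 2 (volume.restrict Ω) ≤ ε / 2 := by
    calc eLpNorm (regularize (φ k) x₀ (s k) (f - g) - (f - g)) 2 (volume.restrict Ω)
        ≤ eLpNorm (regularize (φ k) x₀ (s k) (f - g) - (f - g)) 2 volume :=
          eLpNorm_mono_measure _ Measure.restrict_le_self
      _ ≤ eLpNorm (regularize (φ k) x₀ (s k) (f - g)) 2 volume + eLpNorm (f - g) 2 volume :=
          eLpNorm_sub_le hm1 hfgLp.1 (by norm_num)
      _ ≤ 2 ^ N * eLpNorm (f - g) 2 volume + eLpNorm (f - g) 2 volume := by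
          gcongr; exact eLpNorm_regularize_le _ _ (hs k) hfgLp
      _ = (2 ^ N + 1) * eLpNorm (f - g) 2 volume := by ring
      _ ≤ (2 ^ N + 1) * ε₁ := by gcongr
      _ ≤ ε / 2 := hε₁'
  have hB : eLpNorm (regularize (φ k) x₀ (s k) g - g) 2 (volume.restrict Ω) ≤ ε / 2 := by
    refine (eLpNorm_le_of_ae_bound (C := ε₂) ?_).trans hε₂'
    refine (ae_restrict_iff' hm).2 (ae_of_all _ fun x hx => ?_)
    rw [Pi.sub_apply, ← dist_eq_norm]
    have hzx : ∀ y ∈ Metric.ball (x₀ + s k • (x - x₀)) (φ k).rOut, dist (g y) (g x) ≤ ε₂ := by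
      intro y hy
      refine (hηg ?_).le
      calc dist y x ≤ dist y (x₀ + s k • (x - x₀)) + dist (x₀ + s k • (x - x₀)) x :=
            dist_triangle _ _ _
        _ ≤ (φ k).rOut + (1 - s k) * R := by
            refine add_le_add (Metric.mem_ball.1 hy).le ?_
            have e : x₀ + s k • (x - x₀) - x = (1 - s k) • (x₀ - x) := by
              rw [sub_smul, one_smul, smul_sub, smul_sub]; abel
            rw [dist_eq_norm, e, norm_smul, Real.norm_of_nonneg (by linarith [hs1 k]),
              ← dist_eq_norm]
            exact mul_le_mul_of_nonneg_left (hR hx₀ hx) (by linarith [hs1 k])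
        _ < η := hk
    exact dist_convolution_le hε₂.le (φ k).support_normed_eq.subset (φ k).nonneg_normed
      (φ k).integral_normed hg.aestronglyMeasurable hzx
  rw [hdecomp]
  calc _ ≤ eLpNorm (regularize (φ k) x₀ (s k) (f - g) - (f - g)) 2 (volume.restrict Ω) +
        eLpNorm (regularize (φ k) x₀ (s k) g - g) 2 (volume.restrict Ω) :=
        eLpNorm_add_le (hm1.sub hfgLp.1).restrict hm2.restrict (by norm_num)
    _ ≤ ε / 2 + ε / 2 := add_le_add hA hB
    _ = ε := ENNReal.add_halves ε

end Regularization


/-! ### Gradients and `C¹` approximation in `H¹` -/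

lemma inner_gradient {f : Eu N → ℝ} (x e : Eu N) : ⟪gradient f x, e⟫ = fderiv ℝ f x e := by
  rw [gradient, InnerProductSpace.toDual_symm_apply]

lemma gradient_apply (f : Eu N → ℝ) (x : Eu N) (i : Fin N) :
    gradient f x i = fderiv ℝ f x (EuclideanSpace.single i 1) := by
  rw [← inner_gradient, EuclideanSpace.inner_single_right]
  simp

lemma norm_gradient (f : Eu N → ℝ) (x : Eu N) : ‖gradient f x‖ = ‖fderiv ℝ f x‖ := by
  rw [gradient, LinearIsometryEquiv.norm_map]

lemma continuous_gradient {f : Eu N → ℝ} (hf : ContDiff ℝ 1 f) : Continuous (gradient f) := by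
  have h : Continuous (fderiv ℝ f) := hf.continuous_fderiv (by norm_num)
  exact (InnerProductSpace.toDual ℝ (Eu N)).symm.continuous.comp h

section Regularization

open Filter Topology

lemma contDiff_mollify (φ : ContDiffBump (0 : Eu N)) {f : Eu N → ℝ}
    (hf : LocallyIntegrable f volume) : ContDiff ℝ 1 (mollify φ f) :=
  φ.hasCompactSupport_normed.contDiff_convolution_left (n := 1) _ φ.contDiff_normed hf

lemma fderiv_mollify_apply (φ : ContDiffBump (0 : Eu N)) {f : Eu N → ℝ}
    (hf : LocallyIntegrable f volume) (z e : Eu N) :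
    fderiv ℝ (mollify φ f) z e = ∫ t, f t * fderiv ℝ (φ.normed volume) (z - t) e := by
  have hφ : HasCompactSupport (φ.normed volume) := φ.hasCompactSupport_normed
  have hc : ContDiff ℝ 1 (φ.normed volume) := φ.contDiff_normed (n := 1)
  have hd : Continuous (fderiv ℝ (φ.normed volume)) := hc.continuous_fderiv (by norm_num)
  have h1 : HasFDerivAt (mollify φ f) _ z :=
    hφ.hasFDerivAt_convolution_left (ContinuousLinearMap.lsmul ℝ ℝ) hc hf z
  have h2 := ((hφ.fderiv ℝ).convolutionExists_left
    ((ContinuousLinearMap.lsmul ℝ ℝ).precompL (Eu N)) hd hf) z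
  rw [h1.fderiv, convolution_def, ContinuousLinearMap.integral_apply h2]
  simp only [ContinuousLinearMap.precompL_apply, ContinuousLinearMap.lsmul_apply, smul_eq_mul]
  rw [← integral_sub_left_eq_self _ volume z]
  refine integral_congr_ae (ae_of_all _ fun t => ?_)
  simp only [sub_sub_cancel]
  ring

/-- Extension by zero has no weak gradient across the boundary, but at a point whose ball of radius
`φ.rOut` lies in `Ω` the reflected bump is an admissible test function in `IsH1`. -/
lemma fderiv_mollify_indicator {Ω : Set (Eu N)} (hΩ : IsOpen Ω) {ψ : Eu N → ℝ} {g : Eu N → Eu N}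
    (h : IsH1 Ω ψ g) (φ : ContDiffBump (0 : Eu N)) {z : Eu N}
    (hz : Metric.closedBall z φ.rOut ⊆ Ω) (i : Fin N) :
    fderiv ℝ (mollify φ (Ω.indicator ψ)) z (EuclideanSpace.single i 1) =
      mollify φ (Ω.indicator g) z i := by
  have hψ : MemLp (Ω.indicator ψ) 2 volume := (memLp_indicator_iff_restrict hΩ.measurableSet).2 h.memLp
  have hg : MemLp (Ω.indicator g) 2 volume :=
    (memLp_indicator_iff_restrict hΩ.measurableSet).2 h.memLp_grad
  have hφ : HasCompactSupport (φ.normed volume) := φ.hasCompactSupport_normed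
  have hc : ContDiff ℝ ∞ (φ.normed volume) := φ.contDiff_normed (n := ⊤)
  rw [fderiv_mollify_apply φ (hψ.locallyIntegrable (by norm_num))]
  set ζ : Eu N → ℝ := fun t => φ.normed volume (z - t) with hζdef
  have hζ : ContDiff ℝ ∞ ζ := hc.comp (contDiff_const.sub contDiff_id)
  have hζsub : tsupport ζ ⊆ Metric.closedBall z φ.rOut := by
    refine closure_minimal ?_ Metric.isClosed_closedBall
    intro t ht
    have h1 : z - t ∈ Function.support (φ.normed volume) := ht
    rw [φ.support_normed_eq, mem_ball_zero_iff] at h1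
    rw [mem_closedBall_iff_norm, norm_sub_rev]
    exact h1.le
  have hζc : HasCompactSupport ζ :=
    HasCompactSupport.of_support_subset_isCompact (isCompact_closedBall z φ.rOut)
      ((subset_tsupport ζ).trans hζsub)
  have hibp := h.integral_by_parts ζ hζ hζc (hζsub.trans hz) i
  have hfd : ∀ t, fderiv ℝ ζ t (EuclideanSpace.single i 1) =
      -fderiv ℝ (φ.normed volume) (z - t) (EuclideanSpace.single i 1) := by
    intro t
    have h1 : HasFDerivAt (fun t : Eu N => z - t) (-ContinuousLinearMap.id ℝ (Eu N)) t :=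
      (hasFDerivAt_id t).const_sub z
    have h2 := ((hc.differentiable (by simp)) (z - t)).hasFDerivAt.comp t h1
    have h3 : fderiv ℝ ζ t = _ := h2.fderiv
    rw [h3]
    simp
  have e1 : ∫ t, Ω.indicator ψ t * fderiv ℝ (φ.normed volume) (z - t) (EuclideanSpace.single i 1) =
      ∫ t in Ω, g t i * ζ t := by
    rw [← neg_inj, ← hibp, ← integral_neg, ← integral_indicator hΩ.measurableSet]
    refine integral_congr_ae (ae_of_all _ fun t => ?_)
    by_cases ht : t ∈ Ω
    · simp only [indicator_of_mem ht, hfd]; ring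
    · simp [indicator_of_notMem ht]
  have hex := (hφ.convolutionExists_left (ContinuousLinearMap.lsmul ℝ ℝ) hc.continuous
    (hg.locallyIntegrable (by norm_num))) z
  have e2 : mollify φ (Ω.indicator g) z i =
      ∫ t, φ.normed volume t * (Ω.indicator g (z - t)) i := by
    have h1 := (EuclideanSpace.proj (𝕜 := ℝ) i).integral_comp_comm hex
    exact h1.symm
  rw [e1, e2, ← integral_sub_left_eq_self _ volume z, ← integral_indicator hΩ.measurableSet]
  refine integral_congr_ae (ae_of_all _ fun t => ?_)
  simp only [sub_sub_cancel]
  by_cases ht : t ∈ Ω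
  · simp only [indicator_of_mem ht, hζdef]; ring
  · simp [indicator_of_notMem ht]

/-- Contracting the convex set `Ω` towards an interior point `x₀` leaves room, proportional to `q
k`, for a mollifier. The resulting functions are `C¹` on the whole space, and their gradients are `s
k` times the regularized weak gradient. -/
lemma exists_contDiff_approx {Ω : Set (Eu N)} (hΩ : IsOpen Ω) (hb : Bornology.IsBounded Ω)
    (hconv : Convex ℝ Ω) (hne : Ω.Nonempty) {ψ : Eu N → ℝ} {g : Eu N → Eu N} (h : IsH1 Ω ψ g) :
    ∃ Ψ : ℕ → Eu N → ℝ, (∀ k, ContDiff ℝ 1 (Ψ k)) ∧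
      Tendsto (fun k => eLpNorm (Ψ k - ψ) 2 (volume.restrict Ω)) atTop (𝓝 0) ∧
      Tendsto (fun k => eLpNorm (gradient (Ψ k) - g) 2 (volume.restrict Ω)) atTop (𝓝 0) := by
  obtain ⟨x₀, hx₀⟩ := hne
  obtain ⟨r, hr, hball⟩ := Metric.isOpen_iff.1 hΩ x₀ hx₀
  have hmΩ := hΩ.measurableSet
  have hψ : MemLp (Ω.indicator ψ) 2 volume := (memLp_indicator_iff_restrict hmΩ).2 h.memLp
  have hg : MemLp (Ω.indicator g) 2 volume := (memLp_indicator_iff_restrict hmΩ).2 h.memLp_grad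
  set q : ℕ → ℝ := fun k => 1 / ((k : ℝ) + 1) / 2 with hq
  have hq0 : ∀ k, 0 < q k := fun k => by positivity
  have hq1 : ∀ k, q k ≤ 1 / 2 := fun k => by
    have : 1 / ((k : ℝ) + 1) ≤ 1 := by
      rw [div_le_one (by positivity)]; linarith [Nat.cast_nonneg (α := ℝ) k]
    simp only [hq]; linarith
  have hqlim : Tendsto q atTop (𝓝 0) := by
    simpa [hq] using (tendsto_one_div_add_atTop_nhds_zero_nat (𝕜 := ℝ)).div_const 2
  set s : ℕ → ℝ := fun k => 1 - q k
  have hs : ∀ k, 1 / 2 ≤ s k := fun k => by linarith [hq1 k]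
  have hs1 : ∀ k, s k ≤ 1 := fun k => by linarith [hq0 k]
  have hslim : Tendsto s atTop (𝓝 1) := by simpa using hqlim.const_sub 1
  set φ : ℕ → ContDiffBump (0 : Eu N) := fun k =>
    ⟨q k * r / 4, q k * r / 2, by have := hq0 k; positivity, by
      have := mul_pos (hq0 k) hr; linarith⟩
  have hφ : Tendsto (fun k => (φ k).rOut) atTop (𝓝 0) := by
    simpa using (hqlim.mul_const r).div_const 2
  -- Every point of this ball is a combination `s k • x + q k • w` with `w` in the ball of radius
  -- `r` about `x₀`, hence lies in `Ω` by convexity.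
  have hzball : ∀ k, ∀ x ∈ Ω, Metric.closedBall (x₀ + s k • (x - x₀)) (φ k).rOut ⊆ Ω := by
    intro k x hx y hy
    have hqk := hq0 k
    set w := x₀ + (q k)⁻¹ • (y - (x₀ + s k • (x - x₀))) with hw
    have hwΩ : w ∈ Ω := by
      apply hball
      rw [mem_ball_iff_norm, hw, add_sub_cancel_left, norm_smul, norm_inv,
        Real.norm_of_nonneg hqk.le, inv_mul_lt_iff₀ hqk]
      refine (mem_closedBall_iff_norm.1 hy).trans_lt ?_
      have := mul_pos hqk hr
      change q k * r / 2 < q k * r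
      linarith
    have hyw : y = s k • x + q k • w := by
      rw [hw, smul_add, smul_smul, mul_inv_cancel₀ hqk.ne', one_smul]
      simp only [s, sub_smul, one_smul, smul_sub]
      abel
    rw [hyw]
    exact hconv hx hwΩ (by linarith [hs k]) hqk.le (by simp [s])
  have hli := hψ.locallyIntegrable (by norm_num)
  have hlg := hg.locallyIntegrable (by norm_num)
  have hgrad : ∀ k, ∀ x ∈ Ω, gradient (regularize (φ k) x₀ (s k) (Ω.indicator ψ)) x =
      s k • regularize (φ k) x₀ (s k) (Ω.indicator g) x := by
    intro k x hx
    ext i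
    have h1 : HasFDerivAt (fun x : Eu N => x₀ + s k • (x - x₀))
        (s k • ContinuousLinearMap.id ℝ (Eu N)) x :=
      (((hasFDerivAt_id x).sub_const x₀).const_smul (s k)).const_add x₀
    have h2 := (((contDiff_mollify (φ k) hli).differentiable (by norm_num))
      (x₀ + s k • (x - x₀))).hasFDerivAt.comp x h1
    have h3 : fderiv ℝ (regularize (φ k) x₀ (s k) (Ω.indicator ψ)) x = _ := h2.fderiv
    rw [gradient_apply, h3]
    simp only [ContinuousLinearMap.comp_apply, smul_apply,
      ContinuousLinearMap.id_apply, map_smul, smul_eq_mul, PiLp.smul_apply, regularize]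
    rw [fderiv_mollify_indicator hΩ h (φ k) (hzball k x hx)]
  refine ⟨fun k => regularize (φ k) x₀ (s k) (Ω.indicator ψ), fun k =>
    (contDiff_mollify (φ k) hli).comp (by fun_prop), ?_, ?_⟩
  · refine (tendsto_eLpNorm_regularize_sub hb hmΩ hx₀ hs hs1 hslim hφ hψ).congr fun k => ?_
    refine eLpNorm_congr_ae ((ae_restrict_iff' hmΩ).2 (ae_of_all _ fun x hx => ?_))
    simp [indicator_of_mem hx]
  · have hlim := tendsto_eLpNorm_regularize_sub hb hmΩ hx₀ hs hs1 hslim hφ hg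
    have hlim2 : Tendsto (fun k => eLpNorm (regularize (φ k) x₀ (s k) (Ω.indicator g) -
        Ω.indicator g) 2 (volume.restrict Ω) +
        ENNReal.ofReal (q k) * eLpNorm (Ω.indicator g) 2 volume) atTop (𝓝 0) := by
      have h1 : Tendsto (fun k => ENNReal.ofReal (q k)) atTop (𝓝 0) := by
        simpa [Function.comp_def] using (ENNReal.continuous_ofReal.tendsto 0).comp hqlim
      simpa using hlim.add (ENNReal.Tendsto.mul_const h1 (Or.inr hg.2.ne))
    refine tendsto_of_tendsto_of_tendsto_of_le_of_le tendsto_const_nhds hlim2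
      (fun _ => zero_le) fun k => ?_
    have hc : AEStronglyMeasurable (regularize (φ k) x₀ (s k) (Ω.indicator g) - Ω.indicator g)
        (volume.restrict Ω) :=
      ((continuous_regularize _ _ _ hlg).aestronglyMeasurable.sub hg.1).restrict
    calc eLpNorm (gradient (regularize (φ k) x₀ (s k) (Ω.indicator ψ)) - g) 2 (volume.restrict Ω)
        = eLpNorm (s k • (regularize (φ k) x₀ (s k) (Ω.indicator g) - Ω.indicator g) -
            q k • Ω.indicator g) 2 (volume.restrict Ω) := by
          refine eLpNorm_congr_ae ((ae_restrict_iff' hmΩ).2 (ae_of_all _ fun x hx => ?_))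
          simp only [Pi.sub_apply, Pi.smul_apply, hgrad k x hx, indicator_of_mem hx, s, smul_sub,
            sub_smul, one_smul]
          abel
      _ ≤ eLpNorm (s k • (regularize (φ k) x₀ (s k) (Ω.indicator g) - Ω.indicator g)) 2
            (volume.restrict Ω) + eLpNorm (q k • Ω.indicator g) 2 (volume.restrict Ω) :=
          eLpNorm_sub_le (hc.const_smul _) (hg.1.restrict.const_smul _) (by norm_num)
      _ ≤ _ := by
          rw [eLpNorm_const_smul, eLpNorm_const_smul]
          refine add_le_add (mul_le_of_le_one_left zero_le ?_) (mul_le_mul' ?_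
            (eLpNorm_mono_measure _ Measure.restrict_le_self))
          · rw [Real.enorm_of_nonneg (by linarith [hs k]), ENNReal.ofReal_le_one]
            exact hs1 k
          · rw [Real.enorm_of_nonneg (hq0 k).le]

end Regularization


/-! ### Finite element functions -/

lemma contDiff_eval (p : MvPolynomial (Fin N) ℝ) {n : WithTop ℕ∞} :
    ContDiff ℝ n fun x : Eu N => MvPolynomial.eval (fun i => x i) p := by
  induction p using MvPolynomial.induction_on with
  | C a => simpa using contDiff_const
  | add p q hp hq => simpa using hp.add hq
  | mul_X p i hp => simpa using hp.mul (contDiff_piLp_apply (p := 2) (i := i))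

lemma exists_eval_eq_bary (K : Finset (Eu N)) (v : Eu N) :
    ∃ p : MvPolynomial (Fin N) ℝ, p.totalDegree ≤ 1 ∧
      ∀ x : Eu N, bary K v x = MvPolynomial.eval (fun i => x i) p := by
  set h := heightVec K v with hh
  refine ⟨MvPolynomial.C (1 + ⟪h, v⟫ / ‖h‖ ^ 2) +
    ∑ i, MvPolynomial.C (-(h i / ‖h‖ ^ 2)) * MvPolynomial.X i, ?_, fun x => ?_⟩
  · refine (MvPolynomial.totalDegree_add _ _).trans (max_le (by rw [MvPolynomial.totalDegree_C]; omega) ?_)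
    refine MvPolynomial.totalDegree_finsetSum_le fun i _ => ?_
    exact (MvPolynomial.totalDegree_mul _ _).trans (by simp)
  · have : ⟪h, x⟫ = ∑ i, h i * x i := by
      simp [PiLp.inner_apply, mul_comm]
    simp only [bary, ← hh, inner_sub_right, this, map_add, map_sum, map_mul, MvPolynomial.eval_C,
      MvPolynomial.eval_X, neg_mul, Finset.sum_neg_distrib, div_mul_eq_mul_div, ← Finset.sum_div]
    ring

namespace Triangulation

variable {Ω : Set (Eu N)} (𝒯 : Triangulation Ω)

lemma closure_eq_iUnion_coe : closure Ω = ⋃ K : 𝒯.elements, cell K.1 := by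
  rw [𝒯.closure_eq_iUnion, Set.iUnion_subtype]

lemma continuousOn_closure {f : Eu N → ℝ} (h : ∀ K ∈ 𝒯.elements, ContinuousOn f (cell K)) :
    ContinuousOn f (closure Ω) := by
  rw [𝒯.closure_eq_iUnion_coe]
  exact (locallyFinite_of_finite _).continuousOn_iUnion
    (fun K => (isCompact_cell K.1).isClosed) fun K => h K.1 K.2

open Classical in
/-- The continuous piecewise affine function with nodal values `a`. -/
def interp (a : Eu N → ℝ) (x : Eu N) : ℝ :=
  if h : ∃ K ∈ 𝒯.elements, x ∈ cell K then ∑ v ∈ h.choose, a v * bary h.choose v x else 0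

/-- A common point lies in the common face, where both sets of coordinates are the weights of the
shared vertices. Thus `interp` does not depend on the chosen element and is continuous across faces.
-/
lemma sum_bary_congr (hN : 1 ≤ N) {K L : Finset (Eu N)} (hK : K ∈ 𝒯.elements)
    (hL : L ∈ 𝒯.elements) {x : Eu N} (hxK : x ∈ cell K) (hxL : x ∈ cell L) (a : Eu N → ℝ) :
    ∑ v ∈ K, a v * bary K v x = ∑ v ∈ L, a v * bary L v x := by
  classical
  have hx : x ∈ cell (K ∩ L) := by convert! 𝒯.inter_cell_subset hK hL ⟨hxK, hxL⟩
  have sK := 𝒯.isSimplex hK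
  have sL := 𝒯.isSimplex hL
  obtain ⟨h1, h2⟩ := sK.bary_combination_subset hN Finset.inter_subset_left hx
  have key : ∀ v ∈ K ∩ L, bary L v x = bary K v x := by
    intro v hv
    have := sL.bary_combination hN (c := fun v => if v ∈ K ∩ L then bary K v x else 0) (v := v) ?_
      (Finset.mem_inter.1 hv).2
    · simp only [ite_smul, zero_smul, hv, if_true] at this
      rw [← this]
      congr 1
      rw [← Finset.sum_filter, Finset.filter_mem_eq_inter,
        Finset.inter_eq_right.2 Finset.inter_subset_right, h2]
    · rw [← Finset.sum_filter, Finset.filter_mem_eq_inter,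
        Finset.inter_eq_right.2 Finset.inter_subset_right, h1]
  rw [← Finset.sum_subset (Finset.inter_subset_left (s₁ := K) (s₂ := L)) fun v hv hv' => by
      rw [sK.bary_eq_zero_of_notMem hN Finset.inter_subset_left hx hv hv', mul_zero],
    ← Finset.sum_subset (Finset.inter_subset_right (s₁ := K) (s₂ := L)) fun v hv hv' => by
      rw [sL.bary_eq_zero_of_notMem hN Finset.inter_subset_right hx hv hv', mul_zero]]
  exact Finset.sum_congr rfl fun v hv => by rw [key v hv]

lemma interp_apply (hN : 1 ≤ N) (a : Eu N → ℝ) {K : Finset (Eu N)} (hK : K ∈ 𝒯.elements)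
    {x : Eu N} (hx : x ∈ cell K) : 𝒯.interp a x = ∑ v ∈ K, a v * bary K v x := by
  have h : ∃ K ∈ 𝒯.elements, x ∈ cell K := ⟨K, hK, hx⟩
  rw [interp, dif_pos h]
  exact 𝒯.sum_bary_congr hN h.choose_spec.1 hK h.choose_spec.2 hx a

lemma interp_mem_feSpace (hN : 1 ≤ N) {m : ℕ} (hm : 1 ≤ m) (a : Eu N → ℝ) :
    𝒯.interp a ∈ feSpace 𝒯 m := by
  refine ⟨𝒯.continuousOn_closure fun K hK => ?_, fun K hK => ?_⟩
  · refine ContinuousOn.congr ?_ fun x hx => 𝒯.interp_apply hN a hK hx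
    exact (continuous_finsetSum _ fun v _ => continuous_const.mul (continuous_bary K v)).continuousOn
  · choose p hp1 hp2 using exists_eval_eq_bary K
    refine ⟨∑ v ∈ K, MvPolynomial.C (a v) * p v, ?_, fun x hx => ?_⟩
    · refine MvPolynomial.totalDegree_finsetSum_le fun v _ => ?_
      refine (MvPolynomial.totalDegree_mul _ _).trans ?_
      have := hp1 v
      simp only [MvPolynomial.totalDegree_C]
      omega
    · rw [𝒯.interp_apply hN a hK hx]
      simp [hp2]

lemma restrict_eq_sum (hconv : Convex ℝ Ω) :
    (volume : Measure (Eu N)).restrict Ω = ∑ K ∈ 𝒯.elements, volume.restrict (cell K) := by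
  have h0 : volume (frontier Ω) = 0 := hconv.addHaar_frontier volume
  have h1 : (volume : Measure (Eu N)).restrict Ω = volume.restrict (closure Ω) :=
    Measure.restrict_congr_set (closure_ae_eq_of_null_frontier h0).symm
  rw [h1, 𝒯.closure_eq_iUnion_coe,
    Measure.restrict_iUnion_ae
      (fun K L h => 𝒯.aedisjoint_cell K.2 L.2 fun e => h (Subtype.ext e))
      fun K => (measurableSet_cell _).nullMeasurableSet]
  rw [Measure.sum_fintype]
  exact Finset.sum_coe_sort 𝒯.elements fun K => volume.restrict (cell K)

lemma integral_eq_sum (hconv : Convex ℝ Ω) {f : Eu N → ℝ}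
    (hf : ∀ K ∈ 𝒯.elements, IntegrableOn f (cell K)) :
    ∫ x in Ω, f x = ∑ K ∈ 𝒯.elements, ∫ x in cell K, f x := by
  rw [𝒯.restrict_eq_sum hconv, integral_finsetSum_measure hf]

end Triangulation

/-! ### Differential operators on an element -/

lemma fderiv_mul_fderiv_apply {P z : Eu N → ℝ} (hP : ContDiff ℝ 2 P) (hz : ContDiff ℝ 1 z)
    (x e : Eu N) :
    fderiv ℝ (fun y => z y * fderiv ℝ P y e) x e =
      z x * fderiv ℝ (fderiv ℝ P) x e e + fderiv ℝ z x e * fderiv ℝ P x e := by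
  have h1 : DifferentiableAt ℝ (fderiv ℝ P) x :=
    ((hP.fderiv_right (m := 1) (by norm_num)).differentiable (by norm_num)) x
  have h2 : DifferentiableAt ℝ z x := hz.differentiable (by norm_num) x
  have h3 := (h2.hasFDerivAt.mul (h1.hasFDerivAt.clm_apply (hasFDerivAt_const e x)))
  have h4 := h3.fderiv
  simp only [Pi.mul_def] at h4
  rw [h4]
  simp [mul_comm]

namespace IsSimplex

variable {K : Finset (Eu N)}

/-- A cell is convex with interior points, so derivatives within it are unique up to the boundary
and may be computed from any smooth representative. -/
lemma laplacianWithin_eq (hK : IsSimplex K) (hN : 1 ≤ N) {w P : Eu N → ℝ} (hP : ContDiff ℝ 2 P)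
    (hw : EqOn w P (cell K)) {x : Eu N} (hx : x ∈ cell K) :
    InnerProductSpace.laplacianWithin w (cell K) x =
      ∑ i : Fin N, fderiv ℝ (fderiv ℝ P) x (EuclideanSpace.single i 1)
        (EuclideanSpace.single i 1) := by
  rw [InnerProductSpace.laplacianWithin_eq_iteratedFDerivWithin_orthonormalBasis w
    (hK.uniqueDiffOn_cell hN) hx (EuclideanSpace.basisFun (Fin N) ℝ),
    iteratedFDerivWithin_congr hw hx,
    iteratedFDerivWithin_eq_iteratedFDeriv (hK.uniqueDiffOn_cell hN) hP.contDiffAt hx]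
  simp [iteratedFDeriv_two_apply]

lemma normalDeriv_eq (hK : IsSimplex K) (hN : 1 ≤ N) {w P : Eu N → ℝ} (hP : ContDiff ℝ 1 P)
    (hw : EqOn w P (cell K)) (v : Eu N) {x : Eu N} (hx : x ∈ cell K) :
    normalDeriv w K v x = fderiv ℝ P x (outerNormal K v) := by
  rw [normalDeriv, fderivWithin_congr hw (hw hx),
    (hP.differentiable (by norm_num) x).fderivWithin (hK.uniqueDiffOn_cell hN x hx)]

lemma integrableOn_cell {f : Eu N → ℝ} (hf : ContinuousOn f (cell K)) : IntegrableOn f (cell K) :=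
  hf.integrableOn_compact (isCompact_cell K)

/-- Integration by parts on a simplex. -/
lemma integral_inner_gradient (hK : IsSimplex K) (hN : 1 ≤ N) {P z : Eu N → ℝ}
    (hP : ContDiff ℝ 2 P) (hz : ContDiff ℝ 1 z) :
    ∫ x in cell K, ⟪gradient P x, gradient z x⟫ =
      -(∫ x in cell K, (∑ i : Fin N, fderiv ℝ (fderiv ℝ P) x (EuclideanSpace.single i 1)
        (EuclideanSpace.single i 1)) * z x) +
      ∑ v ∈ K, ∫ x in cell (faceOpp K v), fderiv ℝ P x (outerNormal K v) * z x ∂μHE[N - 1] := by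
  have cP : Continuous (fderiv ℝ P) := hP.continuous_fderiv (by norm_num)
  have cP2 : Continuous (fderiv ℝ (fderiv ℝ P)) :=
    (hP.fderiv_right (m := 1) (by norm_num)).continuous_fderiv (by norm_num)
  have cz : Continuous (fderiv ℝ z) := hz.continuous_fderiv (by norm_num)
  let e : Fin N → Eu N := fun i => EuclideanSpace.single i 1
  have hcd : ∀ i, ContDiff ℝ 1 fun y => z y * fderiv ℝ P y (e i) := fun i =>
    hz.mul ((hP.fderiv_right (m := 1) (by norm_num)).clm_apply contDiff_const)
  have h1 : ∀ x, ⟪gradient P x, gradient z x⟫ = ∑ i, fderiv ℝ z x (e i) * fderiv ℝ P x (e i) := by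
    intro x
    rw [PiLp.inner_apply]
    simp [gradient_apply, e]
  have h2 := fun i => hK.integral_fderiv_apply hN (hcd i) (e i)
  simp only [fderiv_mul_fderiv_apply hP hz] at h2
  have h3 : ∀ i, ∫ x in cell K, (z x * fderiv ℝ (fderiv ℝ P) x (e i) (e i) +
      fderiv ℝ z x (e i) * fderiv ℝ P x (e i)) =
      (∫ x in cell K, fderiv ℝ (fderiv ℝ P) x (e i) (e i) * z x) +
      ∫ x in cell K, fderiv ℝ z x (e i) * fderiv ℝ P x (e i) := by
    intro i
    rw [← integral_add]
    · simp only [mul_comm (z _)]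
    · exact integrableOn_cell (by have := hz.continuous; fun_prop)
    · exact integrableOn_cell (by fun_prop)
  simp only [h1]
  rw [integral_finsetSum _ fun i _ => integrableOn_cell (by fun_prop)]
  simp only [Finset.sum_mul]
  rw [integral_finsetSum _ fun i _ => integrableOn_cell (by have := hz.continuous; fun_prop)]
  rw [← sub_eq_iff_eq_add', sub_neg_eq_add, ← Finset.sum_add_distrib]
  have h4 : ∀ i, (∫ x in cell K, fderiv ℝ z x (e i) * fderiv ℝ P x (e i)) +
      (∫ x in cell K, fderiv ℝ (fderiv ℝ P) x (e i) (e i) * z x) =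
      ∑ v ∈ K, ⟪outerNormal K v, e i⟫ *
        ∫ y in cell (faceOpp K v), z y * fderiv ℝ P y (e i) ∂μHE[N - 1] := fun i => by
    rw [← h2, h3, add_comm]
  simp only [e] at h4 ⊢
  rw [Finset.sum_congr rfl fun i _ => h4 i, Finset.sum_comm]
  refine Finset.sum_congr rfl fun v hv => ?_
  simp only [← integral_const_mul]
  rw [← integral_finsetSum]
  · congr 1 with y
    have h5 : outerNormal K v = ∑ i, ⟪outerNormal K v, EuclideanSpace.single i 1⟫ •
        (EuclideanSpace.single i 1 : Eu N) := by
      conv_lhs => rw [← (EuclideanSpace.basisFun (Fin N) ℝ).sum_repr' (outerNormal K v)]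
      simp [real_inner_comm]
    conv_rhs => rw [h5]
    simp only [map_sum, map_smul, smul_eq_mul, Finset.sum_mul]
    exact Finset.sum_congr rfl fun i _ => by ring
  · intro i _
    exact hK.integrableOn_face hN hv (by have := hz.continuous; fun_prop)

end IsSimplex

/-! ### Finite element functions on an element -/

lemma exists_contDiff_eqOn {Ω : Set (Eu N)} {𝒯 : Triangulation Ω} {m : ℕ} {w : Eu N → ℝ}
    (hw : w ∈ feSpace 𝒯 m) {K : Finset (Eu N)} (hK : K ∈ 𝒯.elements) :
    ∃ P : Eu N → ℝ, ContDiff ℝ 2 P ∧ EqOn w P (cell K) := by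
  obtain ⟨p, -, hp⟩ := hw.2 K hK
  exact ⟨_, contDiff_eval p, hp⟩

lemma gradient_eq_of_eqOn {K : Finset (Eu N)} {w P : Eu N → ℝ} (h : EqOn w P (cell K)) {x : Eu N}
    (hx : x ∈ interior (cell K)) : gradient w x = gradient P x := by
  have : w =ᶠ[nhds x] P := (h.mono interior_subset).eventuallyEq_of_mem
    (isOpen_interior.mem_nhds hx)
  rw [gradient, gradient, this.fderiv_eq]

lemma IsSimplex.gradient_ae_eq {K : Finset (Eu N)} (hK : IsSimplex K) {w P : Eu N → ℝ}
    (h : EqOn w P (cell K)) : gradient w =ᵐ[volume.restrict (cell K)] gradient P := by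
  rw [← Measure.restrict_congr_set hK.interior_ae_eq_cell]
  exact (ae_restrict_mem isOpen_interior.measurableSet).mono fun x hx => gradient_eq_of_eqOn h hx

/-- The polynomials of bounded degree form a finite-dimensional, hence closed, subspace of the
functions on the cell with the topology of pointwise convergence. -/
lemma isClosed_eval_image (K : Finset (Eu N)) (m : ℕ) :
    ∃ V : Submodule ℝ (cell K → ℝ), IsClosed (V : Set (cell K → ℝ)) ∧
      ∀ f, f ∈ V ↔ ∃ p : MvPolynomial (Fin N) ℝ, p.totalDegree ≤ m ∧
        ∀ x : cell K, f x = MvPolynomial.eval (fun i => x.1 i) p := by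
  let E : MvPolynomial (Fin N) ℝ →ₗ[ℝ] (cell K → ℝ) :=
    LinearMap.pi fun x => (MvPolynomial.aeval (fun i => x.1 i)).toLinearMap
  refine ⟨(MvPolynomial.restrictTotalDegree (Fin N) ℝ m).map E,
    Submodule.closed_of_finiteDimensional _, fun f => ?_⟩
  simp only [Submodule.mem_map, MvPolynomial.mem_restrictTotalDegree]
  refine exists_congr fun p => and_congr_right fun _ => ?_
  rw [funext_iff]
  refine forall_congr' fun x => ?_
  rw [eq_comm]
  simp [E, MvPolynomial.aeval_eq_eval]

open Filter Topology in
-- The difference quotients lie in that closed subspace and converge pointwise, so differentiability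
-- in time at each point already makes the time derivative a polynomial on each element.
lemma timeDeriv_eqOn {Ω : Set (Eu N)} {𝒯 : Triangulation Ω} {m : ℕ} {T : ℝ} {u : ℝ → Eu N → ℝ}
    (hu : ∀ t ∈ Icc 0 T, u t ∈ feSpace 𝒯 m) {t : ℝ} (ht : t ∈ Ioc 0 T)
    (hd : ∀ x ∈ closure Ω, DifferentiableWithinAt ℝ (fun s => u s x) (Icc 0 T) t)
    {K : Finset (Eu N)} (hK : K ∈ 𝒯.elements) :
    ∃ p : MvPolynomial (Fin N) ℝ, p.totalDegree ≤ m ∧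
      ∀ x ∈ cell K, timeDeriv T u t x = MvPolynomial.eval (fun i => x i) p := by
  obtain ⟨V, hV, hmem⟩ := isClosed_eval_image K m
  have hin : ∀ s ∈ Icc 0 T, (fun x : cell K => u s x) ∈ V := fun s hs => by
    obtain ⟨p, hp, h⟩ := (hu s hs).2 K hK
    exact (hmem _).2 ⟨p, hp, fun x => h x x.2⟩
  have hlim : Tendsto (fun s => fun x : cell K => slope (fun s => u s x) t s)
      (𝓝[Icc 0 T \ {t}] t) (𝓝 fun x : cell K => timeDeriv T u t x) := by
    refine tendsto_pi_nhds.2 fun x => ?_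
    exact hasDerivWithinAt_iff_tendsto_slope.1
      (hd x (𝒯.cell_subset_closure hK x.2)).hasDerivWithinAt
  have hne : (𝓝[Icc 0 T \ {t}] t).NeBot := by
    refine (nhdsWithin_Ioo_eq_nhdsLT ht.1 ▸ inferInstance : (𝓝[Ioo 0 t] t).NeBot).mono
      (nhdsWithin_mono _ fun s hs => ⟨⟨hs.1.le, hs.2.le.trans ht.2⟩, hs.2.ne⟩)
  have htI : t ∈ Icc 0 T := ⟨ht.1.le, ht.2⟩
  have := hV.mem_of_tendsto hlim (eventually_mem_nhdsWithin.mono fun s hs => by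
    have h := V.smul_mem (s - t)⁻¹ (V.sub_mem (hin s hs.1) (hin t htI))
    exact h)
  obtain ⟨p, hp, h⟩ := (hmem _).1 this
  exact ⟨p, hp, fun x hx => h ⟨x, hx⟩⟩

/-! ### Cauchy-Schwarz and local bounds for the interpolation error -/

lemma abs_integral_mul_le {α : Type*} [MeasurableSpace α] {μ : Measure α} {f g : α → ℝ}
    (hf : Integrable (fun x => f x ^ 2) μ) (hg : Integrable (fun x => g x ^ 2) μ)
    (hfg : Integrable (fun x => f x * g x) μ) :
    |∫ x, f x * g x ∂μ| ≤ √(∫ x, f x ^ 2 ∂μ) * √(∫ x, g x ^ 2 ∂μ) := by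
  rw [← Real.sqrt_mul (integral_nonneg fun x => sq_nonneg _)]
  refine Real.le_sqrt_of_sq_le ?_
  rw [sq_abs]
  have h : ∀ t : ℝ, 0 ≤ (∫ x, g x ^ 2 ∂μ) * (t * t) + 2 * (∫ x, f x * g x ∂μ) * t +
      ∫ x, f x ^ 2 ∂μ := by
    intro t
    have : 0 ≤ ∫ x, (f x + t * g x) ^ 2 ∂μ := integral_nonneg fun x => sq_nonneg _
    have h1 : ∀ x, (f x + t * g x) ^ 2 = t * t * g x ^ 2 + 2 * t * (f x * g x) + f x ^ 2 :=
      fun x => by ring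
    simp only [h1] at this
    have h2 : Integrable (fun x => t * t * g x ^ 2 + 2 * t * (f x * g x)) μ :=
      (hg.const_mul _).add (hfg.const_mul _)
    rw [integral_add h2 hf, integral_add (hg.const_mul _) (hfg.const_mul _), integral_const_mul, integral_const_mul] at this
    linarith
  have := discrim_le_zero h
  rw [discrim] at this
  nlinarith

/-- The square of the `L²` norm of the derivative over an element. -/
def gradSq (ψ : Eu N → ℝ) (K : Finset (Eu N)) : ℝ := ∫ x in cell K, ‖fderiv ℝ ψ x‖ ^ 2

lemma gradSq_nonneg (ψ : Eu N → ℝ) (K : Finset (Eu N)) : 0 ≤ gradSq ψ K :=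
  integral_nonneg fun _ => sq_nonneg _

lemma energy_cell {ψ : Eu N → ℝ} (hψ : ContDiff ℝ 1 ψ) (K : Finset (Eu N)) :
    energy ψ (cell K) = ENNReal.ofReal (gradSq ψ K) := by
  have : Continuous (fderiv ℝ ψ) := hψ.continuous_fderiv (by norm_num)
  rw [energy, gradSq, ofReal_integral_eq_lintegral_ofReal]
  · exact IsSimplex.integrableOn_cell (by fun_prop)
  · exact ae_of_all _ fun x => sq_nonneg _

lemma sqDev_cell {ψ : Eu N → ℝ} (hψ : ContDiff ℝ 1 ψ) (c : ℝ) (K : Finset (Eu N)) :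
    sqDev ψ c (cell K) = ENNReal.ofReal (∫ x in cell K, (ψ x - c) ^ 2) := by
  have := hψ.continuous
  rw [sqDev, ofReal_integral_eq_lintegral_ofReal]
  · exact IsSimplex.integrableOn_cell (by fun_prop)
  · exact ae_of_all _ fun x => sq_nonneg _

lemma Triangulation.energy_patch_le {Ω : Set (Eu N)} (𝒯 : Triangulation Ω) {ψ : Eu N → ℝ}
    (hψ : ContDiff ℝ 1 ψ) (z : Eu N) :
    energy ψ (𝒯.patch z) ≤ ENNReal.ofReal (∑ L ∈ 𝒯.star z, gradSq ψ L) := by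
  rw [ENNReal.ofReal_sum_of_nonneg fun L _ => gradSq_nonneg ψ L]
  simp only [← energy_cell hψ]
  have h : 𝒯.patch z = ⋃ K : 𝒯.star z, cell K.1 := by
    rw [patch, Set.iUnion_subtype]
  rw [energy, h]
  refine (lintegral_iUnion_le _ _).trans_eq ?_
  rw [tsum_fintype]
  exact Finset.sum_coe_sort (𝒯.star z) fun L => energy ψ (cell L)

namespace IsSimplex

variable {K : Finset (Eu N)}

/-- The trace inequality on a simplex. -/
lemma heightVec_mul_integral_face_le (hK : IsSimplex K) (hN : 1 ≤ N) {v : Eu N} (hv : v ∈ K)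
    {ψ : Eu N → ℝ} (hψ : ContDiff ℝ 1 ψ) (c : ℝ) :
    ‖heightVec K v‖ * ∫ y in cell (faceOpp K v), (ψ y - c) ^ 2 ∂μHE[N - 1] ≤
      (N + 1) * (∫ x in cell K, (ψ x - c) ^ 2) + Metric.diam (cell K) ^ 2 * gradSq ψ K := by
  have c1 : Continuous (fderiv ℝ ψ) := hψ.continuous_fderiv (by norm_num)
  have c0 := hψ.continuous
  have hd : ∀ x e, fderiv ℝ (fun y => (ψ y - c) ^ 2) x e = 2 * (ψ x - c) * fderiv ℝ ψ x e := by
    intro x e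
    have h := ((hψ.differentiable (by norm_num) x).hasFDerivAt.sub_const c).pow 2
    have h' := h.fderiv
    rw [h']
    simp
  -- The identity is applied to `(ψ - c) ^ 2`; the mixed term is split by `2ab ≤ a² + b²`, which
  -- raises `N` to `N + 1`.
  rw [hK.height_mul_integral_face hN hv ((hψ.sub contDiff_const).pow 2), gradSq,
    ← integral_const_mul, ← integral_const_mul, ← integral_add]
  · refine setIntegral_mono_on ?_ ?_ (measurableSet_cell K) fun x hx => ?_
    · exact integrableOn_cell (by simp only [hd]; fun_prop)
    · exact integrableOn_cell (by fun_prop)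
    · rw [hd]
      have h1 : |fderiv ℝ ψ x (x - v)| ≤ Metric.diam (cell K) * ‖fderiv ℝ ψ x‖ := by
        rw [mul_comm]
        refine ((fderiv ℝ ψ x).le_opNorm _).trans ?_
        gcongr
        rw [← dist_eq_norm]
        exact dist_le_diam_cell hx (subset_cell hv)
      have h2 := abs_le.1 h1
      have h3 : (fderiv ℝ ψ x (x - v)) ^ 2 ≤ (Metric.diam (cell K) * ‖fderiv ℝ ψ x‖) ^ 2 :=
        sq_le_sq' h2.1 h2.2
      nlinarith [sq_nonneg (ψ x - c - fderiv ℝ ψ x (x - v))]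
  · exact integrableOn_cell (by fun_prop)
  · exact integrableOn_cell (by fun_prop)

/-- Convexity of the square: the coordinates are nonnegative and sum to `1`, so the interpolation
error is an average of the local errors `s - c v`. -/
lemma sq_sub_sum_bary_le (hK : IsSimplex K) (hN : 1 ≤ N) {x : Eu N} (hx : x ∈ cell K) (s : ℝ)
    (c : Eu N → ℝ) : (s - ∑ v ∈ K, c v * bary K v x) ^ 2 ≤ ∑ v ∈ K, (s - c v) ^ 2 := by
  have h1 : s - ∑ v ∈ K, c v * bary K v x = ∑ v ∈ K, bary K v x • (s - c v) := by
    simp only [smul_eq_mul, mul_sub, Finset.sum_sub_distrib, ← Finset.sum_mul, hK.sum_bary hN x,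
      one_mul, mul_comm (bary K _ x) (c _)]
  have h0 := (hK.mem_cell_iff hN).1 hx
  rw [h1]
  refine ((even_two.convexOn_pow (𝕜 := ℝ)).map_sum_le h0 (hK.sum_bary hN x) (by simp)).trans ?_
  refine Finset.sum_le_sum fun v hv => ?_
  exact mul_le_of_le_one_left (sq_nonneg _) (hK.bary_le_one hN hv hx)

/-- For `N ≥ 2` a face contains an edge, and every edge is at least as long as a height. -/
lemma exists_diam_le_diam_face (hK : IsSimplex K) (hN : 2 ≤ N) {v : Eu N} (hv : v ∈ K) {d : ℝ}
    (hd : ∀ w ∈ K, d ≤ ‖heightVec K w‖) : d ≤ Metric.diam (cell (faceOpp K v)) := by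
  obtain ⟨a, ha, b, hb, hab⟩ := Finset.one_lt_card.1
    (show 1 < (faceOpp K v).card by rw [hK.card_faceOpp hv]; omega)
  have haK := faceOpp_subset K v ha
  have hbK := faceOpp_subset K v hb
  exact (hd b hbK).trans ((hK.heightVec_le_dist (by omega) hbK haK hab).trans
    (dist_le_diam_cell (subset_cell ha) (subset_cell hb)))

end IsSimplex

/-! ### The residual on smooth functions -/

namespace Triangulation

variable {Ω : Set (Eu N)} (𝒯 : Triangulation Ω)

/-- The sum of the squares of the `L²` norms of the derivative over the elements that meet `K`,
each counted as often as it shares a vertex with `K`. -/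
def starGradSq (ψ : Eu N → ℝ) (K : Finset (Eu N)) : ℝ := ∑ v ∈ K, ∑ L ∈ 𝒯.star v, gradSq ψ L

lemma starGradSq_nonneg (ψ : Eu N → ℝ) (K : Finset (Eu N)) : 0 ≤ 𝒯.starGradSq ψ K :=
  Finset.sum_nonneg fun _ _ => Finset.sum_nonneg fun _ _ => gradSq_nonneg _ _

/-- After exchanging the sums, an element `L` is counted once for each of its `N + 1` vertices and
each of the at most `M` elements at that vertex. -/
lemma sum_starGradSq_le {M : ℕ} (hM : ∀ z, (𝒯.star z).card ≤ M) (ψ : Eu N → ℝ) :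
    ∑ K ∈ 𝒯.elements, 𝒯.starGradSq ψ K ≤ ((N + 1) * M) * ∑ L ∈ 𝒯.elements, gradSq ψ L := by
  have h1 : ∀ K ∈ 𝒯.elements, 𝒯.starGradSq ψ K =
      ∑ L ∈ 𝒯.elements, ∑ v ∈ L, if v ∈ K then gradSq ψ L else 0 := by
    intro K hK
    rw [starGradSq, Finset.sum_comm' (t' := 𝒯.elements) (s' := fun L => K.filter (· ∈ L))]
    · refine Finset.sum_congr rfl fun L _ => ?_
      rw [← Finset.sum_filter]
      refine Finset.sum_congr ?_ fun _ _ => rfl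
      ext v
      simp [and_comm]
    · intro v L
      simp only [mem_star, Finset.mem_filter]
      tauto
  rw [Finset.sum_congr rfl h1, Finset.sum_comm, Finset.mul_sum]
  refine Finset.sum_le_sum fun L hL => ?_
  rw [Finset.sum_comm]
  have h2 : ∀ v ∈ L, ∑ K ∈ 𝒯.elements, (if v ∈ K then gradSq ψ L else 0) ≤ M * gradSq ψ L := by
    intro v _
    rw [← Finset.sum_filter, Finset.sum_const, nsmul_eq_mul]
    exact mul_le_mul_of_nonneg_right (by exact_mod_cast hM v) (gradSq_nonneg _ _)
  refine (Finset.sum_le_sum h2).trans_eq ?_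
  rw [Finset.sum_const, (𝒯.isSimplex hL).card, nsmul_eq_mul]
  push_cast
  ring

/-- `c z` is a good constant approximation of `ψ` near each vertex `z`. -/
def IsLocalApprox (C : ℝ) (ψ c : Eu N → ℝ) : Prop :=
  ∀ z, ∀ K ∈ 𝒯.star z, ∫ x in cell K, (ψ x - c z) ^ 2 ≤
    C * Metric.diam (cell K) ^ 2 * ∑ L ∈ 𝒯.star z, gradSq ψ L

lemma exists_isLocalApprox {C : ℝ} (hC : 0 ≤ C) {ψ : Eu N → ℝ} (hψ : ContDiff ℝ 1 ψ)
    (h : ∀ z, ∃ c, ∀ K ∈ 𝒯.star z, sqDev ψ c (cell K) ≤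
      ENNReal.ofReal (C * Metric.diam (cell K) ^ 2) * energy ψ (𝒯.patch z)) :
    ∃ c, 𝒯.IsLocalApprox C ψ c := by
  choose c hc using h
  refine ⟨c, fun z K hK => ?_⟩
  have h0 : 0 ≤ C * Metric.diam (cell K) ^ 2 := by positivity
  have h1 := (hc z K hK).trans (mul_le_mul_right (𝒯.energy_patch_le hψ z) _)
  rw [sqDev_cell hψ, ← ENNReal.ofReal_mul h0] at h1
  exact (ENNReal.ofReal_le_ofReal_iff
    (mul_nonneg h0 (Finset.sum_nonneg fun _ _ => gradSq_nonneg _ _))).1 h1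

variable {𝒯} {C κ : ℝ} {ψ c : Eu N → ℝ} {K : Finset (Eu N)}

lemma IsLocalApprox.integral_cell_le (hc : 𝒯.IsLocalApprox C ψ c) (hN : 1 ≤ N)
    (hψ : ContDiff ℝ 1 ψ) (hK : K ∈ 𝒯.elements) :
    ∫ x in cell K, (ψ x - 𝒯.interp c x) ^ 2 ≤
      C * Metric.diam (cell K) ^ 2 * 𝒯.starGradSq ψ K := by
  have sK := 𝒯.isSimplex hK
  have c0 := hψ.continuous
  have cI : ContinuousOn (𝒯.interp c) (cell K) :=
    (𝒯.interp_mem_feSpace hN le_rfl c).1.mono (𝒯.cell_subset_closure hK)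
  calc ∫ x in cell K, (ψ x - 𝒯.interp c x) ^ 2
      ≤ ∫ x in cell K, ∑ v ∈ K, (ψ x - c v) ^ 2 := by
        refine setIntegral_mono_on (IsSimplex.integrableOn_cell ((c0.continuousOn.sub cI).pow 2))
          (IsSimplex.integrableOn_cell (by fun_prop)) (measurableSet_cell K) fun x hx => ?_
        rw [𝒯.interp_apply hN c hK hx]
        exact sK.sq_sub_sum_bary_le hN hx _ _
    _ = ∑ v ∈ K, ∫ x in cell K, (ψ x - c v) ^ 2 :=
        integral_finsetSum _ fun v _ => IsSimplex.integrableOn_cell (by fun_prop)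
    _ ≤ _ := by
        rw [starGradSq, Finset.mul_sum]
        exact Finset.sum_le_sum fun v hv => hc v K (𝒯.mem_star.2 ⟨hK, hv⟩)

/-- The trace inequality gives `4 * C + 1`, since `N + 1 ≤ 4`. One `κ` comes from dividing by the
height, the other from replacing the diameter of `K` by that of the face; the `2` offsets the weight
`1 / 2` of the estimator. -/
lemma IsLocalApprox.integral_face_le (hc : 𝒯.IsLocalApprox C ψ c) (hN : 2 ≤ N) (hN3 : N ≤ 3)
    (hC : 0 ≤ C) (hκ : 0 < κ) (hreg : 𝒯.ShapeRegular κ)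
    (hψ : ContDiff ℝ 1 ψ) (hK : K ∈ 𝒯.elements) {v : Eu N} (hv : v ∈ K) :
    ∫ x in cell (faceOpp K v), (ψ x - 𝒯.interp c x) ^ 2 ∂μHE[N - 1] ≤
      1 / 2 * Metric.diam (cell (faceOpp K v)) * (2 * (4 * C + 1) / κ ^ 2 * 𝒯.starGradSq ψ K) := by
  have hN1 : 1 ≤ N := by omega
  have sK := 𝒯.isSimplex hK
  have c0 := hψ.continuous
  have cI : ContinuousOn (𝒯.interp c) (cell (faceOpp K v)) :=
    (𝒯.interp_mem_feSpace hN1 le_rfl c).1.mono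
      ((cell_mono (faceOpp_subset K v)).trans (𝒯.cell_subset_closure hK))
  set h := Metric.diam (cell K)
  set A := ∫ x in cell (faceOpp K v), (ψ x - 𝒯.interp c x) ^ 2 ∂μHE[N - 1] with hA
  have hA0 : 0 ≤ A := integral_nonneg fun x => sq_nonneg _
  have hpos : 0 < h := sK.diam_pos hN1
  have h1 : A ≤ ∑ w ∈ K, ∫ x in cell (faceOpp K v), (ψ x - c w) ^ 2 ∂μHE[N - 1] := by
    rw [← integral_finsetSum _ fun w _ => sK.integrableOn_face hN1 hv (by fun_prop)]
    refine setIntegral_mono_on (sK.integrableOn_face hN1 hv ((c0.continuousOn.sub cI).pow 2))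
      (sK.integrableOn_face hN1 hv (by fun_prop)) (measurableSet_cell _) fun x hx => ?_
    have hx' := cell_mono (faceOpp_subset K v) hx
    rw [𝒯.interp_apply hN1 c hK hx']
    exact sK.sq_sub_sum_bary_le hN1 hx' _ _
  have h2 : ‖heightVec K v‖ * A ≤ (4 * C + 1) * h ^ 2 * 𝒯.starGradSq ψ K := by
    refine (mul_le_mul_of_nonneg_left h1 (norm_nonneg _)).trans ?_
    rw [Finset.mul_sum, starGradSq, Finset.mul_sum]
    refine Finset.sum_le_sum fun w hw => ?_
    refine (sK.heightVec_mul_integral_face_le hN1 hv hψ (c w)).trans ?_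
    have hs := 𝒯.mem_star.2 ⟨hK, hw⟩
    have h3 := hc w K hs
    have h4 : gradSq ψ K ≤ ∑ L ∈ 𝒯.star w, gradSq ψ L :=
      Finset.single_le_sum (f := fun L => gradSq ψ L) (fun L _ => gradSq_nonneg ψ L) hs
    have h5 : (N : ℝ) + 1 ≤ 4 := by
      have : (N : ℝ) ≤ 3 := by exact_mod_cast hN3
      linarith
    have h6 : 0 ≤ ∫ x in cell K, (ψ x - c w) ^ 2 := integral_nonneg fun x => sq_nonneg _
    have h7 := mul_le_mul_of_nonneg_left h4 (sq_nonneg h)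
    have h8 := mul_le_mul_of_nonneg_right h5 h6
    change _ + h ^ 2 * _ ≤ _
    nlinarith
  have h3 : κ * h * A ≤ (4 * C + 1) * h ^ 2 * 𝒯.starGradSq ψ K :=
    (mul_le_mul_of_nonneg_right (hreg K hK v hv) hA0).trans h2
  have h4 : κ * h ≤ Metric.diam (cell (faceOpp K v)) :=
    sK.exists_diam_le_diam_face hN hv fun w hw => hreg K hK w hw
  have hG := 𝒯.starGradSq_nonneg ψ K
  have h5 : A ≤ (4 * C + 1) / κ * h * 𝒯.starGradSq ψ K := by
    rw [← mul_le_mul_iff_of_pos_left (mul_pos hκ hpos)]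
    refine h3.trans_eq ?_
    field_simp
  refine h5.trans ?_
  have h6 : (4 * C + 1) / κ * h * 𝒯.starGradSq ψ K =
      κ * h * ((4 * C + 1) / κ ^ 2 * 𝒯.starGradSq ψ K) := by field_simp
  rw [h6]
  refine (mul_le_mul_of_nonneg_right h4 (by positivity)).trans_eq ?_
  ring

end Triangulation

/-! ### Elementwise representation of the residual -/

namespace Triangulation

variable {Ω : Set (Eu N)} {𝒯 : Triangulation Ω} {m : ℕ} {w b f : Eu N → ℝ} {K : Finset (Eu N)}

lemma _root_.CahnHilliardFEM.integrableOn_cell_mul {g : Eu N → ℝ} (hf : ContinuousOn f (cell K))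
    (hg : ContinuousOn g (cell K)) : IntegrableOn (fun x => f x * g x) (cell K) :=
  IsSimplex.integrableOn_cell (hf.mul hg)

lemma continuousOn_laplacianWithin (hN : 1 ≤ N) (hw : w ∈ feSpace 𝒯 m) (hK : K ∈ 𝒯.elements) :
    ContinuousOn (InnerProductSpace.laplacianWithin w (cell K)) (cell K) := by
  obtain ⟨P, hP, hwP⟩ := exists_contDiff_eqOn hw hK
  have c2 : Continuous (fderiv ℝ (fderiv ℝ P)) :=
    (hP.fderiv_right (m := 1) (by norm_num)).continuous_fderiv (by norm_num)
  refine ContinuousOn.congr ?_ fun x hx => (𝒯.isSimplex hK).laplacianWithin_eq hN hP hwP hx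
  fun_prop

lemma continuousOn_normalDeriv (hN : 1 ≤ N) (hw : w ∈ feSpace 𝒯 m) (hK : K ∈ 𝒯.elements)
    (v : Eu N) : ContinuousOn (normalDeriv w K v) (cell K) := by
  obtain ⟨P, hP, hwP⟩ := exists_contDiff_eqOn hw hK
  have c1 : Continuous (fderiv ℝ P) := hP.continuous_fderiv (by norm_num)
  refine ContinuousOn.congr ?_ fun x hx =>
    (𝒯.isSimplex hK).normalDeriv_eq hN (hP.of_le (by norm_num)) hwP v hx
  fun_prop

/-- The contribution of an element `K` to the residual. -/
def elemForm (b w f : Eu N → ℝ) (K : Finset (Eu N)) : ℝ :=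
  (∫ x in cell K, (b x - InnerProductSpace.laplacianWithin w (cell K) x) * f x) +
    ∑ v ∈ K, ∫ x in cell (faceOpp K v), normalDeriv w K v x * f x ∂μHE[N - 1]

lemma elemForm_sub (hN : 1 ≤ N) (hw : w ∈ feSpace 𝒯 m) (hK : K ∈ 𝒯.elements)
    (hb : ContinuousOn b (cell K)) {g : Eu N → ℝ} (hf : ContinuousOn f (cell K))
    (hg : ContinuousOn g (cell K)) :
    elemForm b w (f - g) K = elemForm b w f K - elemForm b w g K := by
  have cR : ContinuousOn (fun x => b x - InnerProductSpace.laplacianWithin w (cell K) x)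
    (cell K) := hb.sub (continuousOn_laplacianWithin hN hw hK)
  have cn := continuousOn_normalDeriv hN hw hK
  have hs : ∀ v, cell (faceOpp K v) ⊆ cell K := fun v => cell_mono (faceOpp_subset K v)
  simp only [elemForm, Pi.sub_apply, mul_sub]
  rw [integral_sub (integrableOn_cell_mul cR hf) (integrableOn_cell_mul cR hg), add_sub_add_comm, ← Finset.sum_sub_distrib]
  congr 1
  refine Finset.sum_congr rfl fun v hv => ?_
  exact integral_sub
    ((𝒯.isSimplex hK).integrableOn_face hN hv (((cn v).mul hf).mono (hs v)))
    ((𝒯.isSimplex hK).integrableOn_face hN hv (((cn v).mul hg).mono (hs v)))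

lemma integral_add_integral_eq_elemForm (hN : 1 ≤ N) (hw : w ∈ feSpace 𝒯 m) (hK : K ∈ 𝒯.elements)
    (hb : ContinuousOn b (cell K)) {Z : Eu N → ℝ} (hZ : ContDiff ℝ 1 Z) (hf : EqOn f Z (cell K)) :
    (∫ x in cell K, b x * f x) + ∫ x in cell K, ⟪gradient w x, gradient f x⟫ =
      elemForm b w f K := by
  have sK := 𝒯.isSimplex hK
  obtain ⟨P, hP, hwP⟩ := exists_contDiff_eqOn hw hK
  have cf : ContinuousOn f (cell K) := hZ.continuous.continuousOn.congr hf
  have h1 : ∫ x in cell K, ⟪gradient w x, gradient f x⟫ =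
      ∫ x in cell K, ⟪gradient P x, gradient Z x⟫ := by
    refine integral_congr_ae ?_
    filter_upwards [sK.gradient_ae_eq hwP, sK.gradient_ae_eq hf] with x h1 h2
    rw [h1, h2]
  rw [h1, sK.integral_inner_gradient hN hP hZ, elemForm, ← add_assoc]
  congr 1
  · simp only [sub_mul]
    rw [integral_sub (integrableOn_cell_mul hb cf)
      (integrableOn_cell_mul (continuousOn_laplacianWithin hN hw hK) cf),
      sub_eq_add_neg]
    congr 2
    refine setIntegral_congr_fun (measurableSet_cell K) fun x hx => ?_
    simp only [hf hx, sK.laplacianWithin_eq hN hP hwP hx]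
  · refine Finset.sum_congr rfl fun v hv => ?_
    refine setIntegral_congr_fun (measurableSet_cell _) fun x hx => ?_
    have hx' := cell_mono (faceOpp_subset K v) hx
    simp only [hf hx', sK.normalDeriv_eq hN (hP.of_le (by norm_num)) hwP v hx']

lemma integral_add_integral_eq_sum_elemForm (hconv : Convex ℝ Ω) (hN : 1 ≤ N)
    (hw : w ∈ feSpace 𝒯 m) (hb : ∀ K ∈ 𝒯.elements, ContinuousOn b (cell K))
    (hf : ∀ K ∈ 𝒯.elements, ∃ Z : Eu N → ℝ, ContDiff ℝ 1 Z ∧ EqOn f Z (cell K)) :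
    (∫ x in Ω, b x * f x) + ∫ x in Ω, ⟪gradient w x, gradient f x⟫ =
      ∑ K ∈ 𝒯.elements, elemForm b w f K := by
  rw [𝒯.integral_eq_sum hconv, 𝒯.integral_eq_sum hconv, ← Finset.sum_add_distrib]
  · refine Finset.sum_congr rfl fun K hK => ?_
    obtain ⟨Z, hZ, hfZ⟩ := hf K hK
    exact integral_add_integral_eq_elemForm hN hw hK (hb K hK) hZ hfZ
  · intro K hK
    obtain ⟨Z, hZ, hfZ⟩ := hf K hK
    obtain ⟨P, hP, hwP⟩ := exists_contDiff_eqOn hw hK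
    have c1 := continuous_gradient (hP.of_le (show (1 : WithTop ℕ∞) ≤ 2 by norm_num))
    have c2 := continuous_gradient hZ
    have : IntegrableOn (fun x => ⟪gradient P x, gradient Z x⟫) (cell K) :=
      IsSimplex.integrableOn_cell (c1.inner c2).continuousOn
    refine this.congr ?_
    filter_upwards [(𝒯.isSimplex hK).gradient_ae_eq hwP, (𝒯.isSimplex hK).gradient_ae_eq hfZ]
      with x h1 h2
    rw [h1, h2]
  · intro K hK
    obtain ⟨Z, hZ, hfZ⟩ := hf K hK
    exact IsSimplex.integrableOn_cell ((hb K hK).mul (hZ.continuous.continuousOn.congr hfZ))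

open Classical in
/-- The sum of the face terms is controlled by the jumps. -/
lemma abs_sum_face_le (hN : 1 ≤ N) (hw : w ∈ feSpace 𝒯 m)
    (hf : ∀ K ∈ 𝒯.elements, ContinuousOn f (cell K)) :
    |∑ K ∈ 𝒯.elements, ∑ v ∈ K, ∫ x in cell (faceOpp K v), normalDeriv w K v x * f x ∂μHE[N - 1]| ≤
      ∑ K ∈ 𝒯.elements, ∑ v ∈ K, faceNorm (faceOpp K v) (jump 𝒯 w (faceOpp K v)) *
        faceNorm (faceOpp K v) f := by
  let S : Finset ((_ : Finset (Eu N)) × Eu N) := 𝒯.elements.sigma fun K => K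
  let τ : (_ : Finset (Eu N)) × Eu N → Finset (Eu N) := fun p => faceOpp p.1 p.2
  have hS : ∀ p ∈ S, p.1 ∈ 𝒯.elements ∧ p.2 ∈ p.1 := fun p hp => Finset.mem_sigma.1 hp
  have hsub : ∀ p, cell (τ p) ⊆ cell p.1 := fun p => cell_mono (faceOpp_subset _ _)
  have cn : ∀ p ∈ S, ∀ q, τ p = τ q → ContinuousOn (normalDeriv w p.1 p.2) (cell (τ q)) :=
    fun p hp q e => e ▸ (continuousOn_normalDeriv hN hw (hS p hp).1 p.2).mono (hsub p)
  rw [Finset.sum_sigma' 𝒯.elements (fun K => K) fun K v =>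
      ∫ x in cell (faceOpp K v), normalDeriv w K v x * f x ∂μHE[N - 1],
    Finset.sum_sigma' 𝒯.elements (fun K => K) fun K v =>
      faceNorm (faceOpp K v) (jump 𝒯 w (faceOpp K v)) * faceNorm (faceOpp K v) f]
  change |∑ p ∈ S, ∫ x in cell (τ p), normalDeriv w p.1 p.2 x * f x ∂μHE[N - 1]| ≤
    ∑ p ∈ S, faceNorm (τ p) (jump 𝒯 w (τ p)) * faceNorm (τ p) f
  -- Group the pairs of an element and a vertex by the face that they determine.
  rw [← Finset.sum_fiberwise_of_maps_to (t := S.image τ)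
      (fun p hp => Finset.mem_image_of_mem τ hp),
    ← Finset.sum_fiberwise_of_maps_to (s := S) (t := S.image τ) (g := τ)
      (fun p hp => Finset.mem_image_of_mem τ hp)
      fun p => faceNorm (τ p) (jump 𝒯 w (τ p)) * faceNorm (τ p) f]
  refine (Finset.abs_sum_le_sum_abs _ _).trans (Finset.sum_le_sum fun σ hσ => ?_)
  obtain ⟨q, hq, rfl⟩ := Finset.mem_image.1 hσ
  have hint : ∀ g : Eu N → ℝ, ContinuousOn g (cell (τ q)) →
      IntegrableOn g (cell (τ q)) μHE[N - 1] := fun g hg =>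
    (𝒯.isSimplex (hS q hq).1).integrableOn_face hN (hS q hq).2 hg
  have cf : ContinuousOn f (cell (τ q)) := (hf _ (hS q hq).1).mono (hsub q)
  have hJ : ∀ x, jump 𝒯 w (τ q) x = (if cell (τ q) ⊆ frontier Ω then 2 else 1) *
      ∑ p ∈ S with τ p = τ q, normalDeriv w p.1 p.2 x := by
    intro x
    rw [jump]
    congr 1
    simp only [Finset.sum_filter]
    exact Finset.sum_sigma' 𝒯.elements (fun K => K) fun K v =>
      if faceOpp K v = τ q then normalDeriv w K v x else 0
  have cs : ContinuousOn (fun x => ∑ p ∈ S with τ p = τ q, normalDeriv w p.1 p.2 x)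
      (cell (τ q)) := continuousOn_finsetSum _ fun p hp =>
    cn p (Finset.mem_filter.1 hp).1 q (Finset.mem_filter.1 hp).2
  have cJ : ContinuousOn (jump 𝒯 w (τ q)) (cell (τ q)) :=
    (continuousOn_const.mul cs).congr fun x _ => hJ x
  -- The sum of the normal derivatives is the jump divided by `1` or `2`, and the division only
  -- helps. The number of elements at a face plays no role.
  have h1 : ∑ p ∈ S with τ p = τ q, ∫ x in cell (τ p), normalDeriv w p.1 p.2 x * f x ∂μHE[N - 1] =
      (if cell (τ q) ⊆ frontier Ω then 2 else 1)⁻¹ *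
        ∫ x in cell (τ q), jump 𝒯 w (τ q) x * f x ∂μHE[N - 1] := by
    simp only [hJ, mul_assoc]
    rw [integral_const_mul, inv_mul_cancel_left₀ (by split_ifs <;> norm_num)]
    simp only [Finset.sum_mul]
    have hi : ∀ p ∈ S.filter fun p => τ p = τ q, IntegrableOn
        (fun x => normalDeriv w p.1 p.2 x * f x) (cell (τ q)) μHE[N - 1] := fun p hp =>
      hint _ ((cn p (Finset.mem_filter.1 hp).1 q (Finset.mem_filter.1 hp).2).mul cf)
    rw [integral_finsetSum _ hi]
    exact Finset.sum_congr rfl fun p hp => by rw [(Finset.mem_filter.1 hp).2]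
  have h2 := abs_integral_mul_le (hint _ (cJ.pow 2)) (hint _ (cf.pow 2)) (hint _ (cJ.mul cf))
  have h3 : |(if cell (τ q) ⊆ frontier Ω then (2 : ℝ) else 1)⁻¹| ≤ 1 := by
    split_ifs <;> norm_num
  rw [h1, abs_mul]
  refine (mul_le_of_le_one_left (abs_nonneg _) h3).trans (h2.trans ?_)
  -- On the right a face is counted once for each element that has it; one occurrence suffices.
  exact Finset.single_le_sum
    (f := fun p => faceNorm (τ p) (jump 𝒯 w (τ p)) * faceNorm (τ p) f)
    (fun p _ => mul_nonneg (Real.sqrt_nonneg _) (Real.sqrt_nonneg _))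
    (Finset.mem_filter.2 ⟨hq, rfl⟩)

end Triangulation

namespace Triangulation

variable {Ω : Set (Eu N)} {𝒯 : Triangulation Ω} {m : ℕ} {w b ψ c : Eu N → ℝ} {C κ : ℝ}

/-- The residual estimate for a continuously differentiable test function. -/
lemma sq_residual_le_of_contDiff (hconv : Convex ℝ Ω) (hN : 2 ≤ N) (hN3 : N ≤ 3) (hm : 1 ≤ m)
    (hC : 0 ≤ C) (hκ : 0 < κ) (hκ1 : κ ≤ 1) (hreg : 𝒯.ShapeRegular κ) {M : ℕ}
    (hM : ∀ z, (𝒯.star z).card ≤ M) (hw : w ∈ feSpace 𝒯 m)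
    (hb : ∀ K ∈ 𝒯.elements, ContinuousOn b (cell K))
    (hG : ∀ χ ∈ feSpace 𝒯 m,
      (∫ x in Ω, b x * χ x) + ∫ x in Ω, ⟪gradient w x, gradient χ x⟫ = 0)
    (hψ : ContDiff ℝ 1 ψ) (hc : 𝒯.IsLocalApprox C ψ c) :
    ((∫ x in Ω, b x * ψ x) + ∫ x in Ω, ⟪gradient w x, gradient ψ x⟫) ^ 2 ≤
      (2 * (4 * C + 1) / κ ^ 2 * (4 * M) * ∑ K ∈ 𝒯.elements, estimator 𝒯
        (fun x => b x - InnerProductSpace.laplacianWithin w (cell K) x) w K ^ 2) *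
        ∫ x in Ω, ‖gradient ψ x‖ ^ 2 := by
  have hN1 : 1 ≤ N := by omega
  -- The constant of the face bound; as `κ ≤ 1`, it also dominates the constant `C` of the element
  -- bound.
  set D := 2 * (4 * C + 1) / κ ^ 2 with hD
  have hD0 : 0 ≤ D := by positivity
  have hCD : C ≤ D := by
    rw [hD, le_div_iff₀ (by positivity)]
    nlinarith [mul_le_mul_of_nonneg_left (pow_le_one₀ hκ.le hκ1 (n := 2)) hC]
  let I := 𝒯.interp c
  have hI : I ∈ feSpace 𝒯 m := 𝒯.interp_mem_feSpace hN1 hm c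
  set R : Finset (Eu N) → Eu N → ℝ :=
    fun K x => b x - InnerProductSpace.laplacianWithin w (cell K) x with hR
  set est : Finset (Eu N) → ℝ := fun K => estimator 𝒯 (R K) w K with hest
  have cψ : ∀ K, ContinuousOn ψ (cell K) := fun K => hψ.continuous.continuousOn
  have cI : ∀ K ∈ 𝒯.elements, ContinuousOn I (cell K) := fun K hK =>
    hI.1.mono (𝒯.cell_subset_closure hK)
  have h1 := integral_add_integral_eq_sum_elemForm (f := ψ) hconv hN1 hw hb
    fun K _ => ⟨ψ, hψ, fun _ _ => rfl⟩
  have h2 := integral_add_integral_eq_sum_elemForm (f := I) hconv hN1 hw hb fun K hK => by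
    obtain ⟨P, hP, h⟩ := exists_contDiff_eqOn hI hK
    exact ⟨P, hP.of_le (by norm_num), h⟩
  rw [hG I hI] at h2
  -- Galerkin orthogonality: the residual of the quasi-interpolant is zero.
  have h3 : ∑ K ∈ 𝒯.elements, elemForm b w ψ K = ∑ K ∈ 𝒯.elements, elemForm b w (ψ - I) K := by
    rw [← sub_zero (∑ K ∈ 𝒯.elements, elemForm b w ψ K), h2, ← Finset.sum_sub_distrib]
    exact Finset.sum_congr rfl fun K hK =>
      (elemForm_sub hN1 hw hK (hb K hK) (cψ K) (cI K hK)).symm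
  have h4 : |∑ K ∈ 𝒯.elements, elemForm b w (ψ - I) K| ≤
      ∑ K ∈ 𝒯.elements, √(D * 𝒯.starGradSq ψ K) * est K := by
    simp only [elemForm]
    rw [Finset.sum_add_distrib]
    refine (abs_add_le _ _).trans ((add_le_add (Finset.abs_sum_le_sum_abs _ _)
      (abs_sum_face_le hN1 hw fun K hK => (cψ K).sub (cI K hK))).trans ?_)
    rw [← Finset.sum_add_distrib]
    refine Finset.sum_le_sum fun K hK => ?_
    have hG0 := 𝒯.starGradSq_nonneg ψ K
    have cR : ContinuousOn (R K) (cell K) :=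
      (hb K hK).sub (continuousOn_laplacianWithin hN1 hw hK)
    have cz : ContinuousOn (ψ - I) (cell K) := (cψ K).sub (cI K hK)
    rw [hest]
    simp only [estimator]
    rw [mul_add, Finset.mul_sum]
    refine add_le_add ?_ (Finset.sum_le_sum fun v hv => ?_)
    · refine (abs_integral_mul_le (IsSimplex.integrableOn_cell (cR.pow 2))
        (IsSimplex.integrableOn_cell (cz.pow 2)) (integrableOn_cell_mul cR cz)).trans ?_
      have h5 : √(∫ x in cell K, (ψ - I) x ^ 2) ≤
          √(D * 𝒯.starGradSq ψ K) * Metric.diam (cell K) := by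
        rw [← Real.sqrt_sq (Metric.diam_nonneg (s := cell K)), ← Real.sqrt_mul (by positivity)]
        refine Real.sqrt_le_sqrt ((hc.integral_cell_le hN1 hψ hK).trans ?_)
        rw [mul_right_comm]
        gcongr
      calc _ ≤ √(∫ x in cell K, R K x ^ 2) * (√(D * 𝒯.starGradSq ψ K) * Metric.diam (cell K)) := by
            gcongr
        _ = _ := by rw [elemNorm]; ring
    · have h5 : faceNorm (faceOpp K v) (ψ - I) ≤
          √(1 / 2 * Metric.diam (cell (faceOpp K v))) * √(D * 𝒯.starGradSq ψ K) := by
        rw [← Real.sqrt_mul (mul_nonneg (by norm_num) Metric.diam_nonneg)]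
        exact Real.sqrt_le_sqrt (hc.integral_face_le hN hN3 hC hκ hreg hψ hK hv)
      rw [Real.sqrt_mul (mul_nonneg (by norm_num) Metric.diam_nonneg),
        Real.sqrt_sq (show 0 ≤ faceNorm (faceOpp K v) (jump 𝒯 w (faceOpp K v)) from
          Real.sqrt_nonneg _)]
      calc _ ≤ faceNorm (faceOpp K v) (jump 𝒯 w (faceOpp K v)) *
            (√(1 / 2 * Metric.diam (cell (faceOpp K v))) * √(D * 𝒯.starGradSq ψ K)) :=
            mul_le_mul_of_nonneg_left h5 (Real.sqrt_nonneg _)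
        _ = _ := by ring
  have h5 : ∑ L ∈ 𝒯.elements, gradSq ψ L = ∫ x in Ω, ‖gradient ψ x‖ ^ 2 := by
    simp only [norm_gradient]
    have : Continuous (fderiv ℝ ψ) := hψ.continuous_fderiv (by norm_num)
    rw [𝒯.integral_eq_sum hconv fun K _ => IsSimplex.integrableOn_cell (by fun_prop)]
    rfl
  have hN4 : (N : ℝ) + 1 ≤ 4 := by
    have : (N : ℝ) ≤ 3 := by exact_mod_cast hN3
    linarith
  have hS0 : 0 ≤ ∑ L ∈ 𝒯.elements, gradSq ψ L := Finset.sum_nonneg fun _ _ => gradSq_nonneg _ _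
  rw [h1, h3, ← h5]
  calc (∑ K ∈ 𝒯.elements, elemForm b w (ψ - I) K) ^ 2
      ≤ (∑ K ∈ 𝒯.elements, √(D * 𝒯.starGradSq ψ K) * est K) ^ 2 :=
        sq_le_sq' (abs_le.1 h4).1 (abs_le.1 h4).2
    _ ≤ (∑ K ∈ 𝒯.elements, √(D * 𝒯.starGradSq ψ K) ^ 2) * ∑ K ∈ 𝒯.elements, est K ^ 2 :=
        Finset.sum_mul_sq_le_sq_mul_sq _ _ _
    _ = (D * ∑ K ∈ 𝒯.elements, 𝒯.starGradSq ψ K) * ∑ K ∈ 𝒯.elements, est K ^ 2 := by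
        congr 1
        rw [Finset.mul_sum]
        exact Finset.sum_congr rfl fun K _ =>
          Real.sq_sqrt (mul_nonneg hD0 (𝒯.starGradSq_nonneg ψ K))
    _ ≤ (D * (4 * M * ∑ L ∈ 𝒯.elements, gradSq ψ L)) * ∑ K ∈ 𝒯.elements, est K ^ 2 := by
        have := 𝒯.sum_starGradSq_le hM ψ
        gcongr
        refine this.trans ?_
        gcongr
    _ = _ := by ring

end Triangulation

/-! ### Passage to `H¹` -/

section Limits

open Filter Topology

variable {α E : Type*} [MeasurableSpace α] {μ : Measure α} [NormedAddCommGroup E]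
  [InnerProductSpace ℝ E]

lemma tendsto_integral_inner {F G : ℕ → α → E} {f g : α → E} (hF : ∀ k, MemLp (F k) 2 μ)
    (hG : ∀ k, MemLp (G k) 2 μ) (hf : MemLp f 2 μ) (hg : MemLp g 2 μ)
    (hFf : Tendsto (fun k => eLpNorm (F k - f) 2 μ) atTop (𝓝 0))
    (hGg : Tendsto (fun k => eLpNorm (G k - g) 2 μ) atTop (𝓝 0)) :
    Tendsto (fun k => ∫ x, ⟪F k x, G k x⟫ ∂μ) atTop (𝓝 (∫ x, ⟪f x, g x⟫ ∂μ)) := by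
  have h1 := (Lp.tendsto_Lp_iff_tendsto_eLpNorm'' F hF f hf).2 hFf
  have h2 := (Lp.tendsto_Lp_iff_tendsto_eLpNorm'' G hG g hg).2 hGg
  have key : ∀ {a b : α → E} (ha : MemLp a 2 μ) (hb : MemLp b 2 μ),
      ⟪ha.toLp a, hb.toLp b⟫ = ∫ x, ⟪a x, b x⟫ ∂μ := by
    intro a b ha hb
    rw [L2.inner_def]
    refine integral_congr_ae ?_
    filter_upwards [ha.coeFn_toLp, hb.coeFn_toLp] with x h1 h2
    rw [h1, h2]
  simpa only [key] using h1.inner (𝕜 := ℝ) h2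

end Limits

lemma memLp_cell {E : Type*} [NormedAddCommGroup E] {K : Finset (Eu N)} {f : Eu N → E}
    (hf : ContinuousOn f (cell K)) : MemLp f 2 (volume.restrict (cell K)) := by
  rw [memLp_two_iff_integrable_sq_norm
    (hf.aestronglyMeasurable_of_isCompact (isCompact_cell K) (measurableSet_cell K))]
  exact (hf.norm.pow 2).integrableOn_compact (isCompact_cell K)

namespace Triangulation

variable {Ω : Set (Eu N)} {𝒯 : Triangulation Ω} {m : ℕ} {w b : Eu N → ℝ}

/-- Finite element functions and their gradients are controlled only element by element; finitely
many elements make up `Ω` up to a null set. -/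
lemma memLp_of_forall_cell {E : Type*} [NormedAddCommGroup E] (hconv : Convex ℝ Ω) {f : Eu N → E}
    (hf : ∀ K ∈ 𝒯.elements, MemLp f 2 (volume.restrict (cell K))) :
    MemLp f 2 (volume.restrict Ω) := by
  rw [𝒯.restrict_eq_sum hconv]
  have h1 : AEStronglyMeasurable f (∑ K ∈ 𝒯.elements, volume.restrict (cell K)) := by
    refine Finset.sum_induction _ (fun μ => AEStronglyMeasurable f μ)
      (fun μ ν hμ hν => hμ.add_measure hν) (aestronglyMeasurable_zero_measure _)
      fun K hK => (hf K hK).1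
  rw [memLp_two_iff_integrable_sq_norm h1, integrable_finsetSum_measure]
  exact fun K hK => (memLp_two_iff_integrable_sq_norm (hf K hK).1).1 (hf K hK)

lemma memLp_gradient (hconv : Convex ℝ Ω) (hw : w ∈ feSpace 𝒯 m) :
    MemLp (gradient w) 2 (volume.restrict Ω) := by
  refine memLp_of_forall_cell (𝒯 := 𝒯) hconv fun K hK => ?_
  obtain ⟨P, hP, hwP⟩ := exists_contDiff_eqOn hw hK
  refine (memLp_congr_ae ((𝒯.isSimplex hK).gradient_ae_eq hwP)).2 (memLp_cell ?_)
  exact (continuous_gradient (hP.of_le (by norm_num))).continuousOn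

open Filter Topology in
/-- A bound for the residual that holds on smooth functions holds on `H¹(Ω)`. -/
lemma sq_residual_le_of_isH1 (hΩ : IsOpen Ω) (hbd : Bornology.IsBounded Ω) (hconv : Convex ℝ Ω)
    (hw : w ∈ feSpace 𝒯 m) (hb : ∀ K ∈ 𝒯.elements, ContinuousOn b (cell K)) {B : ℝ}
    (hB : ∀ ψ : Eu N → ℝ, ContDiff ℝ 1 ψ →
      ((∫ x in Ω, b x * ψ x) + ∫ x in Ω, ⟪gradient w x, gradient ψ x⟫) ^ 2 ≤
        B * ∫ x in Ω, ‖gradient ψ x‖ ^ 2)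
    {ψ : Eu N → ℝ} {g : Eu N → Eu N} (h : IsH1 Ω ψ g) :
    ((∫ x in Ω, b x * ψ x) + ∫ x in Ω, ⟪gradient w x, g x⟫) ^ 2 ≤ B * ∫ x in Ω, ‖g x‖ ^ 2 := by
  rcases Ω.eq_empty_or_nonempty with rfl | hne
  · simp
  obtain ⟨Ψ, hΨ, h0, h1⟩ := exists_contDiff_approx hΩ hbd hconv hne h
  have mb : MemLp b 2 (volume.restrict Ω) :=
    memLp_of_forall_cell hconv fun K hK => memLp_cell (hb K hK)
  have mw := memLp_gradient hconv hw
  have mΨ : ∀ k, MemLp (Ψ k) 2 (volume.restrict Ω) := fun k =>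
    memLp_of_forall_cell (𝒯 := 𝒯) hconv fun K _ => memLp_cell (hΨ k).continuous.continuousOn
  have mg : ∀ k, MemLp (gradient (Ψ k)) 2 (volume.restrict Ω) := fun k =>
    memLp_of_forall_cell (𝒯 := 𝒯) hconv fun K _ => memLp_cell (continuous_gradient (hΨ k)).continuousOn
  have hconst : ∀ {E : Type} [NormedAddCommGroup E] (f : Eu N → E),
      Tendsto (fun _ : ℕ => eLpNorm (f - f) 2 (volume.restrict Ω)) atTop (𝓝 0) := by
    intro E _ f
    simp
  have t1 := tendsto_integral_inner mΨ (fun _ => mb) h.memLp mb h0 (hconst b)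
  have t2 := tendsto_integral_inner (fun _ => mw) mg mw h.memLp_grad (hconst _) h1
  have t3 := tendsto_integral_inner mg mg h.memLp_grad h.memLp_grad h1 h1
  simp only [real_inner_self_eq_norm_sq] at t3
  have hin : ∀ s t : ℝ, ⟪s, t⟫ = t * s := fun s t => by simp
  simp only [hin] at t1
  exact le_of_tendsto_of_tendsto' ((t1.add t2).pow 2) (t3.const_mul B) fun k => hB _ (hΨ k)

end Triangulation

/-- When `‖g‖` vanishes in `L²` the hypothesis forces `r ψ g = 0`, so the quotient is `0 / 0 = 0`
and the supremum stays finite. -/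
lemma dualNorm_sq_le {Ω : Set (Eu N)} {r : (Eu N → ℝ) → (Eu N → Eu N) → ℝ} {B : ℝ} (hB : 0 ≤ B)
    (h : ∀ ψ g, IsH1 Ω ψ g → r ψ g ^ 2 ≤ B * ∫ x in Ω, ‖g x‖ ^ 2) :
    dualNorm Ω r ^ 2 ≤ ENNReal.ofReal B := by
  have h1 : dualNorm Ω r ≤ ENNReal.ofReal √B := by
    refine iSup_le fun ψ => iSup_le fun g => iSup_le fun hψ => ENNReal.div_le_of_le_mul ?_
    rw [← ENNReal.ofReal_mul (Real.sqrt_nonneg _), ← Real.sqrt_mul hB]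
    exact ENNReal.ofReal_le_ofReal (Real.le_sqrt_of_sq_le (h ψ g hψ))
  refine (pow_le_pow_left' h1 2).trans_eq ?_
  rw [← ENNReal.ofReal_pow (Real.sqrt_nonneg _), Real.sq_sqrt hB]

/-! ### The residuals of the mixed method -/

section MixedMethod

variable {Ω : Set (Eu N)} {𝒯 : Triangulation Ω} {m : ℕ}

lemma feSpace_continuousOn_cell {w : Eu N → ℝ} (hw : w ∈ feSpace 𝒯 m) {K : Finset (Eu N)}
    (hK : K ∈ 𝒯.elements) : ContinuousOn w (cell K) :=
  hw.1.mono (𝒯.cell_subset_closure hK)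

lemma feSpace_memLp (hconv : Convex ℝ Ω) {w : Eu N → ℝ} (hw : w ∈ feSpace 𝒯 m) :
    MemLp w 2 (volume.restrict Ω) :=
  Triangulation.memLp_of_forall_cell hconv fun _ hK => memLp_cell (feSpace_continuousOn_cell hw hK)

/-- Brings the second residual to the common form with `b = ε⁻² f(u) - ε⁻¹ φ`. Square integrability
is needed to split the integral. -/
lemma residual₂_eq {ε : ℝ} (hε : ε ≠ 0) {f : ℝ → ℝ} {u φ χ : Eu N → ℝ} (g : Eu N → Eu N)
    (hf : MemLp (fun x => f (u x)) 2 (volume.restrict Ω)) (hφ : MemLp φ 2 (volume.restrict Ω))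
    (hχ : MemLp χ 2 (volume.restrict Ω)) :
    residual₂ Ω ε f u φ χ g = (∫ x in Ω, ((ε ^ 2)⁻¹ * f (u x) - ε⁻¹ * φ x) * χ x) +
      ∫ x in Ω, ⟪gradient u x, g x⟫ := by
  have h1 : Integrable (fun x => f (u x) * χ x) (volume.restrict Ω) := hf.integrable_mul hχ
  have h2 : Integrable (fun x => φ x * χ x) (volume.restrict Ω) := hφ.integrable_mul hχ
  simp only [sub_mul, mul_assoc]
  rw [integral_sub (h1.const_mul _) (h2.const_mul _), integral_const_mul, integral_const_mul,
    residual₂]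
  field_simp
  ring

/-- The residual estimate with the constant of the local approximation property. -/
lemma dualNorm_sq_le_of_galerkin (hΩ : IsOpen Ω) (hbd : Bornology.IsBounded Ω)
    (hconv : Convex ℝ Ω) (hN : 2 ≤ N) (hN3 : N ≤ 3) (hm : 1 ≤ m) {C κ : ℝ} (hC : 0 ≤ C)
    (hκ : 0 < κ) (hκ1 : κ ≤ 1) (hreg : 𝒯.ShapeRegular κ) {M : ℕ}
    (hM : ∀ z, (𝒯.star z).card ≤ M)
    (happrox : ∀ ψ : Eu N → ℝ, ContDiff ℝ 1 ψ → ∃ c, 𝒯.IsLocalApprox C ψ c)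
    {w b : Eu N → ℝ} (hw : w ∈ feSpace 𝒯 m) (hb : ∀ K ∈ 𝒯.elements, ContinuousOn b (cell K))
    {r : (Eu N → ℝ) → (Eu N → Eu N) → ℝ}
    (hr : ∀ ψ g, MemLp ψ 2 (volume.restrict Ω) →
      r ψ g = (∫ x in Ω, b x * ψ x) + ∫ x in Ω, ⟪gradient w x, g x⟫)
    (hG : ∀ χ ∈ feSpace 𝒯 m, r χ (gradient χ) = 0) :
    dualNorm Ω r ^ 2 ≤ ENNReal.ofReal (2 * (4 * C + 1) / κ ^ 2 * (4 * M) *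
      ∑ K ∈ 𝒯.elements, estimator 𝒯
        (fun x => b x - InnerProductSpace.laplacianWithin w (cell K) x) w K ^ 2) := by
  refine dualNorm_sq_le (mul_nonneg (by positivity) (Finset.sum_nonneg fun _ _ => sq_nonneg _))
    fun ψ g hψ => ?_
  rw [hr ψ g hψ.memLp]
  refine Triangulation.sq_residual_le_of_isH1 hΩ hbd hconv hw hb (fun χ hχ => ?_) hψ
  obtain ⟨c, hc⟩ := happrox χ hχ
  refine Triangulation.sq_residual_le_of_contDiff hconv hN hN3 hm hC hκ hκ1 hreg hM hw hb
    (fun χ hχ => ?_) hχ hc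
  rw [← hr χ _ (feSpace_memLp hconv hχ)]
  exact hG χ hχ

end MixedMethod

end CahnHilliardFEM

end

/-! ### The bounds for both residuals with one constant -/

theorem mainTheorem10 (θ₀ : ℝ) (hθ₀ : 0 < θ₀) :
    ∃ C : ℝ, 0 < C ∧
      ∀ (N : ℕ) (_ : N = 2 ∨ N = 3)
        (Ω : Set (CahnHilliardFEM.Eu N)) (_ : IsOpen Ω) (_ : Bornology.IsBounded Ω)
        (_ : Convex ℝ Ω)
        (𝒯 : CahnHilliardFEM.Triangulation Ω) (_ : ∀ α ∈ 𝒯.angles, θ₀ ≤ α)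
        (m : ℕ) (_ : 1 ≤ m) (ε : ℝ) (_ : 0 < ε)
        (F : ℝ → ℝ) (_ : CahnHilliardFEM.IsDoubleWell F)
        (T : ℝ) (u φ : ℝ → CahnHilliardFEM.Eu N → ℝ)
        (_ : CahnHilliardFEM.IsMixedSolution 𝒯 m ε (deriv F) T u φ)
        (t : ℝ) (_ : t ∈ Set.Ioc 0 T),
        (CahnHilliardFEM.dualNorm Ω
            (CahnHilliardFEM.residual₁ Ω (CahnHilliardFEM.timeDeriv T u t) (φ t)) ^ 2 ≤
          ENNReal.ofReal (C * ∑ K ∈ 𝒯.elements,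
            CahnHilliardFEM.η₁ 𝒯 (CahnHilliardFEM.timeDeriv T u t) (φ t) K ^ 2)) ∧
        (CahnHilliardFEM.dualNorm Ω
            (CahnHilliardFEM.residual₂ Ω ε (deriv F) (u t) (φ t)) ^ 2 ≤
          ENNReal.ofReal (C * ∑ K ∈ 𝒯.elements,
            CahnHilliardFEM.η₂ 𝒯 ε (deriv F) (u t) (φ t) K ^ 2)) := by
  obtain ⟨κ, hκ, hκ1, hreg⟩ := CahnHilliardFEM.exists_shapeRegular hθ₀
  obtain ⟨M, C, hC, hMC⟩ := CahnHilliardFEM.exists_patch_constants hκ hκ1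
  -- `M + 1` in place of `M` makes the constant visibly positive.
  refine ⟨2 * (4 * C + 1) / κ ^ 2 * (4 * (M + 1 : ℕ)), by positivity, ?_⟩
  intro N hN Ω hΩ hbd hconv 𝒯 hang m hm ε hε F hF T u φ hsol t ht
  have hN2 : 2 ≤ N := by omega
  have hN3 : N ≤ 3 := by omega
  have hr := hreg N hN Ω 𝒯 hang
  have hM : ∀ z, (𝒯.star z).card ≤ M + 1 := fun z =>
    (hMC N hN Ω hΩ hconv 𝒯 hr z).1.trans (Nat.le_succ M)
  have happrox : ∀ ψ : CahnHilliardFEM.Eu N → ℝ, ContDiff ℝ 1 ψ → ∃ c, 𝒯.IsLocalApprox C ψ c :=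
    fun ψ hψ => 𝒯.exists_isLocalApprox hC.le hψ fun z => (hMC N hN Ω hΩ hconv 𝒯 hr z).2 ψ hψ
  have htI : t ∈ Icc 0 T := ⟨ht.1.le, ht.2⟩
  have hu := hsol.mem_u t htI
  have hφ := hsol.mem_φ t htI
  constructor
  · refine CahnHilliardFEM.dualNorm_sq_le_of_galerkin (m := m) hΩ hbd hconv hN2 hN3 hm hC.le hκ
      hκ1 hr hM happrox hφ (fun K hK => ?_) (fun ψ g _ => rfl) fun χ hχ => hsol.eq₁ t ht χ hχ
    obtain ⟨p, -, hp⟩ := CahnHilliardFEM.timeDeriv_eqOn hsol.mem_u ht (hsol.differentiable t ht) hK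
    exact (CahnHilliardFEM.contDiff_eval p (n := 0)).continuous.continuousOn.congr hp
  · have cf : Continuous (deriv F) := hF.smooth.continuous_deriv (by simp)
    have cfu : ∀ K ∈ 𝒯.elements,
        ContinuousOn (fun x => deriv F (u t x)) (CahnHilliardFEM.cell K) := fun K hK =>
      cf.comp_continuousOn (CahnHilliardFEM.feSpace_continuousOn_cell hu hK)
    -- The element residual is rearranged as `b - Δu`, the shape that the common estimate expects.
    have hres : ∀ K, CahnHilliardFEM.elemRes₂ ε (deriv F) (u t) (φ t) K = fun x =>
        ((ε ^ 2)⁻¹ * deriv F (u t x) - ε⁻¹ * φ t x) -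
          InnerProductSpace.laplacianWithin (u t) (CahnHilliardFEM.cell K) x := by
      intro K
      funext x
      rw [CahnHilliardFEM.elemRes₂]
      ring
    simp only [CahnHilliardFEM.η₂, hres]
    refine CahnHilliardFEM.dualNorm_sq_le_of_galerkin (m := m)
      (b := fun x => (ε ^ 2)⁻¹ * deriv F (u t x) - ε⁻¹ * φ t x) hΩ hbd hconv hN2 hN3 hm hC.le hκ
      hκ1 hr hM happrox hu (fun K hK => ?_) (fun ψ g hψ => ?_) fun χ hχ => ?_
    · exact (continuousOn_const.mul (cfu K hK)).sub
        (continuousOn_const.mul (CahnHilliardFEM.feSpace_continuousOn_cell hφ hK))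
    · exact CahnHilliardFEM.residual₂_eq hε.ne' g
        (CahnHilliardFEM.Triangulation.memLp_of_forall_cell hconv fun K hK =>
          CahnHilliardFEM.memLp_cell (cfu K hK))
        (CahnHilliardFEM.feSpace_memLp hconv hφ) hψ
    · rw [CahnHilliardFEM.residual₂, hsol.eq₂ t ht χ hχ, mul_zero]
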